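/- Let $M$ be a smooth $n$-dimensional manifold, $\pi:E\to M$ a smooth real vector bundle of rank $m$, and let $\mathcal M=\Pi E=(M,\mathcal O_{\mathcal M})$ with $\mathcal O_{\mathcal M}=\Gamma_{\Lambda E^*}$ be the associated supermanifold, with sheaf of superderivations $\mathcal T_{\mathcal M}$. Let $\nabla$ be a connection on $\mathcal M$, i.e. an even morphism of sheaves of real super vector spaces $\nabla:\mathcal T_{\mathcal M}\otimes_{\mathbb R}\mathcal T_{\mathcal M}\to\mathcal T_{\mathcal M}$ which is $\mathcal O_{\mathcal M}$-linear in the first argument and satisfies $\nabla_X(fY)=X(f)Y+(-1)^{|X||f|}f\nabla_XY$. For $U\subset M$ open put $\mathcal F(U)=\Gamma_{\mathbb R\oplus E^*}(U)\subset\mathcal O_{\mathcal M}(U)$, let $pr:\mathcal O_{\mathcal M}\to\mathcal F$ be the projection killing the parts of degree $\ge 2$, and for $s=s_0+s_1\in\mathcal F(U)$ let $\psi(s)$ be the function $e\mapsto s_0(\pi(e))+s_1(\pi(e))(e)$ on $\pi^{-1}(U)$. Let $\mathcal L_{\bar 0}(U)$ be the set of even $X\in\mathcal T_{\mathcal M}(U)$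 with $X(\mathcal F)\subset\mathcal F$, and for $X\in\mathcal L_{\bar 0}(U)$ let $\Psi(X)$ be the smooth vector field on $\pi^{-1}(U)$ with $\Psi(X)(\psi(f))=\psi(X(f))$ for all local sections $f$ of $\mathcal F$ over $U$. The reduction $\nabla^{TE}$ of $\nabla$ is the smooth connection on (the tangent bundle of) the manifold $E$ determined by $$\big(\nabla^{TE}_{\Psi(X)}\Psi(Y)\big)(\psi(f))=\psi\big(pr\big((\nabla_XY)(f)\big)\big)$$ for all open $U\subset M$, all $X,Y\in\mathcal L_{\bar 0}(U)$ and all local sections $f$ of $\mathcal F$ over $U$. Let $(x_i)_{1\le i\le n}$ be local coordinates of $M$ and let $E$ be trivialized with linear fibre coordinates $(e_\alpha^*)_{1\le\alpha\le m}$, both over an open set $U\subset M$. Let $\partial_i=\partial_{x_i}$, $\partial_\alpha=\partial_{e_\alpha^*}$ be the coordinate vector fields of the coordinates $(x_i,e_\alpha^*)$ on $\pi^{-1}(U)\subset E$, and let $\hat\partial_i$ (even) and $\hat\partial_\alpha$ (odd) be the coordinate superderivations on $U$: $\hat\partial_i$ acts on smooth functions as $\partial_{x_i}$ and annihilates every $e_\beta^*$;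 $\hat\partial_\alpha$ annihilates smooth functions and maps $e_\beta^*$ to $\delta_{\alpha\beta}$. Denote by $\Gamma_{su}^r\in\mathcal O_{\mathcal M}(U)$ the Christoffel symbols of $\nabla$, $\nabla_{\hat\partial_s}\hat\partial_u=\sum_r\Gamma_{su}^r\hat\partial_r$, and by ${\Gamma^{TE}}_{su}^r$ those of $\nabla^{TE}$, $\nabla^{TE}_{\partial_s}\partial_u=\sum_r{\Gamma^{TE}}_{su}^r\partial_r$ on $\pi^{-1}(U)$, where $s,u,r$ run over all base and fibre indices; let $\widetilde f\in C^\infty(U)$ denote the reduction (degree-$0$ part) of a superfunction $f$. Then $\nabla^{TE}$, the derivations $\hat\partial_i,\hat\partial_\alpha$ and the symbols $\Gamma$, $\Gamma^{TE}$ exist (the derivations and $\Gamma$ uniquely), and for all base indices $i,j,k$ and all fibre indices $\alpha,\beta,\gamma$, on $\pi^{-1}(U)$, $${\Gamma^{TE}}_{ij}^k=\widetilde{\Gamma_{ij}^k}\circ\pi,\qquad {\Gamma^{TE}}_{ij}^\alpha=\sum_\delta e_\delta^*\,\big(\widetilde{\hat\partial_\delta\Gamma_{ij}^\alpha}\circ\pi\big),$$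 $${\Gamma^{TE}}_{i\alpha}^\gamma=\widetilde{\Gamma_{i\alpha}^\gamma}\circ\pi,\qquad {\Gamma^{TE}}_{\alpha i}^\gamma=\widetilde{\Gamma_{\alpha i}^\gamma}\circ\pi,$$ $${\Gamma^{TE}}_{i\alpha}^k={\Gamma^{TE}}_{\alpha i}^k={\Gamma^{TE}}_{\alpha\beta}^k={\Gamma^{TE}}_{\alpha\beta}^\gamma=0.$$ -/

import Mathlib

open scoped Manifold ContDiff Topology
open Bundle TopologicalSpace

namespace SuperRed

/-- The model space `ℝᵏ`. -/
abbrev Eu (k : ℕ) := EuclideanSpace ℝ (Fin k)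

section ExteriorFacts

variable {W : Type*} [AddCommGroup W] [Module ℝ W]

/-- The parity involution of an exterior algebra: `+1` on even elements, `-1` on odd ones. -/
noncomputable def invol : ExteriorAlgebra ℝ W →ₐ[ℝ] ExteriorAlgebra ℝ W :=
  CliffordAlgebra.involute

theorem invol_invol (a : ExteriorAlgebra ℝ W) : invol (invol a) = a :=
  CliffordAlgebra.involute_involute a

theorem invol_ι (v : W) : invol (ExteriorAlgebra.ι ℝ v) = -ExteriorAlgebra.ι ℝ v :=
  CliffordAlgebra.involute_ι v

theorem ι_mul_eq (v : W) (b : ExteriorAlgebra ℝ W) :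
    ExteriorAlgebra.ι ℝ v * b = invol b * ExteriorAlgebra.ι ℝ v := by
  induction b using ExteriorAlgebra.induction with
  | algebraMap r => simpa using (Algebra.commutes r (ExteriorAlgebra.ι ℝ v)).symm
  | ι w =>
    rw [invol_ι, neg_mul, eq_neg_iff_add_eq_zero]
    exact ExteriorAlgebra.ι_add_mul_swap v w
  | mul a b ha hb => rw [← mul_assoc, ha, mul_assoc, hb, ← mul_assoc, map_mul]
  | add a b ha hb => rw [mul_add, ha, hb, ← add_mul, map_add]

theorem supercomm_aux (a : ExteriorAlgebra ℝ W) :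
    (∀ b, (a + invol a) * b = b * (a + invol a)) ∧
      ∀ b, (a - invol a) * b = invol b * (a - invol a) := by
  induction a using ExteriorAlgebra.induction with
  | algebraMap r =>
    simp only [AlgHom.commutes, sub_self, zero_mul, mul_zero, implies_true, and_true]
    intro b
    rw [← map_add]
    exact Algebra.commutes _ _
  | ι w =>
    simp only [invol_ι, add_neg_cancel, zero_mul, mul_zero, implies_true, true_and, sub_neg_eq_add]
    intro b
    rw [add_mul, ι_mul_eq, ← mul_add]
  | mul a c ha hc =>
    have e0 : a * c + invol (a * c) = (1 / 2 : ℝ) • ((a + invol a) * (c + invol c) +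
        (a - invol a) * (c - invol c)) := by
      rw [map_mul]
      have : (a + invol a) * (c + invol c) + (a - invol a) * (c - invol c)
        = (2 : ℝ) • (a * c + invol a * invol c) := by
        rw [two_smul]; noncomm_ring
      rw [this, smul_smul]; norm_num
    have e1 : a * c - invol (a * c) = (1 / 2 : ℝ) • ((a + invol a) * (c - invol c) +
        (a - invol a) * (c + invol c)) := by
      rw [map_mul]
      have : (a + invol a) * (c - invol c) + (a - invol a) * (c + invol c)
        = (2 : ℝ) • (a * c - invol a * invol c) := by
        rw [two_smul]; noncomm_ring
      rw [this, smul_smul]; norm_num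
    refine ⟨fun b => ?_, fun b => ?_⟩
    · rw [e0, smul_mul_assoc, mul_smul_comm]
      congr 1
      rw [add_mul, mul_add b]
      congr 1
      · rw [mul_assoc, hc.1, ← mul_assoc, ha.1, mul_assoc]
      · rw [mul_assoc, hc.2, ← mul_assoc, ha.2, invol_invol, mul_assoc]
    · rw [e1, smul_mul_assoc, mul_smul_comm]
      congr 1
      rw [add_mul, mul_add (invol b)]
      congr 1
      · rw [mul_assoc, hc.2, ← mul_assoc, ha.1, mul_assoc]
      · rw [mul_assoc, hc.1, ← mul_assoc, ha.2, mul_assoc]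
  | add a c ha hc =>
    refine ⟨fun b => ?_, fun b => ?_⟩
    · rw [map_add, add_add_add_comm, add_mul, mul_add b, ha.1, hc.1]
    · rw [map_add, add_sub_add_comm, add_mul, mul_add (invol b), ha.2, hc.2]

theorem even_comm {a : ExteriorAlgebra ℝ W} (ha : invol a = a) (b : ExteriorAlgebra ℝ W) :
    a * b = b * a := by
  have h := (supercomm_aux a).1 b
  rw [ha, ← two_smul ℝ a, smul_mul_assoc, mul_smul_comm] at h
  exact smul_right_injective _ (two_ne_zero (α := ℝ)) h

theorem odd_comm {a : ExteriorAlgebra ℝ W} (ha : invol a = -a) (b : ExteriorAlgebra ℝ W) :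
    a * b = invol b * a := by
  have h := (supercomm_aux a).2 b
  rw [ha, sub_neg_eq_add, ← two_smul ℝ a, smul_mul_assoc, mul_smul_comm] at h
  exact smul_right_injective _ (two_ne_zero (α := ℝ)) h

end ExteriorFacts

section Superfunctions

variable (n m : ℕ) {M : Type*} [TopologicalSpace M] [ChartedSpace (Eu n) M]
  (V : M → Type*) [∀ x, AddCommGroup (V x)] [∀ x, Module ℝ (V x)]
  [TopologicalSpace (TotalSpace (Eu m) V)] [∀ x, TopologicalSpace (V x)]
  [FiberBundle (Eu m) V]

/-- The fibre `Λ(E_x^*)` of the bundle `ΛE^*`. -/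
abbrev LamFib (x : M) := ExteriorAlgebra ℝ (Module.Dual ℝ (V x))

/-- The (not necessarily continuous) sections of `ΛE^*` which over the open set `W` are either a
smooth function, or a smooth section of `E^*`. A section `φ` of `E^*` is smooth over `W` iff the
fibrewise linear function `v ↦ φ(v)` that it defines on `E|_W` is smooth. -/
def smoothGen (W : Set M) : Set (Π x : M, LamFib V x) :=
  {s | (∃ f : M → ℝ, ContMDiffOn (𝓡 n) 𝓘(ℝ) ∞ f W ∧ ∀ x, s x = algebraMap ℝ _ (f x)) ∨
    ∃ φ : Π x : M, Module.Dual ℝ (V x),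
      ContMDiffOn ((𝓡 n).prod 𝓘(ℝ, Eu m)) 𝓘(ℝ) ∞
        (fun v : TotalSpace (Eu m) V => φ v.1 v.2) (TotalSpace.proj ⁻¹' W) ∧
      ∀ x, s x = ExteriorAlgebra.ι ℝ (φ x)}

variable {n m V} in
theorem smoothGen_mono {W W' : Set M} (h : W' ⊆ W) : smoothGen n m V W ⊆ smoothGen n m V W' := by
  rintro s (⟨f, hf, hs⟩ | ⟨φ, hφ, hs⟩)
  · exact Or.inl ⟨f, hf.mono h, hs⟩
  · exact Or.inr ⟨φ, hφ.mono (Set.preimage_mono h), hs⟩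

/-- The algebra of superfunctions over the open set `U`: sections of `ΛE^*` which are, locally,
polynomials in smooth functions and smooth sections of `E^*`. -/
def smoothSec (U : Opens M) : Subalgebra ℝ (Π x : U, LamFib V (x : M)) where
  carrier := {s | ∀ x₀ : U, ∃ W : Set M, IsOpen W ∧ (x₀ : M) ∈ W ∧
    ∃ t ∈ Algebra.adjoin ℝ (smoothGen n m V W), ∀ x : U, (x : M) ∈ W → s x = t x}
  mul_mem' := by
    intro a b ha hb x₀
    obtain ⟨W, hW, hx, t, ht, hs⟩ := ha x₀
    obtain ⟨W', hW', hx', t', ht', hs'⟩ := hb x₀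
    refine ⟨W ∩ W', hW.inter hW', ⟨hx, hx'⟩, t * t', mul_mem ?_ ?_, fun x h => ?_⟩
    · exact Algebra.adjoin_mono (smoothGen_mono Set.inter_subset_left) ht
    · exact Algebra.adjoin_mono (smoothGen_mono Set.inter_subset_right) ht'
    · simp [hs x h.1, hs' x h.2]
  add_mem' := by
    intro a b ha hb x₀
    obtain ⟨W, hW, hx, t, ht, hs⟩ := ha x₀
    obtain ⟨W', hW', hx', t', ht', hs'⟩ := hb x₀
    refine ⟨W ∩ W', hW.inter hW', ⟨hx, hx'⟩, t + t', add_mem ?_ ?_, fun x h => ?_⟩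
    · exact Algebra.adjoin_mono (smoothGen_mono Set.inter_subset_left) ht
    · exact Algebra.adjoin_mono (smoothGen_mono Set.inter_subset_right) ht'
    · simp [hs x h.1, hs' x h.2]
  algebraMap_mem' := fun r x₀ =>
    ⟨Set.univ, isOpen_univ, trivial, algebraMap ℝ _ r, Subalgebra.algebraMap_mem _ r,
      fun x _ => rfl⟩

/-- The algebra `O(U) = Γ(U, ΛE^*)` of superfunctions over the open set `U`. -/
def O (U : Opens M) : Type _ := ↥(smoothSec n m V U)

noncomputable instance (U : Opens M) : Ring (O n m V U) :=
  inferInstanceAs (Ring ↥(smoothSec n m V U))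

noncomputable instance (U : Opens M) : Algebra ℝ (O n m V U) :=
  inferInstanceAs (Algebra ℝ ↥(smoothSec n m V U))

variable {n m V}

/-- The section of `ΛE^*` underlying a superfunction. -/
def O.val {U : Opens M} (s : O n m V U) : Π x : U, LamFib V (x : M) := Subtype.val s

theorem O.ext {U : Opens M} {s t : O n m V U} (h : ∀ x, s.val x = t.val x) : s = t :=
  Subtype.ext (funext h)

/-- Restriction of superfunctions. -/
noncomputable def O.res {U W : Opens M} (h : W ≤ U) : O n m V U →ₐ[ℝ] O n m V W where
  toFun s := ⟨fun x => s.val ⟨x, h x.2⟩, fun x₀ => by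
    obtain ⟨W', hW', hx, t, ht, hs⟩ := s.2 ⟨x₀, h x₀.2⟩
    exact ⟨W', hW', hx, t, ht, fun x hxW => hs ⟨x, h x.2⟩ hxW⟩⟩
  map_one' := rfl
  map_mul' _ _ := rfl
  map_zero' := rfl
  map_add' _ _ := rfl
  commutes' _ := rfl

theorem invol_mem_adjoin {W : Set M} {t : Π x : M, LamFib V x}
    (ht : t ∈ Algebra.adjoin ℝ (smoothGen n m V W)) :
    (fun x => invol (t x)) ∈ Algebra.adjoin ℝ (smoothGen n m V W) := by
  induction ht using Algebra.adjoin_induction with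
  | mem s hs =>
    rcases hs with ⟨f, hf, hs⟩ | ⟨φ, hφ, hs⟩
    · have : (fun x => invol (s x)) = s := by
        funext x; rw [hs x]; exact AlgHom.commutes _ _
      rw [this]
      exact Algebra.subset_adjoin (Or.inl ⟨f, hf, hs⟩)
    · have : (fun x => invol (s x)) = -s := by
        funext x; simp only [Pi.neg_apply, hs x]; exact invol_ι _
      rw [this]
      exact neg_mem (Algebra.subset_adjoin (Or.inr ⟨φ, hφ, hs⟩))
  | algebraMap r =>
    have : (fun x => invol ((algebraMap ℝ (Π x : M, LamFib V x) r) x)) =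
        algebraMap ℝ (Π x : M, LamFib V x) r := by
      funext x; exact AlgHom.commutes _ _
    rw [this]
    exact Subalgebra.algebraMap_mem _ r
  | add a b _ _ ha hb =>
    have : (fun x => invol ((a + b) x)) = (fun x => invol (a x)) + fun x => invol (b x) := by
      funext x; simp
    rw [this]; exact add_mem ha hb
  | mul a b _ _ ha hb =>
    have : (fun x => invol ((a * b) x)) = (fun x => invol (a x)) * fun x => invol (b x) := by
      funext x; simp
    rw [this]; exact mul_mem ha hb

/-- The parity involution `f ↦ (-1)^{|f|} f` of `O(U)`. -/
noncomputable def O.sig (U : Opens M) : O n m V U →ₐ[ℝ] O n m V U where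
  toFun s := ⟨fun x => invol (s.val x), fun x₀ => by
    obtain ⟨W', hW', hx, t, ht, hs⟩ := s.2 x₀
    exact ⟨W', hW', hx, _, invol_mem_adjoin ht, fun x hxW => congrArg invol (hs x hxW)⟩⟩
  map_one' := O.ext fun x => map_one invol
  map_mul' a b := O.ext fun x => map_mul invol (a.val x) (b.val x)
  map_zero' := O.ext fun x => map_zero invol
  map_add' a b := O.ext fun x => map_add invol (a.val x) (b.val x)
  commutes' r := O.ext fun x => AlgHom.commutes invol r

theorem O.sig_sig {U : Opens M} (f : O n m V U) : O.sig U (O.sig U f) = f :=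
  O.ext fun x => invol_invol (f.val x)

theorem O.res_sig {U W : Opens M} (h : W ≤ U) (f : O n m V U) :
    O.res h (O.sig U f) = O.sig W (O.res h f) := rfl

/-- The involution `f ↦ (-1)^{p|f|} f`. -/
noncomputable def O.sigPow (U : Opens M) (p : ZMod 2) : O n m V U →ₐ[ℝ] O n m V U :=
  if p = 0 then AlgHom.id ℝ _ else O.sig U

theorem zmod_cases (p : ZMod 2) : p = 0 ∨ p = 1 := by decide +revert

/-- The sign `(-1)^p`. -/
def sgn (p : ZMod 2) : ℝ := if p = 0 then 1 else -1

/-- Homogeneous superfunctions of parity `p`. -/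
def O.IsHom {U : Opens M} (p : ZMod 2) (f : O n m V U) : Prop := O.sig U f = sgn p • f

theorem O.IsHom.mul_comm {U : Opens M} {p : ZMod 2} {f : O n m V U} (hf : O.IsHom p f)
    (g : O n m V U) : f * g = O.sigPow U p g * f := by
  rcases zmod_cases p with rfl | rfl
  · refine O.ext fun x => even_comm (a := f.val x) ?_ (g.val x)
    have h : O.sig U f = f := by simpa [O.IsHom, sgn] using hf
    exact congrFun (congrArg O.val h) x
  · refine O.ext fun x => odd_comm (a := f.val x) ?_ (g.val x)
    have h : O.sig U f = -f := by simpa [O.IsHom, sgn] using hf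
    exact congrFun (congrArg O.val h) x

/-! ### Superderivations -/

variable (n m V) in
/-- Families of `ℝ`-linear operators `O(W) → O(W)`, for the open sets `W ⊆ U`. -/
abbrev Op (U : Opens M) := ∀ W : Set.Iic U, O n m V W.1 →ₗ[ℝ] O n m V W.1

variable (n m V) in
/-- The homogeneous superderivations over `U`, of parity `p`, of the sheaf of superfunctions:
sheaf morphisms `X : O|_U → O|_U` of parity `p` with `X(fg) = X(f)g + (-1)^{p|f|} f X(g)`. -/
def derHom (U : Opens M) (p : ZMod 2) : Submodule ℝ (Op n m V U) where
  carrier := {X |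
    (∀ (W W' : Set.Iic U) (h : W'.1 ≤ W.1) (f : O n m V W.1),
      O.res h (X W f) = X W' (O.res h f)) ∧
    (∀ (W : Set.Iic U) (f : O n m V W.1), O.sig W.1 (X W f) = sgn p • X W (O.sig W.1 f)) ∧
    ∀ (W : Set.Iic U) (f g : O n m V W.1),
      X W (f * g) = X W f * g + O.sigPow W.1 p f * X W g}
  add_mem' := by
    rintro X Y ⟨h1, h2, h3⟩ ⟨k1, k2, k3⟩
    refine ⟨fun W W' h f => ?_, fun W f => ?_, fun W f g => ?_⟩
    · simp [h1 W W' h f, k1 W W' h f]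
    · simp [h2, k2]
    · simp only [Pi.add_apply, LinearMap.add_apply, h3, k3, add_mul, mul_add]; abel
  zero_mem' := by
    refine ⟨fun W W' h f => ?_, fun W f => ?_, fun W f g => ?_⟩ <;> simp
  smul_mem' := by
    rintro c X ⟨h1, h2, h3⟩
    refine ⟨fun W W' h f => ?_, fun W f => ?_, fun W f g => ?_⟩
    · simp [h1 W W' h f]
    · simp [h2, smul_comm c]
    · simp [h3]

variable (n m V) in
/-- The superderivations `T(U)` of the sheaf of superfunctions over `U`: sums of an even and an
odd superderivation. -/
def T (U : Opens M) : Type _ := ↥(derHom n m V U 0 ⊔ derHom n m V U 1)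

noncomputable instance (U : Opens M) : AddCommGroup (T n m V U) :=
  inferInstanceAs (AddCommGroup ↥(derHom n m V U 0 ⊔ derHom n m V U 1))

noncomputable instance (U : Opens M) : Module ℝ (T n m V U) :=
  inferInstanceAs (Module ℝ ↥(derHom n m V U 0 ⊔ derHom n m V U 1))

/-- The family of operators underlying a superderivation. -/
def T.val {U : Opens M} (X : T n m V U) : Op n m V U := Subtype.val X

/-- `X` is homogeneous of parity `p`. -/
def T.IsHom {U : Opens M} (p : ZMod 2) (X : T n m V U) : Prop := X.val ∈ derHom n m V U p

/-- The value `X(f)`, for `f` a superfunction over an open subset `W` of `U`. -/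
def T.app {U : Opens M} (X : T n m V U) {W : Opens M} (h : W ≤ U) :
    O n m V W →ₗ[ℝ] O n m V W := X.val ⟨W, h⟩

/-- Restriction of families of operators to a smaller open set. -/
def Op.res {U W : Opens M} (h : W ≤ U) (X : Op n m V U) : Op n m V W :=
  fun W' => X ⟨W'.1, le_trans W'.2 h⟩

theorem Op.res_mem {U W : Opens M} (h : W ≤ U) {p : ZMod 2} {X : Op n m V U}
    (hX : X ∈ derHom n m V U p) : Op.res h X ∈ derHom n m V W p :=
  ⟨fun W₁ W₂ h' f => hX.1 ⟨W₁.1, le_trans W₁.2 h⟩ ⟨W₂.1, le_trans W₂.2 h⟩ h' f,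
    fun W₁ f => hX.2.1 ⟨W₁.1, le_trans W₁.2 h⟩ f,
    fun W₁ f g => hX.2.2 ⟨W₁.1, le_trans W₁.2 h⟩ f g⟩

theorem Op.res_add {U W : Opens M} (h : W ≤ U) (X Y : Op n m V U) :
    Op.res h (X + Y) = Op.res h X + Op.res h Y := by
  funext W'; rfl

/-- Restriction of superderivations. -/
def T.res {U W : Opens M} (h : W ≤ U) (X : T n m V U) : T n m V W :=
  ⟨Op.res h X.val, by
    obtain ⟨Y, hY, Z, hZ, e⟩ := Submodule.mem_sup.1 (Subtype.property X)
    change Op.res h (Subtype.val X) ∈ _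
    rw [← e, Op.res_add]
    exact Submodule.add_mem_sup (Op.res_mem h hY) (Op.res_mem h hZ)⟩

/-- The operators `g ↦ f X(g)`. -/
noncomputable def Op.mulLeft {U : Opens M} (f : O n m V U) (X : Op n m V U) : Op n m V U :=
  fun W => (LinearMap.mulLeft ℝ (O.res W.2 f)) ∘ₗ X W

theorem Op.mulLeft_add {U : Opens M} (f : O n m V U) (X Y : Op n m V U) :
    Op.mulLeft f (X + Y) = Op.mulLeft f X + Op.mulLeft f Y := by
  funext W
  refine LinearMap.ext fun g => ?_
  exact mul_add (O.res W.2 f) (X W g) (Y W g)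

theorem Op.add_mulLeft {U : Opens M} (a b : O n m V U) (Z : Op n m V U) :
    Op.mulLeft (a + b) Z = Op.mulLeft a Z + Op.mulLeft b Z := by
  funext W
  refine LinearMap.ext fun g => ?_
  change O.res W.2 (a + b) * Z W g = O.res W.2 a * Z W g + O.res W.2 b * Z W g
  rw [map_add, add_mul]

theorem Op.mulLeft_mem {U : Opens M} {p q : ZMod 2} {f : O n m V U} (hf : O.IsHom p f)
    {X : Op n m V U} (hX : X ∈ derHom n m V U q) :
    Op.mulLeft f X ∈ derHom n m V U (p + q) := by
  obtain ⟨h1, h2, h3⟩ := hX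
  have hres : ∀ W : Set.Iic U, O.IsHom p (O.res W.2 f) := fun W => by
    have := congrArg (O.res W.2) hf
    rw [map_smul] at this
    exact this
  have hsgn : sgn p * sgn q = sgn (p + q) := by
    rcases zmod_cases p with rfl | rfl
    all_goals
      rcases zmod_cases q with rfl | rfl
      all_goals simp [sgn, show (1 : ZMod 2) + 1 = 0 from rfl]
  have hpow : ∀ (W : Opens M) (g : O n m V W),
      O.sigPow W p (O.sigPow W q g) = O.sigPow W (p + q) g := by
    intro W g
    rcases zmod_cases p with rfl | rfl
    all_goals
      rcases zmod_cases q with rfl | rfl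
      all_goals simp [O.sigPow, show (1 : ZMod 2) + 1 = 0 from rfl, O.sig_sig]
  refine ⟨fun W W' h g => ?_, fun W g => ?_, fun W a b => ?_⟩
  · change O.res h (O.res W.2 f * X W g) = O.res W'.2 f * X W' (O.res h g)
    rw [map_mul, h1]; rfl
  · change O.sig W.1 (O.res W.2 f * X W g) = sgn (p + q) • (O.res W.2 f * X W (O.sig W.1 g))
    rw [map_mul, hres W, h2, smul_mul_smul_comm, hsgn]
  · change O.res W.2 f * X W (a * b) =
      O.res W.2 f * X W a * b + O.sigPow W.1 (p + q) a * (O.res W.2 f * X W b)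
    rw [h3, mul_add, ← mul_assoc, ← mul_assoc, (hres W).mul_comm (O.sigPow W.1 q a), hpow,
      mul_assoc (O.sigPow W.1 (p + q) a)]

theorem O.exists_hom_add {U : Opens M} (f : O n m V U) :
    ∃ a b : O n m V U, O.IsHom 0 a ∧ O.IsHom 1 b ∧ f = a + b := by
  refine ⟨(1 / 2 : ℝ) • (f + O.sig U f), (1 / 2 : ℝ) • (f - O.sig U f), ?_, ?_, ?_⟩
  · unfold O.IsHom
    rw [map_smul, map_add, O.sig_sig, sgn, if_pos rfl, one_smul, add_comm]
  · unfold O.IsHom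
    rw [map_smul, map_sub, O.sig_sig, sgn, if_neg one_ne_zero, neg_smul, one_smul, ← smul_neg,
      neg_sub]
  · rw [← smul_add, add_add_sub_cancel, ← two_smul ℝ f, smul_smul]
    norm_num

theorem Op.mulLeft_mem_sup {U : Opens M} (f : O n m V U) {X : Op n m V U}
    (hX : X ∈ derHom n m V U 0 ⊔ derHom n m V U 1) :
    Op.mulLeft f X ∈ derHom n m V U 0 ⊔ derHom n m V U 1 := by
  obtain ⟨Y, hY, Z, hZ, rfl⟩ := Submodule.mem_sup.1 hX
  obtain ⟨a, b, ha, hb, rfl⟩ := O.exists_hom_add f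
  rw [Op.mulLeft_add, Op.add_mulLeft, Op.add_mulLeft]
  have h1 := Op.mulLeft_mem ha hY
  have h2 := Op.mulLeft_mem hb hY
  have h3 := Op.mulLeft_mem ha hZ
  have h4 := Op.mulLeft_mem hb hZ
  rw [add_zero] at h1 h2
  rw [zero_add] at h3
  rw [show (1 : ZMod 2) + 1 = 0 from rfl] at h4
  exact Submodule.add_mem _
    (Submodule.add_mem _ (Submodule.mem_sup_left h1) (Submodule.mem_sup_right h2))
    (Submodule.add_mem _ (Submodule.mem_sup_right h3) (Submodule.mem_sup_left h4))

/-- The left `O(U)`-module structure of `T(U)`: `(f X)(g) = f X(g)`. -/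
noncomputable def T.smul {U : Opens M} (f : O n m V U) (X : T n m V U) : T n m V U :=
  ⟨Op.mulLeft f X.val, Op.mulLeft_mem_sup f (Subtype.property X)⟩

variable (n m V) in
/-- A connection on the supermanifold `ΠE = (M, Γ(ΛE^*))`: an even morphism of sheaves of real
super vector spaces `∇ : T ⊗_ℝ T → T`, `O`-linear in the first argument, with the Leibniz rule
`∇_X (f Y) = X(f) Y + (-1)^{|X||f|} f ∇_X Y`. -/
structure SuperConnection where
  /-- `cov U X Y` is `∇_X Y` for `X, Y` in `T(U)`. -/
  cov : ∀ U : Opens M, T n m V U →ₗ[ℝ] T n m V U →ₗ[ℝ] T n m V U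
  res_cov : ∀ (U W : Opens M) (h : W ≤ U) (X Y : T n m V U),
    T.res h (cov U X Y) = cov W (T.res h X) (T.res h Y)
  even : ∀ (U : Opens M) (p q : ZMod 2) (X Y : T n m V U),
    X.IsHom p → Y.IsHom q → (cov U X Y).IsHom (p + q)
  smul_left : ∀ (U : Opens M) (f : O n m V U) (X Y : T n m V U),
    cov U (T.smul f X) Y = T.smul f (cov U X Y)
  leibniz : ∀ (U : Opens M) (p : ZMod 2) (f : O n m V U) (X Y : T n m V U), X.IsHom p →
    cov U X (T.smul f Y) =
      T.smul (X.app le_rfl f) Y + T.smul (O.sigPow U p f) (cov U X Y)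

/-! ### Superfunctions of degree at most one and fibrewise affine functions -/

/-- The projection `pr` of `Λ(E_x^*)` onto `ℝ ⊕ E_x^*`, killing the parts of degree `≥ 2`. -/
noncomputable def pr (x : M) : LamFib V x →ₗ[ℝ] LamFib V x :=
  Algebra.linearMap ℝ _ ∘ₗ ExteriorAlgebra.algebraMapInv.toLinearMap +
    ExteriorAlgebra.ι ℝ ∘ₗ ExteriorAlgebra.ιInv

/-- `s ∈ F(U) = Γ(U, ℝ ⊕ E^*)`. -/
def O.MemF {U : Opens M} (s : O n m V U) : Prop := ∀ x : U, pr (x : M) (s.val x) = s.val x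

/-- For `s = s₀ + s₁` in `F(U)`, the function `ψ(s)` on `π⁻¹(U)` which maps `e` to
`s₀(π(e)) + s₁(π(e))(e)`, extended by zero. The argument is any section over `U` of
`ΛE^*`, of which only the parts of degree at most one matter. -/
noncomputable def psi {U : Opens M} (s : Π x : U, LamFib V (x : M)) (e : TotalSpace (Eu m) V) : ℝ :=
  open scoped Classical in
  if h : e.1 ∈ U then
    ExteriorAlgebra.algebraMapInv (s ⟨e.1, h⟩) + ExteriorAlgebra.ιInv (s ⟨e.1, h⟩) e.2
  else 0

/-- `X ∈ L₀(U)`: an even superderivation over `U` which preserves `F`. -/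
def T.MemL0 {U : Opens M} (X : T n m V U) : Prop :=
  X.IsHom 0 ∧ ∀ (W : Opens M) (h : W ≤ U) (f : O n m V W), f.MemF → (X.app h f).MemF

end Superfunctions

section Reduction

set_option linter.unusedSectionVars false

variable {n m : ℕ} {M : Type*} [TopologicalSpace M] [ChartedSpace (Eu n) M]
  [IsManifold (𝓡 n) ∞ M]
  {V : M → Type*} [∀ x, AddCommGroup (V x)] [∀ x, Module ℝ (V x)]
  [TopologicalSpace (TotalSpace (Eu m) V)] [∀ x, TopologicalSpace (V x)]
  [FiberBundle (Eu m) V] [VectorBundle ℝ (Eu m) V] [ContMDiffVectorBundle ∞ (Eu m) V (𝓡 n)]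

variable (n m V) in
/-- Vector fields on the total space `E` (not necessarily continuous). -/
abbrev VF := Π e : TotalSpace (Eu m) V, TangentSpace ((𝓡 n).prod 𝓘(ℝ, Eu m)) e

/-- The vector field `X'` is smooth on the set `Ω`. -/
def SmoothVF (X' : VF n m V) (Ω : Set (TotalSpace (Eu m) V)) : Prop :=
  ContMDiffOn ((𝓡 n).prod 𝓘(ℝ, Eu m)) (((𝓡 n).prod 𝓘(ℝ, Eu m)).prod 𝓘(ℝ, Eu n × Eu m)) ∞
    (fun e => (⟨e, X' e⟩ : TotalSpace (Eu n × Eu m)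
      (TangentSpace ((𝓡 n).prod 𝓘(ℝ, Eu m)) : TotalSpace (Eu m) V → Type _))) Ω

/-- The derivative of the function `g` on `E` along `X'` at the point `e`. -/
noncomputable def dirDeriv (X' : VF n m V) (g : TotalSpace (Eu m) V → ℝ)
    (e : TotalSpace (Eu m) V) : ℝ :=
  mfderiv ((𝓡 n).prod 𝓘(ℝ, Eu m)) 𝓘(ℝ) g e (X' e)

/-- `X' = Ψ(X)`, for `X ∈ L₀(U)` and `X'` a smooth vector field on `π⁻¹(U)`, i.e.
`X' ∘ ψ = ψ ∘ X` on `F`. -/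
def IsPsi {U : Opens M} (X : T n m V U) (X' : VF n m V) : Prop :=
  SmoothVF X' (TotalSpace.proj ⁻¹' (U : Set M)) ∧
  ∀ (W : Opens M) (h : W ≤ U) (f : O n m V W), f.MemF → ∀ e : TotalSpace (Eu m) V, e.1 ∈ W →
    dirDeriv X' (psi f.val) e = psi (X.app h f).val e

variable (n m V) in
/-- Covariant derivatives on the tangent bundle of the manifold `E`. -/
abbrev ConnE := CovariantDerivative ((𝓡 n).prod 𝓘(ℝ, Eu m)) (Eu n × Eu m)
  (TangentSpace ((𝓡 n).prod 𝓘(ℝ, Eu m)) : TotalSpace (Eu m) V → Type _)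

/-- `D = ∇^{TE}`: the smooth connection `D` on `E` satisfies
`D_{Ψ(X)} Ψ(Y) = Ψ(p(∇_X Y))`, where `p(Z) = pr ∘ Z|_F`, for all `X, Y ∈ L₀(U)`, `U ⊆ M` open. -/
structure IsReduction (nab : SuperConnection n m V) (D : ConnE n m V) : Prop where
  smooth : ∀ Ω : Set (TotalSpace (Eu m) V), IsOpen Ω →
    ContMDiffCovariantDerivativeOn (Eu n × Eu m) ∞ D.toFun Ω
  compat : ∀ (U : Opens M) (X Y : T n m V U) (X' Y' : VF n m V), X.MemL0 → Y.MemL0 →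
    IsPsi X X' → IsPsi Y Y' →
    ∀ (W : Opens M) (h : W ≤ U) (f : O n m V W), f.MemF → ∀ e : TotalSpace (Eu m) V, e.1 ∈ W →
      dirDeriv (fun e' => D Y' e' (X' e')) (psi f.val) e =
        psi (fun x => pr (x : M) (((nab.cov U X Y).app h f).val x)) e

/-! ### Coordinates -/

variable (n m V) in
/-- Local coordinates `x_i` of `M` together with a local trivialization of `E`. -/
structure BundleCoords where
  chart : OpenPartialHomeomorph M (Eu n)
  chart_mem : chart ∈ IsManifold.maximalAtlas (𝓡 n) ∞ M
  triv : Trivialization (Eu m) (π (Eu m) V)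
  linear : triv.IsLinear ℝ
  smooth : ContMDiffOn ((𝓡 n).prod 𝓘(ℝ, Eu m)) ((𝓡 n).prod 𝓘(ℝ, Eu m)) ∞ triv triv.source
  smooth_symm : ContMDiffOn ((𝓡 n).prod 𝓘(ℝ, Eu m)) ((𝓡 n).prod 𝓘(ℝ, Eu m)) ∞
    triv.toOpenPartialHomeomorph.symm triv.target

namespace BundleCoords

variable (c : BundleCoords n m V)

/-- The coordinate domain in `M`. -/
def U : Opens M :=
  ⟨c.chart.source ∩ c.triv.baseSet, c.chart.open_source.inter c.triv.open_baseSet⟩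

/-- The fibre coordinate `e_α^*` as a section of `E^*`. -/
noncomputable def eDual (α : Fin m) (x : M) : Module.Dual ℝ (V x) :=
  letI := c.linear
  (EuclideanSpace.proj α : Eu m →L[ℝ] ℝ).toLinearMap ∘ₗ c.triv.linearMapAt ℝ x

theorem eDual_smooth (α : Fin m) :
    ContMDiffOn ((𝓡 n).prod 𝓘(ℝ, Eu m)) 𝓘(ℝ) ∞
      (fun v : TotalSpace (Eu m) V => c.eDual α v.1 v.2)
      (TotalSpace.proj ⁻¹' c.triv.baseSet) := by
  have h1 : ContMDiffOn ((𝓡 n).prod 𝓘(ℝ, Eu m)) 𝓘(ℝ) ∞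
      (fun v : TotalSpace (Eu m) V => (EuclideanSpace.proj α : Eu m →L[ℝ] ℝ) (c.triv v).2)
      (TotalSpace.proj ⁻¹' c.triv.baseSet) := by
    rw [← c.triv.source_eq]
    exact (EuclideanSpace.proj α : Eu m →L[ℝ] ℝ).contMDiff.comp_contMDiffOn
      (contMDiff_snd.comp_contMDiffOn c.smooth)
  refine h1.congr fun v hv => ?_
  have := c.linear
  have hb : v.1 ∈ c.triv.baseSet := hv
  change (EuclideanSpace.proj α : Eu m →L[ℝ] ℝ) (c.triv.linearMapAt ℝ v.1 v.2) = _
  rw [c.triv.coe_linearMapAt_of_mem hb]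

/-- The odd coordinate `e_α^*`, as a superfunction over `W ⊆ U`. -/
noncomputable def eStar (α : Fin m) {W : Opens M} (h : W ≤ c.U) : O n m V W :=
  ⟨fun x => ExteriorAlgebra.ι ℝ (c.eDual α x), fun x₀ =>
    ⟨c.triv.baseSet, c.triv.open_baseSet, (h x₀.2).2, fun x => ExteriorAlgebra.ι ℝ (c.eDual α x),
      Algebra.subset_adjoin (Or.inr ⟨c.eDual α, c.eDual_smooth α, fun _ => rfl⟩), fun _ _ => rfl⟩⟩

end BundleCoords

/-- A smooth function on `W` as a superfunction. -/
noncomputable def O.ofFun {W : Opens M} (f : M → ℝ)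
    (hf : ContMDiffOn (𝓡 n) 𝓘(ℝ) ∞ f (W : Set M)) : O n m V W :=
  ⟨fun x => algebraMap ℝ _ (f x), fun x₀ =>
    ⟨W, W.2, x₀.2, fun x => algebraMap ℝ _ (f x),
      Algebra.subset_adjoin (Or.inl ⟨f, hf, fun _ => rfl⟩), fun _ _ => rfl⟩⟩

/-- The reduction `f̃` of a superfunction, extended by zero outside of `U`. -/
noncomputable def O.red {U : Opens M} (f : O n m V U) (x : M) : ℝ :=
  open scoped Classical in
  if h : x ∈ U then ExteriorAlgebra.algebraMapInv (f.val ⟨x, h⟩) else 0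

namespace BundleCoords

variable (c : BundleCoords n m V)

/-- The indices of the coordinates: `inl i` for `x_i`, `inr α` for `e_α^*`. -/
abbrev Idx (n m : ℕ) := Fin n ⊕ Fin m

/-- `∂ = (∂̂_i, ∂̂_α)` are the coordinate superderivations: `∂̂_i` is even, acts on smooth functions
as the `i`-th partial derivative and annihilates all `e_β^*`; `∂̂_α` is odd, annihilates smooth
functions and maps `e_β^*` to `δ_{αβ}`. -/
structure IsCoordDer (d : Idx n m → T n m V c.U) : Prop where
  even : ∀ i, (d (.inl i)).IsHom 0
  odd : ∀ α, (d (.inr α)).IsHom 1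
  even_fun : ∀ (i : Fin n) (W : Opens M) (h : W ≤ c.U) (f : M → ℝ)
    (hf : ContMDiffOn (𝓡 n) 𝓘(ℝ) ∞ f (W : Set M)) (x : W),
    ((d (.inl i)).app h (O.ofFun f hf)).val x =
      algebraMap ℝ _ (fderiv ℝ (f ∘ c.chart.symm) (c.chart x) (EuclideanSpace.single i 1))
  even_eStar : ∀ (i : Fin n) (β : Fin m) (W : Opens M) (h : W ≤ c.U),
    (d (.inl i)).app h (c.eStar β h) = 0
  odd_fun : ∀ (α : Fin m) (W : Opens M) (h : W ≤ c.U) (f : M → ℝ)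
    (hf : ContMDiffOn (𝓡 n) 𝓘(ℝ) ∞ f (W : Set M)),
    (d (.inr α)).app h (O.ofFun f hf) = 0
  odd_eStar : ∀ (α β : Fin m) (W : Opens M) (h : W ≤ c.U),
    (d (.inr α)).app h (c.eStar β h) = if α = β then 1 else 0

/-- `Γ_{su}^r = Γ s u r` are the Christoffel symbols of `∇` with respect to the coordinate
superderivations `∂̂_s`: `∇_{∂̂_s} ∂̂_u = ∑_r Γ_{su}^r ∂̂_r`. -/
def IsSuperChristoffel (nab : SuperConnection n m V) (d : Idx n m → T n m V c.U)
    (Γ : Idx n m → Idx n m → Idx n m → O n m V c.U) : Prop :=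
  ∀ s u, nab.cov c.U (d s) (d u) = ∑ r, T.smul (Γ s u r) (d r)

/-- The coordinates `(x_i, e_α^*)` on `π⁻¹(U) ⊆ E`. -/
def coordE (e : TotalSpace (Eu m) V) : Eu n × Eu m := (c.chart e.1, (c.triv e).2)

/-- The standard basis of `ℝⁿ × ℝᵐ`. -/
noncomputable def stdVec : Idx n m → Eu n × Eu m
  | .inl i => (EuclideanSpace.single i 1, 0)
  | .inr α => (0, EuclideanSpace.single α 1)

/-- The coordinate vector fields `∂_i, ∂_α` on `π⁻¹(U)`: the preimages of the standard basis
under the differential of the coordinate map. -/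
noncomputable def vf (s : Idx n m) : VF n m V := fun e =>
  (mfderiv ((𝓡 n).prod 𝓘(ℝ, Eu m)) 𝓘(ℝ, Eu n × Eu m) c.coordE e).inverse (stdVec s)

/-- `G_{su}^r = G s u r` are, on `π⁻¹(U)`, the Christoffel symbols of the connection `D` on `E`
with respect to the coordinate vector fields `∂_s`: `D_{∂_s} ∂_u = ∑_r G_{su}^r ∂_r`. -/
def IsChristoffelE (D : ConnE n m V)
    (G : Idx n m → Idx n m → Idx n m → TotalSpace (Eu m) V → ℝ) : Prop :=
  ∀ s u, ∀ e : TotalSpace (Eu m) V, e.1 ∈ c.U →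
    D (c.vf u) e (c.vf s e) = ∑ r, G s u r e • c.vf r e

end BundleCoords

end Reduction

end SuperRed

/-! The theorem rests on one observation: `psi` keeps only the parts of degree at most one, so it is
multiplicative only in a truncated sense. An even `f` has no degree-one part, hence ψ(fg) =
ψ(f)ψ(g), where ψ(f) is the reduction of `f`. An odd `f` has no degree-zero part, hence ψ(fg) =
ψ(f)·g̃. A product of two odd factors is sent to zero.

Over a coordinate domain every superderivation is X = ∑ X^r ∂̂_r with X^r = X(x^r). This follows
from Hadamard's lemma: a derivation that kills the coordinates is zero (`eq_zero_of_coord`). If X is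
even, X^r has the parity of r, and the truncated product rule shows that Ψ(X) = ∑ ψ(X^r) ∂_r
(`isPsi_psiVF`, `IsPsi.eq_psiVF`). For even X the components of the superconnection are (∇_X Y)^r =
X(Y^r) + ∑ Y^u X^s Γ_{su}^r. Applying ψ to this turns Γ_{su}^r into ψ(Γ) for two base indices, into
Γ̃ for mixed indices and into 0 for two fibre indices. These functions are `redChristoffel`. The
connection on π⁻¹(U) with these symbols is therefore a reduction over U
(`isLocalReduction_localConn`).

Conversely, a reduction is tested on the even fields ∂̂_i and e_α^* ∂̂_α, which preserve F. The
result is that its Christoffel symbols agree with `redChristoffel` after multiplication by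
coefficients 1 or e_α^* (`IsLocalReduction.frameCoeff_mul`). These coefficients can vanish, but they
are nonzero at points arbitrarily close by in the same fibre, so continuity gives equality
everywhere (`IsLocalReduction.comp_cov`). Since local reductions are unique, the coordinate
connections agree on overlaps and together form a smooth global one.

The stated formulas are then read off from parity: Γ_{su}^r has parity |s|+|u|+|r|. An odd symbol
has zero reduction, an even one has ψ(Γ) = Γ̃ ∘ π, and for odd Γ the function ψ(Γ) is ∑ e_δ^* times
the reduction of ∂̂_δ Γ. -/

namespace SuperRed

set_option linter.unusedSectionVars false

variable {n m : ℕ} {M : Type*} [TopologicalSpace M] [ChartedSpace (Eu n) M]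
  [IsManifold (𝓡 n) ∞ M]
  {V : M → Type*} [∀ x, AddCommGroup (V x)] [∀ x, Module ℝ (V x)]
  [TopologicalSpace (TotalSpace (Eu m) V)] [∀ x, TopologicalSpace (V x)]
  [FiberBundle (Eu m) V] [VectorBundle ℝ (Eu m) V] [ContMDiffVectorBundle ∞ (Eu m) V (𝓡 n)]

open ExteriorAlgebra (algebraMapInv ιInv)

/-! ### Parts of degree zero and one in an exterior algebra, and contraction. -/

section ExteriorAlgebraFacts

variable {W W' : Type*} [AddCommGroup W] [Module ℝ W] [AddCommGroup W'] [Module ℝ W']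


theorem algebraMapInv_ι (w : W) : algebraMapInv (ExteriorAlgebra.ι ℝ w) = (0 : ℝ) := by
  simp [algebraMapInv]

theorem algebraMapInv_algebraMap (r : ℝ) :
    algebraMapInv (algebraMap ℝ (ExteriorAlgebra ℝ W) r) = r :=
  ExteriorAlgebra.algebraMap_leftInverse W r

theorem ιInv_ι (w : W) : ιInv (ExteriorAlgebra.ι ℝ w) = w :=
  ExteriorAlgebra.ι_leftInverse w

/-- Discarding degrees at least two is an algebra map onto the trivial square-zero extension, and
`ιInv` is its second component. The formula is the product rule there. -/
theorem ιInv_mul (a b : ExteriorAlgebra ℝ W) :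
    ιInv (a * b) = algebraMapInv a • ιInv b + algebraMapInv b • ιInv a := by
  let : Module ℝᵐᵒᵖ W := Module.compHom _ ((RingHom.id ℝ).fromOpposite mul_comm)
  have : IsCentralScalar ℝ W := ⟨fun r m => rfl⟩
  have h1 : ∀ a : ExteriorAlgebra ℝ W,
      (ExteriorAlgebra.toTrivSqZeroExt a : TrivSqZeroExt ℝ W).fst = algebraMapInv a := by
    have : (TrivSqZeroExt.fstHom ℝ ℝ W).comp ExteriorAlgebra.toTrivSqZeroExt = algebraMapInv := by
      ext w
      simp [algebraMapInv]
    exact fun a => DFunLike.congr_fun this a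
  have h2 : ∀ a : ExteriorAlgebra ℝ W,
      (ExteriorAlgebra.toTrivSqZeroExt a : TrivSqZeroExt ℝ W).snd = ιInv a := fun a => rfl
  rw [← h2, map_mul, TrivSqZeroExt.snd_mul, h1, h1, h2, h2]
  rfl

theorem ιInv_algebraMap (r : ℝ) : ιInv (algebraMap ℝ (ExteriorAlgebra ℝ W) r) = 0 := by
  have h := ιInv_mul (W := W) 1 1
  simp only [mul_one, map_one, one_smul, right_eq_add] at h
  rw [Algebra.algebraMap_eq_smul_one, map_smul, h, smul_zero]

theorem algebraMapInv_invol (a : ExteriorAlgebra ℝ W) :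
    algebraMapInv (invol a) = algebraMapInv a := by
  have : (algebraMapInv (R := ℝ) (M := W)).comp invol = algebraMapInv := by
    ext w
    simp [invol_ι, algebraMapInv_ι]
  exact DFunLike.congr_fun this a

theorem ιInv_invol (a : ExteriorAlgebra ℝ W) : ιInv (invol a) = -ιInv a := by
  induction a using ExteriorAlgebra.induction with
  | algebraMap r => rw [AlgHom.commutes, ιInv_algebraMap, neg_zero]
  | ι w => rw [invol_ι, map_neg]
  | mul a b ha hb =>
    rw [map_mul, ιInv_mul, ιInv_mul, ha, hb, algebraMapInv_invol, algebraMapInv_invol, smul_neg,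
      smul_neg, neg_add]
  | add a b ha hb => rw [map_add, map_add, map_add, ha, hb, neg_add]

theorem ιInv_of_even {a : ExteriorAlgebra ℝ W} (h : invol a = a) : ιInv a = 0 := by
  have := ιInv_invol a
  rw [h] at this
  rw [eq_neg_iff_add_eq_zero, ← two_smul ℝ] at this
  exact (smul_eq_zero.1 this).resolve_left two_ne_zero

theorem algebraMapInv_of_odd {a : ExteriorAlgebra ℝ W} (h : invol a = -a) :
    algebraMapInv a = 0 := by
  have := algebraMapInv_invol a
  rw [h, map_neg] at this
  exact neg_eq_self.1 this

/-- The evaluation `a ↦ a₀ + ⟨a₁, v⟩` of the parts of degree at most one. -/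
noncomputable def affEval (v : W) : ExteriorAlgebra ℝ (Module.Dual ℝ W) →ₗ[ℝ] ℝ :=
  algebraMapInv.toLinearMap + Module.Dual.eval ℝ W v ∘ₗ ιInv

theorem affEval_apply (v : W) (a : ExteriorAlgebra ℝ (Module.Dual ℝ W)) :
    affEval v a = algebraMapInv a + ιInv a v := rfl

/-- Compared with the product of the two evaluations, the term a₁(v)b₁(v) is missing, because it
would come from degree two. All vanishing and all reductions in the final formulas come from this
defect. -/
theorem affEval_mul (v : W) (a b : ExteriorAlgebra ℝ (Module.Dual ℝ W)) :
    affEval v (a * b) = algebraMapInv a * affEval v b + ιInv a v * algebraMapInv b := by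
  simp only [affEval_apply, map_mul, ιInv_mul, LinearMap.add_apply, LinearMap.smul_apply,
    smul_eq_mul]
  ring

theorem affEval_of_even (v : W) {a : ExteriorAlgebra ℝ (Module.Dual ℝ W)} (h : invol a = a) :
    affEval v a = algebraMapInv a := by
  rw [affEval_apply, ιInv_of_even h, LinearMap.zero_apply, add_zero]

theorem affEval_of_odd (v : W) {a : ExteriorAlgebra ℝ (Module.Dual ℝ W)} (h : invol a = -a) :
    affEval v a = ιInv a v := by
  rw [affEval_apply, algebraMapInv_of_odd h, zero_add]

/-- Contraction with an element of the dual space. -/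
noncomputable def contract (ξ : Module.Dual ℝ W) : ExteriorAlgebra ℝ W →ₗ[ℝ] ExteriorAlgebra ℝ W :=
  CliffordAlgebra.contractLeft (Q := (0 : QuadraticForm ℝ W)) ξ

theorem contract_algebraMap (ξ : Module.Dual ℝ W) (r : ℝ) : contract ξ (algebraMap ℝ _ r) = 0 :=
  CliffordAlgebra.contractLeft_algebraMap _ ξ r

theorem contract_ι (ξ : Module.Dual ℝ W) (w : W) :
    contract ξ (ExteriorAlgebra.ι ℝ w) = algebraMap ℝ _ (ξ w) :=
  CliffordAlgebra.contractLeft_ι _ ξ w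

theorem contract_ι_mul (ξ : Module.Dual ℝ W) (w : W) (b : ExteriorAlgebra ℝ W) :
    contract ξ (ExteriorAlgebra.ι ℝ w * b) = ξ w • b - ExteriorAlgebra.ι ℝ w * contract ξ b :=
  CliffordAlgebra.contractLeft_ι_mul ξ w b

theorem contract_mul (ξ : Module.Dual ℝ W) (a b : ExteriorAlgebra ℝ W) :
    contract ξ (a * b) = contract ξ a * b + invol a * contract ξ b := by
  induction a using ExteriorAlgebra.induction generalizing b with
  | algebraMap r =>
    rw [contract_algebraMap, zero_mul, zero_add, AlgHom.commutes, ← Algebra.smul_def, map_smul,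
      ← Algebra.smul_def]
  | ι w =>
    rw [contract_ι_mul, contract_ι, invol_ι, Algebra.smul_def, neg_mul, sub_eq_add_neg]
  | mul a c ha hc =>
    rw [mul_assoc, ha, hc, ha, map_mul, add_mul, mul_add, mul_assoc, mul_assoc, mul_assoc,
      add_assoc]
  | add a c ha hc =>
    rw [add_mul, map_add, ha, hc, map_add, map_add, add_mul, add_mul]
    abel

theorem invol_contract (ξ : Module.Dual ℝ W) (a : ExteriorAlgebra ℝ W) :
    invol (contract ξ a) = -contract ξ (invol a) := by
  induction a using ExteriorAlgebra.induction with
  | algebraMap r => rw [AlgHom.commutes, contract_algebraMap, map_zero, neg_zero]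
  | ι w => rw [contract_ι, invol_ι, map_neg, contract_ι, AlgHom.commutes, neg_neg]
  | mul a c ha hc =>
    rw [contract_mul, map_mul, map_add, map_mul, map_mul, contract_mul, ha, hc]
    noncomm_ring
  | add a c ha hc => rw [map_add, map_add, ha, hc, map_add, map_add, neg_add]

/-- This links the odd derivative ∂̂_α to the fibre derivative ∂_α: the reduction of ∂̂_α f is the
slope of the affine function ψ(f) in direction α. -/
theorem algebraMapInv_contract (ξ : Module.Dual ℝ W) (a : ExteriorAlgebra ℝ W) :
    algebraMapInv (contract ξ a) = ξ (ιInv a) := by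
  induction a using ExteriorAlgebra.induction with
  | algebraMap r => rw [contract_algebraMap, ιInv_algebraMap, map_zero, map_zero]
  | ι w => rw [contract_ι, algebraMapInv_algebraMap, ιInv_ι]
  | mul a c ha hc =>
    rw [contract_mul, map_add, map_mul, map_mul, algebraMapInv_invol, ha, hc, ιInv_mul, map_add,
      map_smul, map_smul, smul_eq_mul, smul_eq_mul]
    ring
  | add a c ha hc => simp only [map_add, ha, hc]

theorem algebraMapInv_map (f : W →ₗ[ℝ] W') (a : ExteriorAlgebra ℝ W) :
    algebraMapInv (ExteriorAlgebra.map f a) = algebraMapInv a := by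
  have : (algebraMapInv (R := ℝ)).comp (ExteriorAlgebra.map f) = algebraMapInv := by
    ext w
    simp [algebraMapInv_ι]
  exact DFunLike.congr_fun this a

theorem ιInv_map (f : W →ₗ[ℝ] W') (a : ExteriorAlgebra ℝ W) :
    ιInv (ExteriorAlgebra.map f a) = f (ιInv a) :=
  LinearMap.congr_fun (ExteriorAlgebra.ιInv_comp_map f) a

theorem invol_map (f : W →ₗ[ℝ] W') (a : ExteriorAlgebra ℝ W) :
    invol (ExteriorAlgebra.map f a) = ExteriorAlgebra.map f (invol a) := by
  have : (invol).comp (ExteriorAlgebra.map f) = (ExteriorAlgebra.map f).comp invol := by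
    ext w
    simp [invol_ι]
  exact DFunLike.congr_fun this a

/-- The exterior powers above the rank vanish, so finitely many finite-dimensional ones span.
Finiteness makes every linear map out of `Lam m` continuous, hence smooth, once a norm is chosen. -/
instance finite_exteriorAlgebra [Module.Finite ℝ W] : Module.Finite ℝ (ExteriorAlgebra ℝ W) := by
  have h0 : ∀ i, Module.finrank ℝ W < i → (⋀[ℝ]^i W) = ⊥ := fun i hi =>
    Submodule.finrank_eq_zero.1 (by rw [exteriorPower.finrank_eq, Nat.choose_eq_zero_of_lt hi])
  have h1 : (⨆ i : Fin (Module.finrank ℝ W + 1), ⋀[ℝ]^(i : ℕ) W) = ⊤ := by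
    rw [eq_top_iff, ← (DirectSum.Decomposition.isInternal
      (fun i : ℕ => ⋀[ℝ]^i W)).submodule_iSup_eq_top]
    refine iSup_le fun i => ?_
    by_cases hi : i < Module.finrank ℝ W + 1
    · exact le_iSup (fun i : Fin (Module.finrank ℝ W + 1) => ⋀[ℝ]^(i : ℕ) W) ⟨i, hi⟩
    · rw [h0 i (by omega)]; exact bot_le
  refine ⟨h1 ▸ Submodule.fg_iSup _ fun i => ?_⟩
  exact Module.Finite.iff_fg.1 inferInstance

end ExteriorAlgebraFacts

/-- The exterior algebra of the dual of the model fibre `ℝᵐ`. -/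
abbrev Lam (m : ℕ) := ExteriorAlgebra ℝ (Module.Dual ℝ (Eu m))

/-- The norm is pulled back from coordinates in an arbitrary basis. It only gives a meaning to
smoothness of maps into `Lam m`; by finite dimension the choice is immaterial. -/
noncomputable instance (m : ℕ) : NormedAddCommGroup (Lam m) :=
  NormedAddCommGroup.induced (Lam m) (Fin (Module.finrank ℝ (Lam m)) → ℝ)
    (Module.finBasis ℝ (Lam m)).equivFun (Module.finBasis ℝ (Lam m)).equivFun.injective

noncomputable instance (m : ℕ) : NormedSpace ℝ (Lam m) :=
  NormedSpace.induced ℝ (Lam m) (Fin (Module.finrank ℝ (Lam m)) → ℝ)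
    (Module.finBasis ℝ (Lam m)).equivFun

/-- Multiplication of the exterior algebra as a continuous bilinear map. -/
noncomputable def mulL (m : ℕ) : Lam m →L[ℝ] Lam m →L[ℝ] Lam m :=
  LinearMap.toContinuousLinearMap
    ((LinearMap.toContinuousLinearMap (𝕜 := ℝ) (E := Lam m) (F' := Lam m)).toLinearMap ∘ₗ
      LinearMap.mul ℝ (Lam m))

theorem mulL_apply {m : ℕ} (a b : Lam m) : mulL m a b = a * b := rfl

/-! ### Superfunctions as smooth maps into the fixed algebra `Lam m`. -/

namespace BundleCoords

variable (c : BundleCoords n m V)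

theorem isOpen_preimage_proj {W : Set M} (hW : IsOpen W) :
    IsOpen (TotalSpace.proj ⁻¹' W : Set (TotalSpace (Eu m) V)) :=
  hW.preimage (FiberBundle.continuous_proj (Eu m) V)

/-- The fibre coordinates of a vector, as a linear map. -/
noncomputable def fib (x : M) : V x →ₗ[ℝ] Eu m :=
  letI := c.linear
  c.triv.linearMapAt ℝ x

/-- The vector with given fibre coordinates. -/
noncomputable def fibInv (x : M) : Eu m →ₗ[ℝ] V x :=
  letI := c.linear
  c.triv.symmₗ ℝ x

theorem fib_apply {x : M} (hx : x ∈ c.triv.baseSet) (v : V x) : c.fib x v = (c.triv ⟨x, v⟩).2 := by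
  have := c.linear
  change c.triv.linearMapAt ℝ x v = _
  rw [c.triv.coe_linearMapAt_of_mem hx]

theorem fib_fibInv {x : M} (hx : x ∈ c.triv.baseSet) (v : Eu m) : c.fib x (c.fibInv x v) = v := by
  have := c.linear
  exact c.triv.linearMapAt_symmₗ hx v

theorem fibInv_fib {x : M} (hx : x ∈ c.triv.baseSet) (v : V x) : c.fibInv x (c.fib x v) = v := by
  have := c.linear
  exact c.triv.symmₗ_linearMapAt hx v

theorem triv_symm_apply {x : M} (hx : x ∈ c.triv.baseSet) (v : Eu m) :
    c.triv.toOpenPartialHomeomorph.symm (x, v) = ⟨x, c.fibInv x v⟩ := by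
  have := c.linear
  rw [← c.triv.mk_symm hx]
  congr 1
  exact (c.triv.symmₗ_apply hx v).symm

theorem fibInv_smooth (v : Eu m) :
    ContMDiffOn (𝓡 n) ((𝓡 n).prod 𝓘(ℝ, Eu m)) ∞
      (fun x => (⟨x, c.fibInv x v⟩ : TotalSpace (Eu m) V)) c.triv.baseSet := by
  refine (c.smooth_symm.comp (t := c.triv.target) (s := c.triv.baseSet) (f := fun x : M => (x, v))
    (contMDiffOn_id.prodMk contMDiffOn_const) fun x hx => ?_).congr fun x hx => ?_
  · exact c.triv.mem_target.2 hx
  · exact (c.triv_symm_apply hx v).symm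

/-- The identification of the exterior algebra of the model fibre with the fibre of `ΛE^*`. -/
noncomputable def up (x : M) : Lam m →ₐ[ℝ] LamFib V x := ExteriorAlgebra.map (c.fib x).dualMap

/-- The inverse of `up`. -/
noncomputable def dn (x : M) : LamFib V x →ₐ[ℝ] Lam m := ExteriorAlgebra.map (c.fibInv x).dualMap

theorem dn_up {x : M} (hx : x ∈ c.triv.baseSet) (a : Lam m) : c.dn x (c.up x a) = a := by
  have : (c.dn x).comp (c.up x) = AlgHom.id ℝ _ := by
    rw [dn, up, ExteriorAlgebra.map_comp_map]
    convert ExteriorAlgebra.map_id (R := ℝ) (M := Module.Dual ℝ (Eu m))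
    ext φ v
    simp [c.fib_fibInv hx]
  exact DFunLike.congr_fun this a

theorem up_dn {x : M} (hx : x ∈ c.triv.baseSet) (a : LamFib V x) : c.up x (c.dn x a) = a := by
  have : (c.up x).comp (c.dn x) = AlgHom.id ℝ _ := by
    rw [dn, up, ExteriorAlgebra.map_comp_map]
    convert ExteriorAlgebra.map_id (R := ℝ) (M := Module.Dual ℝ (V x))
    ext φ v
    simp [c.fibInv_fib hx]
  exact DFunLike.congr_fun this a

/-- The fibre coordinates, as elements of the exterior algebra of the model. -/
noncomputable def eps (α : Fin m) : Lam m :=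
  ExteriorAlgebra.ι ℝ (EuclideanSpace.proj α : Eu m →L[ℝ] ℝ).toLinearMap

theorem up_eps (α : Fin m) (x : M) : c.up x (eps α) = ExteriorAlgebra.ι ℝ (c.eDual α x) := by
  rw [up, eps, ExteriorAlgebra.map_apply_ι]
  rfl

theorem dual_eq_sum (φ : Module.Dual ℝ (Eu m)) :
    φ = ∑ α, φ (EuclideanSpace.single α 1) •
      (EuclideanSpace.proj α : Eu m →L[ℝ] ℝ).toLinearMap := by
  refine (EuclideanSpace.basisFun (Fin m) ℝ).toBasis.ext fun β => ?_
  simp [PiLp.single_apply]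

theorem adjoin_eps : Algebra.adjoin ℝ (Set.range (eps (m := m))) = ⊤ := by
  rw [eq_top_iff]
  rintro a -
  induction a using ExteriorAlgebra.induction with
  | algebraMap r => exact Subalgebra.algebraMap_mem _ r
  | ι φ =>
    rw [dual_eq_sum φ, map_sum]
    refine sum_mem fun α _ => ?_
    rw [map_smul]
    exact Subalgebra.smul_mem _ (Algebra.subset_adjoin (Set.mem_range_self α)) _
  | mul a b ha hb => exact mul_mem ha hb
  | add a b ha hb => exact add_mem ha hb

/-! ### Superfunctions in coordinates -/

/-- Smoothness passes through sums and products, so generators suffice. The coefficients of a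
section φ of E^* are its values on the local frame, obtained by composing the smooth fibrewise
linear function of φ with the smooth frame sections. -/
theorem dn_smooth {W : Set M} (hWU : W ⊆ c.triv.baseSet) {t : Π x : M, LamFib V x}
    (ht : t ∈ Algebra.adjoin ℝ (smoothGen n m V W)) :
    ContMDiffOn (𝓡 n) 𝓘(ℝ, Lam m) ∞ (fun x => c.dn x (t x)) W := by
  induction ht using Algebra.adjoin_induction with
  | mem s hs =>
    rcases hs with ⟨f, hf, hs⟩ | ⟨φ, hφ, hs⟩
    · have : (fun x => c.dn x (s x)) = fun x => f x • (1 : Lam m) := by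
        funext x
        rw [hs x, AlgHom.commutes, Algebra.algebraMap_eq_smul_one]
      rw [this]
      exact (ContinuousLinearMap.toSpanSingleton ℝ (1 : Lam m)).contMDiff.comp_contMDiffOn hf
    · have : (fun x => c.dn x (s x)) =
          fun x => ∑ α, φ x (c.fibInv x (EuclideanSpace.single α 1)) • (eps α : Lam m) := by
        funext x
        rw [hs x, dn, ExteriorAlgebra.map_apply_ι, dual_eq_sum ((c.fibInv x).dualMap (φ x)),
          map_sum]
        simp only [map_smul]
        rfl
      rw [this]
      refine contMDiffOn_finsetSum fun α _ =>
        (ContinuousLinearMap.toSpanSingleton ℝ (eps α : Lam m)).contMDiff.comp_contMDiffOn ?_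
      exact hφ.comp (t := TotalSpace.proj ⁻¹' W) ((c.fibInv_smooth _).mono hWU) fun x hx => hx
  | algebraMap r =>
    have : (fun x => c.dn x ((algebraMap ℝ (Π x : M, LamFib V x) r) x)) =
        fun x => algebraMap ℝ (Lam m) r := by
      funext x; exact AlgHom.commutes _ _
    rw [this]
    exact contMDiffOn_const
  | add a b _ _ ha hb =>
    have : (fun x => c.dn x ((a + b) x)) = (fun x => c.dn x (a x)) + fun x => c.dn x (b x) := by
      funext x; simp
    rw [this]; exact ha.add hb
  | mul a b _ _ ha hb =>
    have : (fun x => c.dn x ((a * b) x)) = fun x => mulL m (c.dn x (a x)) (c.dn x (b x)) := by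
      funext x; simp [mulL_apply]
    rw [this]; exact ((mulL m).contMDiff.comp_contMDiffOn ha).clm_apply hb

variable {c}

open scoped Classical in
/-- A superfunction over `W` in coordinates: a function with values in the exterior algebra of the
dual of the model fibre. -/
noncomputable def loc (c : BundleCoords n m V) {W : Opens M} (s : O n m V W) (x : M) : Lam m :=
  if h : x ∈ W then c.dn x (s.val ⟨x, h⟩) else 0

theorem loc_apply (c : BundleCoords n m V) {W : Opens M} (s : O n m V W) {x : M} (h : x ∈ W) :
    c.loc s x = c.dn x (s.val ⟨x, h⟩) := dif_pos h

theorem up_loc {W : Opens M} (h : W ≤ c.U) (s : O n m V W) {x : M} (hx : x ∈ W) :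
    c.up x (c.loc s x) = s.val ⟨x, hx⟩ := by
  rw [loc_apply c s hx, c.up_dn (h hx).2]

theorem loc_ext {W : Opens M} (h : W ≤ c.U) {s t : O n m V W}
    (hst : ∀ x ∈ W, c.loc s x = c.loc t x) : s = t :=
  O.ext fun x => by rw [← up_loc h s x.2, ← up_loc h t x.2, hst x x.2]

theorem loc_smooth {W : Opens M} (h : W ≤ c.U) (s : O n m V W) :
    ContMDiffOn (𝓡 n) 𝓘(ℝ, Lam m) ∞ (c.loc s) W := by
  intro x hx
  obtain ⟨W', hW', hx', t, ht, hs⟩ := Subtype.property s ⟨x, hx⟩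
  have h1 := c.dn_smooth (W := W' ∩ W) (fun y hy => (h hy.2).2)
    (Algebra.adjoin_mono (smoothGen_mono Set.inter_subset_left) ht)
  have h2 : ContMDiffAt (𝓡 n) 𝓘(ℝ, Lam m) ∞ (c.loc s) x := by
    refine (h1.contMDiffAt ((hW'.inter W.2).mem_nhds ⟨hx', hx⟩)).congr_of_eventuallyEq ?_
    filter_upwards [(hW'.inter W.2).mem_nhds ⟨hx', hx⟩] with y hy
    rw [loc_apply c s hy.2]
    exact congrArg _ (hs ⟨y, hy.2⟩ hy.1)
  exact h2.contMDiffWithinAt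

theorem up_mem_adjoin (c : BundleCoords n m V) {W : Set M} (hW : W ⊆ c.triv.baseSet) (a : Lam m) :
    (fun x => c.up x a) ∈ Algebra.adjoin ℝ (smoothGen n m V W) := by
  have ha : a ∈ Algebra.adjoin ℝ (Set.range (eps (m := m))) := adjoin_eps ▸ Algebra.mem_top
  induction ha using Algebra.adjoin_induction with
  | mem a ha =>
    obtain ⟨α, rfl⟩ := ha
    exact Algebra.subset_adjoin (Or.inr ⟨c.eDual α,
      (c.eDual_smooth α).mono (Set.preimage_mono hW), c.up_eps α⟩)
  | algebraMap r =>
    have : (fun x => c.up x (algebraMap ℝ (Lam m) r)) = algebraMap ℝ (Π x : M, LamFib V x) r := by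
      funext x; exact AlgHom.commutes _ _
    rw [this]
    exact Subalgebra.algebraMap_mem _ r
  | add a b _ _ ha hb =>
    have : (fun x => c.up x (a + b)) = (fun x => c.up x a) + fun x => c.up x b := by
      funext x; simp
    rw [this]; exact add_mem ha hb
  | mul a b _ _ ha hb =>
    have : (fun x => c.up x (a * b)) = (fun x => c.up x a) * fun x => c.up x b := by
      funext x; simp
    rw [this]; exact mul_mem ha hb

/-- The superfunction over `W` given by a smooth function with values in the exterior algebra. -/
noncomputable def unloc (c : BundleCoords n m V) {W : Opens M} (h : W ≤ c.U) (g : M → Lam m)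
    (hg : ContMDiffOn (𝓡 n) 𝓘(ℝ, Lam m) ∞ g W) : O n m V W :=
  ⟨fun x => c.up x (g x), fun x₀ => by
    let b := Module.finBasis ℝ (Lam m)
    -- Expanding `g` in a basis of `Lam m` exhibits the section as a sum of smooth functions times
    -- sections that are constant in the trivialization, so `W` itself serves as the neighbourhood.
    refine ⟨W, W.2, x₀.2, ∑ j, (fun x => algebraMap ℝ (LamFib V x) (b.coord j (g x))) *
      fun x => c.up x (b j), sum_mem fun j _ => mul_mem ?_ ?_, fun x _ => ?_⟩
    · refine Algebra.subset_adjoin (Or.inl ⟨fun x => b.coord j (g x), ?_, fun _ => rfl⟩)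
      exact (LinearMap.toContinuousLinearMap (b.coord j)).contMDiff.comp_contMDiffOn hg
    · exact c.up_mem_adjoin (fun x hx => (h hx).2) (b j)
    · simp only [Finset.sum_apply, Pi.mul_apply, ← Algebra.smul_def, ← map_smul, ← map_sum]
      congr 1
      exact (b.sum_repr (g x)).symm⟩

theorem loc_unloc {W : Opens M} (h : W ≤ c.U) (g : M → Lam m)
    (hg : ContMDiffOn (𝓡 n) 𝓘(ℝ, Lam m) ∞ g W) {x : M} (hx : x ∈ W) :
    c.loc (c.unloc h g hg) x = g x := by
  rw [loc_apply c _ hx]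
  exact c.dn_up (h hx).2 _

theorem loc_add {W : Opens M} (s t : O n m V W) (x : M) :
    c.loc (s + t) x = c.loc s x + c.loc t x := by
  by_cases hx : x ∈ W
  · rw [loc_apply c _ hx, loc_apply c _ hx, loc_apply c _ hx]; exact map_add _ _ _
  · simp [loc, hx]

theorem loc_sub {W : Opens M} (s t : O n m V W) (x : M) :
    c.loc (s - t) x = c.loc s x - c.loc t x := by
  by_cases hx : x ∈ W
  · rw [loc_apply c _ hx, loc_apply c _ hx, loc_apply c _ hx]; exact map_sub _ _ _
  · simp [loc, hx]

theorem loc_mul {W : Opens M} (s t : O n m V W) (x : M) :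
    c.loc (s * t) x = c.loc s x * c.loc t x := by
  by_cases hx : x ∈ W
  · rw [loc_apply c _ hx, loc_apply c _ hx, loc_apply c _ hx]; exact map_mul _ _ _
  · simp [loc, hx]

theorem loc_smul {W : Opens M} (r : ℝ) (s : O n m V W) (x : M) :
    c.loc (r • s) x = r • c.loc s x := by
  by_cases hx : x ∈ W
  · rw [loc_apply c _ hx, loc_apply c _ hx]; exact map_smul (c.dn x) _ _
  · simp [loc, hx]

theorem loc_zero {W : Opens M} (x : M) : c.loc (0 : O n m V W) x = 0 := by
  by_cases hx : x ∈ W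
  · rw [loc_apply c _ hx]; exact map_zero _
  · simp [loc, hx]

theorem loc_one {W : Opens M} {x : M} (hx : x ∈ W) : c.loc (1 : O n m V W) x = 1 := by
  rw [loc_apply c _ hx]; exact map_one _

theorem loc_sum {ι : Type*} (S : Finset ι) {W : Opens M} (s : ι → O n m V W) (x : M) :
    c.loc (∑ i ∈ S, s i) x = ∑ i ∈ S, c.loc (s i) x := by
  classical
  induction S using Finset.induction_on with
  | empty => simp [loc_zero]
  | insert i S hi ih => rw [Finset.sum_insert hi, Finset.sum_insert hi, loc_add, ih]

theorem loc_res {U W : Opens M} (h : W ≤ U) (s : O n m V U) {x : M} (hx : x ∈ W) :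
    c.loc (O.res h s) x = c.loc s x := by
  rw [loc_apply c _ hx, loc_apply c _ (h hx)]
  rfl

theorem loc_sig {W : Opens M} (s : O n m V W) (x : M) :
    c.loc (O.sig W s) x = invol (c.loc s x) := by
  by_cases hx : x ∈ W
  · rw [loc_apply c _ hx, loc_apply c _ hx, dn, invol_map]; rfl
  · simp [loc, hx]

theorem loc_ofFun {W : Opens M} (f : M → ℝ) (hf : ContMDiffOn (𝓡 n) 𝓘(ℝ) ∞ f (W : Set M)) {x : M}
    (hx : x ∈ W) : c.loc (O.ofFun f hf : O n m V W) x = algebraMap ℝ (Lam m) (f x) := by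
  rw [loc_apply c _ hx]
  exact AlgHom.commutes _ _

theorem loc_eStar (α : Fin m) {W : Opens M} (h : W ≤ c.U) {x : M} (hx : x ∈ W) :
    c.loc (c.eStar α h) x = eps α := by
  rw [loc_apply c _ hx, ← c.dn_up (h hx).2 (eps α), c.up_eps]
  rfl

theorem psi_eq {W : Opens M} (h : W ≤ c.U) (s : O n m V W) {e : TotalSpace (Eu m) V}
    (he : e.1 ∈ W) : psi s.val e = affEval ((c.triv e).2) (c.loc s e.1) := by
  rw [psi, dif_pos he, ← up_loc h s he, up, algebraMapInv_map, ιInv_map, affEval_apply,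
    ← c.fib_apply (h he).2]
  rfl

theorem red_eq {W : Opens M} (h : W ≤ c.U) (s : O n m V W) {x : M} (hx : x ∈ W) :
    s.red x = algebraMapInv (c.loc s x) := by
  rw [O.red, dif_pos hx, ← up_loc h s hx, up, algebraMapInv_map]

end BundleCoords

/-! ### Construction of the coordinate superderivations. -/

namespace BundleCoords

variable (c : BundleCoords n m V)

section PartialDerivatives

variable {F F' : Type*} [NormedAddCommGroup F] [NormedSpace ℝ F]
  [NormedAddCommGroup F'] [NormedSpace ℝ F']

theorem chart_smooth : ContMDiffOn (𝓡 n) (𝓡 n) ∞ c.chart c.chart.source :=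
  contMDiffOn_of_mem_maximalAtlas c.chart_mem

theorem chart_symm_smooth : ContMDiffOn (𝓡 n) (𝓡 n) ∞ c.chart.symm c.chart.target :=
  contMDiffOn_symm_of_mem_maximalAtlas c.chart_mem

/-- The partial derivative along the `i`-th coordinate of the base. -/
noncomputable def pd (i : Fin n) (g : M → F) (x : M) : F :=
  fderiv ℝ (g ∘ c.chart.symm) (c.chart x) (EuclideanSpace.single i 1)

theorem contDiffOn_comp_chart_symm {W : Set M} {g : M → F}
    (hg : ContMDiffOn (𝓡 n) 𝓘(ℝ, F) ∞ g W) :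
    ContDiffOn ℝ ∞ (g ∘ c.chart.symm) (c.chart.target ∩ c.chart.symm ⁻¹' W) :=
  contMDiffOn_iff_contDiffOn.1 (hg.comp (c.chart_symm_smooth.mono Set.inter_subset_left)
    fun _ hy => hy.2)

theorem isOpen_target_inter {W : Set M} (hW : IsOpen W) :
    IsOpen (c.chart.target ∩ c.chart.symm ⁻¹' W) :=
  c.chart.symm.isOpen_inter_preimage hW

theorem chart_mem_target_inter {W : Set M} (hWU : W ⊆ c.chart.source) {x : M} (hx : x ∈ W) :
    c.chart x ∈ c.chart.target ∩ c.chart.symm ⁻¹' W :=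
  ⟨c.chart.map_source (hWU hx), by rwa [Set.mem_preimage, c.chart.left_inv (hWU hx)]⟩

theorem differentiableAt_comp_chart_symm {W : Set M} (hW : IsOpen W) (hWU : W ⊆ c.chart.source)
    {g : M → F} (hg : ContMDiffOn (𝓡 n) 𝓘(ℝ, F) ∞ g W) {x : M} (hx : x ∈ W) :
    DifferentiableAt ℝ (g ∘ c.chart.symm) (c.chart x) :=
  ((c.contDiffOn_comp_chart_symm hg).contDiffAt ((c.isOpen_target_inter hW).mem_nhds
    (c.chart_mem_target_inter hWU hx))).differentiableAt (by simp)

theorem pd_smooth {W : Set M} (hW : IsOpen W) (hWU : W ⊆ c.chart.source) (i : Fin n) {g : M → F}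
    (hg : ContMDiffOn (𝓡 n) 𝓘(ℝ, F) ∞ g W) :
    ContMDiffOn (𝓡 n) 𝓘(ℝ, F) ∞ (c.pd i g) W := by
  have h1 := (c.contDiffOn_comp_chart_symm hg).fderiv_of_isOpen (c.isOpen_target_inter hW)
    (m := ∞) le_rfl
  have h2 := h1.clm_apply (contDiffOn_const (c := (EuclideanSpace.single i 1 : Eu n)))
  exact h2.contMDiffOn.comp (c.chart_smooth.mono hWU) fun x hx => c.chart_mem_target_inter hWU hx

theorem pd_congr {W : Set M} (hW : IsOpen W) (hWU : W ⊆ c.chart.source) (i : Fin n) {g g' : M → F}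
    (h : Set.EqOn g g' W) {x : M} (hx : x ∈ W) : c.pd i g x = c.pd i g' x := by
  have : g ∘ c.chart.symm =ᶠ[𝓝 (c.chart x)] g' ∘ c.chart.symm := by
    filter_upwards [(c.isOpen_target_inter hW).mem_nhds (c.chart_mem_target_inter hWU hx)] with y hy
    exact h hy.2
  rw [pd, pd, this.fderiv_eq]

theorem pd_clm {W : Set M} (hW : IsOpen W) (hWU : W ⊆ c.chart.source) (i : Fin n) {g : M → F}
    (hg : ContMDiffOn (𝓡 n) 𝓘(ℝ, F) ∞ g W) (L : F →L[ℝ] F') {x : M} (hx : x ∈ W) :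
    c.pd i (fun y => L (g y)) x = L (c.pd i g x) := by
  have h := L.hasFDerivAt.comp (c.chart x)
    (c.differentiableAt_comp_chart_symm hW hWU hg hx).hasFDerivAt
  have h' : HasFDerivAt ((fun y => L (g y)) ∘ c.chart.symm) _ (c.chart x) := h
  rw [pd, h'.fderiv]
  rfl

theorem pd_add {W : Set M} (hW : IsOpen W) (hWU : W ⊆ c.chart.source) (i : Fin n) {g g' : M → F}
    (hg : ContMDiffOn (𝓡 n) 𝓘(ℝ, F) ∞ g W) (hg' : ContMDiffOn (𝓡 n) 𝓘(ℝ, F) ∞ g' W) {x : M}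
    (hx : x ∈ W) : c.pd i (fun y => g y + g' y) x = c.pd i g x + c.pd i g' x := by
  have h := (c.differentiableAt_comp_chart_symm hW hWU hg hx).hasFDerivAt.add
    (c.differentiableAt_comp_chart_symm hW hWU hg' hx).hasFDerivAt
  have h' : HasFDerivAt ((fun y => g y + g' y) ∘ c.chart.symm) _ (c.chart x) := h
  rw [pd, h'.fderiv]
  rfl

theorem pd_mul {W : Set M} (hW : IsOpen W) (hWU : W ⊆ c.chart.source) (i : Fin n)
    {g g' : M → Lam m} (hg : ContMDiffOn (𝓡 n) 𝓘(ℝ, Lam m) ∞ g W)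
    (hg' : ContMDiffOn (𝓡 n) 𝓘(ℝ, Lam m) ∞ g' W) {x : M} (hx : x ∈ W) :
    c.pd i (fun y => g y * g' y) x = c.pd i g x * g' x + g x * c.pd i g' x := by
  have h := (mulL m).hasFDerivAt_of_bilinear
    (c.differentiableAt_comp_chart_symm hW hWU hg hx).hasFDerivAt
    (c.differentiableAt_comp_chart_symm hW hWU hg' hx).hasFDerivAt
  have h' : HasFDerivAt ((fun y => g y * g' y) ∘ c.chart.symm) _ (c.chart x) := h
  have hx' : c.chart.symm (c.chart x) = x := c.chart.left_inv (hWU hx)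
  rw [pd, h'.fderiv]
  simp only [_root_.add_apply, ContinuousLinearMap.precompR_apply,
    ContinuousLinearMap.precompL_apply, mulL_apply, Function.comp_apply, hx', pd]
  exact add_comm _ _

end PartialDerivatives

theorem U_subset_source : (c.U : Set M) ⊆ c.chart.source := Set.inter_subset_left

/-- The operators `∂̂_i`, over `W`. -/
noncomputable def evenLin (i : Fin n) {W : Opens M} (h : W ≤ c.U) : O n m V W →ₗ[ℝ] O n m V W where
  toFun s := c.unloc h (c.pd i (c.loc s)) (c.pd_smooth W.2 (fun _ hx => (h hx).1) i (loc_smooth h s))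
  map_add' s t := loc_ext h fun x hx => by
    rw [loc_add, loc_unloc _ _ _ hx, loc_unloc _ _ _ hx, loc_unloc _ _ _ hx,
      ← c.pd_add W.2 (fun _ hx => (h hx).1) i (loc_smooth h s) (loc_smooth h t) hx]
    congr 1
    exact funext (loc_add s t)
  map_smul' r s := loc_ext h fun x hx => by
    rw [RingHom.id_apply, loc_smul, loc_unloc _ _ _ hx, loc_unloc _ _ _ hx]
    refine Eq.trans ?_ (c.pd_clm W.2 (fun _ hx => (h hx).1) i (loc_smooth h s)
      (r • ContinuousLinearMap.id ℝ (Lam m)) hx)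
    congr 1
    exact funext (loc_smul r s)

/-- The family of the operators `∂̂_i`. -/
noncomputable def evenOp (i : Fin n) : Op n m V c.U := fun W => c.evenLin i W.2

theorem loc_evenOp (i : Fin n) (W : Set.Iic c.U) (s : O n m V W.1) {x : M} (hx : x ∈ W.1) :
    c.loc (c.evenOp i W s) x = c.pd i (c.loc s) x :=
  loc_unloc (Set.mem_Iic.1 W.2) (c.pd i (c.loc s))
    (c.pd_smooth W.1.2 (fun _ hx => (W.2 hx).1) i (loc_smooth W.2 s)) hx

/-- In the trivialization the operator differentiates a map into a fixed algebra. It commutes with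
continuous linear maps, in particular with the parity involution, and it obeys the Leibniz rule of
the bilinear product. -/
theorem evenOp_mem (i : Fin n) : c.evenOp i ∈ derHom n m V c.U 0 := by
  refine ⟨fun W W' h s => loc_ext W'.2 fun x hx => ?_, fun W s => loc_ext W.2 fun x hx => ?_,
    fun W s t => loc_ext W.2 fun x hx => ?_⟩
  · rw [loc_res h _ hx, loc_evenOp _ _ _ _ hx, loc_evenOp _ _ _ _ (h hx)]
    exact c.pd_congr W'.1.2 (fun _ hx => (W'.2 hx).1) i (fun y hy => (loc_res h s hy).symm) hx
  · rw [loc_sig, sgn, if_pos rfl, one_smul, loc_evenOp _ _ _ _ hx, loc_evenOp _ _ _ _ hx]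
    refine ((c.pd_clm W.1.2 (fun _ hx => (W.2 hx).1) i (loc_smooth W.2 s)
        (LinearMap.toContinuousLinearMap invol.toLinearMap) hx).symm).trans ?_
    congr 1
    exact (funext (loc_sig s)).symm
  · rw [loc_add, loc_mul, loc_mul, O.sigPow, if_pos rfl, loc_evenOp _ _ _ _ hx,
      loc_evenOp _ _ _ _ hx, loc_evenOp _ _ _ _ hx, AlgHom.id_apply,
      ← c.pd_mul W.1.2 (fun _ hx => (W.2 hx).1) i (loc_smooth W.2 s) (loc_smooth W.2 t) hx]
    congr 1
    exact funext (loc_mul s t)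

/-- The contraction of the exterior algebra of the model along the `α`-th fibre coordinate. -/
noncomputable def contr (m : ℕ) (α : Fin m) : Lam m →ₗ[ℝ] Lam m :=
  contract (Module.Dual.eval ℝ (Eu m) (EuclideanSpace.single α 1))

theorem contr_smooth (α : Fin m) {W : Opens M} (h : W ≤ c.U) (s : O n m V W) :
    ContMDiffOn (𝓡 n) 𝓘(ℝ, Lam m) ∞ (fun x => contr m α (c.loc s x)) W :=
  (LinearMap.toContinuousLinearMap (contr m α)).contMDiff.comp_contMDiffOn (loc_smooth h s)

/-- The operators `∂̂_α`, over `W`. -/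
noncomputable def oddLin (α : Fin m) {W : Opens M} (h : W ≤ c.U) : O n m V W →ₗ[ℝ] O n m V W where
  toFun s := c.unloc h (fun x => contr m α (c.loc s x)) (c.contr_smooth α h s)
  map_add' s t := loc_ext h fun x hx => by
    rw [loc_add, loc_unloc _ _ _ hx, loc_unloc _ _ _ hx, loc_unloc _ _ _ hx, loc_add, map_add]
  map_smul' r s := loc_ext h fun x hx => by
    rw [RingHom.id_apply, loc_smul, loc_unloc _ _ _ hx, loc_unloc _ _ _ hx, loc_smul, map_smul]

/-- The family of the operators `∂̂_α`. -/
noncomputable def oddOp (α : Fin m) : Op n m V c.U := fun W => c.oddLin α W.2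

theorem loc_oddOp (α : Fin m) (W : Set.Iic c.U) (s : O n m V W.1) {x : M} (hx : x ∈ W.1) :
    c.loc (c.oddOp α W s) x = contr m α (c.loc s x) :=
  loc_unloc (Set.mem_Iic.1 W.2) (fun x => contr m α (c.loc s x)) (c.contr_smooth α W.2 s) hx

/-- The operator acts pointwise by contraction, which is an antiderivation and anticommutes with the
parity involution. -/
theorem oddOp_mem (α : Fin m) : c.oddOp α ∈ derHom n m V c.U 1 := by
  refine ⟨fun W W' h s => loc_ext W'.2 fun x hx => ?_, fun W s => loc_ext W.2 fun x hx => ?_,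
    fun W s t => loc_ext W.2 fun x hx => ?_⟩
  · rw [loc_res h _ hx, loc_oddOp _ _ _ _ hx, loc_oddOp _ _ _ _ (h hx), loc_res h _ hx]
  · rw [loc_sig, sgn, if_neg one_ne_zero, neg_one_smul, ← zero_sub, loc_sub, loc_zero,
      loc_oddOp _ _ _ _ hx, loc_oddOp _ _ _ _ hx, loc_sig, zero_sub]
    exact invol_contract _ _
  · rw [loc_add, loc_mul, loc_mul, O.sigPow, if_neg one_ne_zero, loc_oddOp _ _ _ _ hx,
      loc_oddOp _ _ _ _ hx, loc_oddOp _ _ _ _ hx, loc_mul, loc_sig]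
    exact contract_mul _ _ _

/-- The coordinate superderivations. -/
noncomputable def coordDer : Idx n m → T n m V c.U
  | .inl i => ⟨c.evenOp i, Submodule.mem_sup_left (c.evenOp_mem i)⟩
  | .inr α => ⟨c.oddOp α, Submodule.mem_sup_right (c.oddOp_mem α)⟩

theorem loc_coordDer_inl (i : Fin n) {W : Opens M} (h : W ≤ c.U) (s : O n m V W) {x : M}
    (hx : x ∈ W) : c.loc ((c.coordDer (.inl i)).app h s) x = c.pd i (c.loc s) x :=
  c.loc_evenOp i ⟨W, h⟩ s hx

theorem loc_coordDer_inr (α : Fin m) {W : Opens M} (h : W ≤ c.U) (s : O n m V W) {x : M}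
    (hx : x ∈ W) : c.loc ((c.coordDer (.inr α)).app h s) x = contr m α (c.loc s x) :=
  c.loc_oddOp α ⟨W, h⟩ s hx

theorem contr_eps (α β : Fin m) :
    contr m α (eps β) = algebraMap ℝ (Lam m) (if α = β then 1 else 0) := by
  rw [contr, eps, contract_ι]
  congr 1
  simp [PiLp.single_apply, eq_comm]

theorem isCoordDer_coordDer : c.IsCoordDer c.coordDer where
  even i := c.evenOp_mem i
  odd α := c.oddOp_mem α
  even_fun i W h f hf x := by
    rw [← up_loc h _ x.2, loc_coordDer_inl _ _ _ _ x.2]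
    have h1 : c.pd i (c.loc (O.ofFun f hf : O n m V W)) x =
        c.pd i (fun y => (ContinuousLinearMap.toSpanSingleton ℝ (1 : Lam m)) (f y)) x :=
      c.pd_congr W.2 (fun _ hx => (h hx).1) i (fun y hy => by
        rw [loc_ofFun f hf hy, Algebra.algebraMap_eq_smul_one]; rfl) x.2
    rw [h1, c.pd_clm W.2 (fun _ hx => (h hx).1) i hf _ x.2,
      ContinuousLinearMap.toSpanSingleton_apply, map_smul, map_one,
      ← Algebra.algebraMap_eq_smul_one]
    rfl
  even_eStar i β W h := loc_ext h fun x hx => by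
    rw [loc_coordDer_inl _ _ _ _ hx, loc_zero, c.pd_congr W.2 (fun _ hx => (h hx).1) i
      (g' := fun _ => eps β) (fun y hy => loc_eStar β h hy) hx, pd]
    have : (fun _ : M => (eps β : Lam m)) ∘ c.chart.symm = fun _ => eps β := rfl
    rw [this, fderiv_const_apply]
    rfl
  odd_fun α W h f hf := loc_ext h fun x hx => by
    rw [loc_coordDer_inr _ _ _ _ hx, loc_ofFun f hf hx, loc_zero]
    exact contract_algebraMap _ _
  odd_eStar α β W h := loc_ext h fun x hx => by
    rw [loc_coordDer_inr _ _ _ _ hx, loc_eStar β h hx, contr_eps]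
    split_ifs
    · rw [loc_one hx, map_one]
    · rw [loc_zero, map_zero]

end BundleCoords

/-! ### Hadamard's lemma. -/

section Hadamard

/-- Induction on the order by differentiation under the integral sign. The target space is
quantified inside the statement because the derivative takes values in a space of linear maps. -/
theorem contDiff_intervalIntegral {E : Type} [NormedAddCommGroup E] [NormedSpace ℝ E]
    [ProperSpace E] (k : ℕ) : ∀ {F : Type} [NormedAddCommGroup F] [NormedSpace ℝ F]
    {h : E × ℝ → F}, ContDiff ℝ k h → ContDiff ℝ k fun y => ∫ t in (0 : ℝ)..1, h (y, t) := by
  induction k with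
  | zero =>
    intro F _ _ h hh
    have hc : Continuous h := hh.continuous
    exact contDiff_zero.2
      (intervalIntegral.continuous_parametric_intervalIntegral_of_continuous' (by fun_prop) 0 1)
  | succ k ih =>
    intro F _ _ h hh
    have hd : ContDiff ℝ k fun p : E × ℝ => fderiv ℝ h p ∘L ContinuousLinearMap.inl ℝ E ℝ :=
      (hh.fderiv_right (m := k) (by norm_cast)).clm_comp contDiff_const
    have hder : ∀ p : E × ℝ, HasFDerivAt (fun y => h (y, p.2))
        (fderiv ℝ h p ∘L ContinuousLinearMap.inl ℝ E ℝ) p.1 := fun p => by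
      have h1 : HasFDerivAt h (fderiv ℝ h p) (p.1, p.2) :=
        (hh.differentiable (by simp) p).hasFDerivAt
      exact h1.comp p.1 (hasFDerivAt_prodMk_left p.1 p.2)
    have hc : Continuous h := hh.continuous
    have hdc := hd.continuous
    rw [Nat.cast_add, Nat.cast_one, contDiff_succ_iff_hasFDerivAt]
    refine ⟨fun y => ∫ t in (0 : ℝ)..1, fderiv ℝ h (y, t) ∘L ContinuousLinearMap.inl ℝ E ℝ,
      ih hd, fun y => ?_⟩
    -- Compactness of the closed unit ball times [0,1] provides the constant that dominates the
    -- derivative near `y`.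
    obtain ⟨C, hC⟩ := ((isCompact_closedBall y 1).prod isCompact_Icc).exists_bound_of_continuousOn
      (f := fun p : E × ℝ => fderiv ℝ h p ∘L ContinuousLinearMap.inl ℝ E ℝ)
      (s := Metric.closedBall y 1 ×ˢ Set.Icc (0 : ℝ) 1) hdc.continuousOn
    refine intervalIntegral.hasFDerivAt_integral_of_dominated_of_fderiv_le
      (F' := fun y t => fderiv ℝ h (y, t) ∘L ContinuousLinearMap.inl ℝ E ℝ) (bound := fun _ => C)
      (Metric.closedBall_mem_nhds y one_pos) ?_ ?_ ?_ ?_ ?_ ?_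
    · exact Filter.Eventually.of_forall fun x =>
        (hc.comp (by fun_prop : Continuous fun t : ℝ => (x, t))).aestronglyMeasurable
    · exact (hc.comp (by fun_prop : Continuous fun t : ℝ => (y, t))).intervalIntegrable 0 1
    · exact (hdc.comp (by fun_prop : Continuous fun t : ℝ => (y, t))).aestronglyMeasurable
    · refine Filter.Eventually.of_forall fun t ht x hx => hC (x, t) ⟨hx, ?_⟩
      rw [Set.uIoc_of_le zero_le_one] at ht
      exact Set.Ioc_subset_Icc_self ht
    · exact intervalIntegrable_const
    · exact Filter.Eventually.of_forall fun t ht x hx => hder (x, t)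

/-- The functions g_k are the averages of the partial derivatives over the segment from `a` to `y`;
the identity is the fundamental theorem of calculus along that segment. -/
theorem exists_hadamard {F : Eu n → ℝ} (hF : ContDiff ℝ ∞ F) (a : Eu n) :
    ∃ g : Fin n → Eu n → ℝ, (∀ k, ContDiff ℝ ∞ (g k)) ∧
      ∀ y, F y = F a + ∑ k, (y k - a k) * g k y := by
  have hs : ∀ k : Fin n, ContDiff ℝ ∞ fun p : Eu n × ℝ =>
      fderiv ℝ F (a + p.2 • (p.1 - a)) (EuclideanSpace.single k 1) := fun k => by
    have h1 : ContDiff ℝ ∞ (fderiv ℝ F) := hF.fderiv_right (m := ∞) le_rfl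
    exact (h1.comp (by fun_prop : ContDiff ℝ ∞ fun p : Eu n × ℝ => a + p.2 • (p.1 - a))).clm_apply
      contDiff_const
  refine ⟨fun k y => ∫ t in (0 : ℝ)..1, fderiv ℝ F (a + t • (y - a)) (EuclideanSpace.single k 1),
    fun k => contDiff_infty.2 fun j => contDiff_intervalIntegral j
      ((hs k).of_le (by exact_mod_cast le_top)), fun y => ?_⟩
  have hcont : ∀ k, Continuous fun t : ℝ =>
      fderiv ℝ F (a + t • (y - a)) (EuclideanSpace.single k 1) := fun k =>
    (hs k).continuous.comp (by fun_prop : Continuous fun t : ℝ => (y, t))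
  have hder : ∀ t : ℝ, HasDerivAt (fun t : ℝ => F (a + t • (y - a)))
      (∑ k, (y k - a k) * fderiv ℝ F (a + t • (y - a)) (EuclideanSpace.single k 1)) t := by
    intro t
    have h1 : HasDerivAt (fun t : ℝ => a + t • (y - a)) (y - a) t := by
      simpa using ((hasDerivAt_id t).smul_const (y - a)).const_add a
    have h2 := ((hF.differentiable (by simp) (a + t • (y - a))).hasFDerivAt).comp_hasDerivAt t h1
    have h3 : ∀ L : Eu n →L[ℝ] ℝ,
        L (y - a) = ∑ k, (y k - a k) * L (EuclideanSpace.single k 1) := fun L => by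
      conv_lhs => rw [← (EuclideanSpace.basisFun (Fin n) ℝ).sum_repr (y - a)]
      simp [map_sum]
    rw [← h3]
    exact h2
  have hint : ∀ k, IntervalIntegrable (fun t : ℝ => (y k - a k) *
      fderiv ℝ F (a + t • (y - a)) (EuclideanSpace.single k 1)) MeasureTheory.volume 0 1 :=
    fun k => (continuous_const.mul (hcont k)).intervalIntegrable 0 1
  have := intervalIntegral.integral_eq_sub_of_hasDerivAt (a := 0) (b := 1) (fun t _ => hder t)
    ((continuous_finsetSum _ fun k _ => continuous_const.mul (hcont k)).intervalIntegrable 0 1)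
  rw [intervalIntegral.integral_finsetSum fun k _ => hint k] at this
  simp only [intervalIntegral.integral_const_mul, one_smul, zero_smul, add_zero,
    add_sub_cancel] at this
  rw [this]
  ring

end Hadamard

/-! ### Hadamard's lemma in a chart, and the supercoordinates. -/

namespace BundleCoords

variable (c : BundleCoords n m V)

theorem exists_hadamard_chart {W : Opens M} (hWU : (W : Set M) ⊆ c.chart.source) {f : M → ℝ}
    (hf : ContMDiffOn (𝓡 n) 𝓘(ℝ) ∞ f (W : Set M)) {x₀ : M} (hx₀ : x₀ ∈ W) :
    ∃ W' : Opens M, W' ≤ W ∧ x₀ ∈ W' ∧ ∃ g : Fin n → M → ℝ,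
      (∀ k, ContMDiffOn (𝓡 n) 𝓘(ℝ) ∞ (g k) (W' : Set M)) ∧
      ∀ x ∈ W', f x = f x₀ + ∑ k, (c.chart x k - c.chart x₀ k) * g k x := by
  have hS := c.isOpen_target_inter W.2
  have hxS := c.chart_mem_target_inter hWU hx₀
  obtain ⟨r, hr, hrS⟩ := Metric.isOpen_iff.1 hS _ hxS
  -- The cut-off equals 1 on the ball of radius r/4, where the conclusion is drawn. It vanishes
  -- outside radius r/2 < r, so the product with `f` in coordinates extends by zero to a smooth
  -- function on all of ℝⁿ.
  let φ : ContDiffBump (c.chart x₀) := ⟨r / 4, r / 2, by positivity, by linarith⟩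
  have hF : ContDiff ℝ ∞ fun y => φ y * (f ∘ c.chart.symm) y := by
    refine contDiff_iff_contDiffAt.2 fun y => ?_
    by_cases hy : y ∈ c.chart.target ∩ c.chart.symm ⁻¹' W
    · exact φ.contDiff.contDiffAt.mul
        ((c.contDiffOn_comp_chart_symm hf).contDiffAt (hS.mem_nhds hy))
    · have hy' : y ∉ Metric.closedBall (c.chart x₀) (r / 2) := fun h =>
        hy (hrS (Metric.closedBall_subset_ball (by linarith) h))
      refine (contDiffAt_const (c := (0 : ℝ))).congr_of_eventuallyEq ?_
      filter_upwards [Metric.isClosed_closedBall.isOpen_compl.mem_nhds hy'] with z hz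
      rw [φ.zero_of_le_dist (not_le.1 fun h => hz h).le, zero_mul]
  obtain ⟨g, hg, hgF⟩ := exists_hadamard hF (c.chart x₀)
  have hφ : ∀ x ∈ W, c.chart x ∈ Metric.ball (c.chart x₀) (r / 4) →
      f x = φ (c.chart x) * (f ∘ c.chart.symm) (c.chart x) := fun x hx h => by
    rw [φ.one_of_mem_closedBall (Metric.ball_subset_closedBall h), one_mul, Function.comp_apply,
      c.chart.left_inv (hWU hx)]
  refine ⟨⟨W ∩ (c.chart.source ∩ c.chart ⁻¹' Metric.ball (c.chart x₀) (r / 4)),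
    W.2.inter (c.chart.isOpen_inter_preimage Metric.isOpen_ball)⟩, fun x hx => hx.1,
    ⟨hx₀, hWU hx₀, Metric.mem_ball_self (by positivity)⟩, fun k x => g k (c.chart x),
    fun k => (hg k).contMDiff.comp_contMDiffOn (c.chart_smooth.mono fun x hx => hWU hx.1),
    fun x hx => ?_⟩
  rw [hφ x hx.1 hx.2.2, hφ x₀ hx₀ (Metric.mem_ball_self (by positivity))]
  exact hgF (c.chart x)

theorem chart_coord_smooth (k : Fin n) {W : Set M} (hW : W ⊆ c.chart.source) :
    ContMDiffOn (𝓡 n) 𝓘(ℝ) ∞ (fun x => c.chart x k) W :=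
  (EuclideanSpace.proj k : Eu n →L[ℝ] ℝ).contMDiff.comp_contMDiffOn (c.chart_smooth.mono hW)

/-- The coordinates of the supermanifold, as superfunctions over `W`. -/
noncomputable def coord {W : Opens M} (h : W ≤ c.U) : Idx n m → O n m V W
  | .inl k => O.ofFun (fun x => c.chart x k) (c.chart_coord_smooth k fun _ hx => (h hx).1)
  | .inr α => c.eStar α h

/-- The parity of an index. -/
def par : Idx n m → ZMod 2
  | .inl _ => 0
  | .inr _ => 1

variable {c}

theorem res_coord {W W' : Opens M} (h : W ≤ c.U) (h' : W' ≤ W) (r : Idx n m) :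
    O.res h' (c.coord h r) = c.coord (h'.trans h) r := by
  rcases r with k | α <;> rfl

end BundleCoords

/-! ### Superderivations are determined by their values on coordinates. -/

section Derivations

variable {U : Opens M}

theorem O.sig_ofFun {W : Opens M} (f : M → ℝ) (hf : ContMDiffOn (𝓡 n) 𝓘(ℝ) ∞ f (W : Set M)) :
    O.sig W (O.ofFun f hf : O n m V W) = O.ofFun f hf :=
  O.ext fun _ => AlgHom.commutes _ _

theorem BundleCoords.coord_isHom {c : BundleCoords n m V} {W : Opens M} (h : W ≤ c.U)
    (r : BundleCoords.Idx n m) : O.IsHom (BundleCoords.par r) (c.coord h r) := by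
  rcases r with k | α
  · refine (O.sig_ofFun (n := n) (m := m) (V := V) (fun x => c.chart x k)
      (c.chart_coord_smooth k fun _ hx => (h hx).1)).trans ?_
    rw [BundleCoords.par, sgn, if_pos rfl, one_smul]
    rfl
  · refine O.ext fun x => (invol_ι (c.eDual α x)).trans ?_
    rw [BundleCoords.par, sgn, if_neg one_ne_zero, neg_one_smul]
    rfl

theorem derHom_one {p : ZMod 2} {X : Op n m V U} (hX : X ∈ derHom n m V U p) (W : Set.Iic U) :
    X W 1 = 0 := by
  have h := hX.2.2 W 1 1
  have h1 : O.sigPow W.1 p (1 : O n m V W.1) = 1 := map_one _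
  rw [mul_one, h1, one_mul, mul_one] at h
  exact left_eq_add.1 h

theorem derHom_ofFun_const {p : ZMod 2} {X : Op n m V U} (hX : X ∈ derHom n m V U p)
    (W : Set.Iic U) (r : ℝ) : X W (O.ofFun (fun _ => r) contMDiffOn_const) = 0 := by
  have : (O.ofFun (fun _ => r) contMDiffOn_const : O n m V W.1) = r • 1 :=
    O.ext fun x => Algebra.algebraMap_eq_smul_one r
  rw [this, map_smul, derHom_one hX, smul_zero]

theorem derHom_app_isHom {p q : ZMod 2} {X : Op n m V U} (hX : X ∈ derHom n m V U p)
    (W : Set.Iic U) {f : O n m V W.1} (hf : O.IsHom q f) : O.IsHom (p + q) (X W f) := by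
  have h := hX.2.1 W f
  rw [O.IsHom, h, hf, map_smul, smul_smul]
  congr 1
  rcases zmod_cases p with rfl | rfl
  all_goals
    rcases zmod_cases q with rfl | rfl
    all_goals simp [sgn, show (1 : ZMod 2) + 1 = 0 from rfl]

theorem O.eq_zero_of_isHom {p q : ZMod 2} (hpq : p ≠ q) {f : O n m V U} (hp : O.IsHom p f)
    (hq : O.IsHom q f) : f = 0 := by
  have h : sgn p • f = sgn q • f := hp.symm.trans hq
  have h2 : (sgn p - sgn q) • f = 0 := by rw [sub_smul, h, sub_self]
  refine (smul_eq_zero.1 h2).resolve_left ?_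
  rcases zmod_cases p with rfl | rfl
  all_goals
    rcases zmod_cases q with rfl | rfl
    all_goals first | exact absurd rfl hpq | (norm_num [sgn])

namespace BundleCoords

variable {c : BundleCoords n m V}

/-- Near x₀ the function is f(x₀) + ∑ (x_k − x_k(x₀)) g_k. A derivation kills the constant and each
factor x_k − x_k(x₀); in what remains, this factor vanishes at x₀. So the whole value in `Lam m` at
x₀ is zero, and x₀ is arbitrary. -/
theorem derHom_ofFun_eq_zero (hU : U ≤ c.U) {p : ZMod 2} {X : Op n m V U}
    (hX : X ∈ derHom n m V U p) (h0 : ∀ k, X ⟨U, Set.mem_Iic.2 le_rfl⟩ (c.coord hU (.inl k)) = 0)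
    (W : Set.Iic U) (f : M → ℝ) (hf : ContMDiffOn (𝓡 n) 𝓘(ℝ) ∞ f (W.1 : Set M)) :
    X W (O.ofFun f hf) = 0 := by
  have hWU : W.1 ≤ c.U := le_trans W.2 hU
  refine loc_ext hWU fun x₀ hx₀ => ?_
  rw [loc_zero]
  obtain ⟨W', hW', hx', g, hg, hgf⟩ := c.exists_hadamard_chart (fun _ hx => (hWU hx).1) hf hx₀
  have hW'U : W' ≤ c.U := hW'.trans hWU
  let w' : Set.Iic U := ⟨W', hW'.trans W.2⟩
  let ξ : Fin n → O n m V W' := fun k => c.coord hW'U (.inl k) -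
    O.ofFun (fun _ => c.chart x₀ k) contMDiffOn_const
  have e : O.res hW' (O.ofFun f hf : O n m V W.1) = O.ofFun (fun _ => f x₀) contMDiffOn_const +
      ∑ k, ξ k * O.ofFun (g k) (hg k) := by
    refine loc_ext hW'U fun x hx => ?_
    rw [loc_res hW' _ hx, loc_ofFun _ _ (hW' hx), loc_add, loc_ofFun _ _ hx, loc_sum, hgf x hx,
      map_add, map_sum]
    congr 1
    refine Finset.sum_congr rfl fun k _ => ?_
    rw [loc_mul, loc_sub, loc_ofFun _ _ hx, loc_ofFun _ _ hx, coord, loc_ofFun _ _ hx, map_mul,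
      map_sub]
  have hξ0 : ∀ k, X w' (ξ k) = 0 := fun k => by
    rw [map_sub, derHom_ofFun_const hX, sub_zero, ← res_coord hU (hW'.trans W.2),
      ← hX.1 ⟨U, Set.mem_Iic.2 le_rfl⟩ w', h0, map_zero]
  have hξ : ∀ k, c.loc (O.sigPow W' p (ξ k)) x₀ = 0 := fun k => by
    have h1 : c.loc (ξ k) x₀ = 0 := by
      rw [loc_sub, coord, loc_ofFun _ _ hx', loc_ofFun _ _ hx', sub_self]
    rcases zmod_cases p with rfl | rfl
    · rwa [O.sigPow, if_pos rfl]
    · rw [O.sigPow, if_neg one_ne_zero, loc_sig, h1, map_zero]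
  rw [← loc_res hW' _ hx', hX.1 W w' hW', e, map_add, derHom_ofFun_const hX, zero_add, map_sum,
    loc_sum]
  refine Finset.sum_eq_zero fun k _ => ?_
  rw [hX.2.2, hξ0, zero_mul, zero_add, loc_mul, hξ, zero_mul]

theorem derHom_eq_zero_of_ofFun (hU : U ≤ c.U) {p : ZMod 2} {X : Op n m V U}
    (hX : X ∈ derHom n m V U p)
    (hf : ∀ (W : Set.Iic U) (f : M → ℝ) (hf : ContMDiffOn (𝓡 n) 𝓘(ℝ) ∞ f (W.1 : Set M)),
      X W (O.ofFun f hf) = 0)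
    (he : ∀ (W : Set.Iic U) (α : Fin m), X W (c.eStar α (le_trans W.2 hU)) = 0) : X = 0 := by
  funext W
  have hWU : W.1 ≤ c.U := le_trans W.2 hU
  have hconst : ∀ a : Lam m, X W (c.unloc hWU (fun _ => a) contMDiffOn_const) = 0 := by
    intro a
    have ha : a ∈ Algebra.adjoin ℝ (Set.range (eps (m := m))) := adjoin_eps ▸ Algebra.mem_top
    induction ha using Algebra.adjoin_induction with
    | mem a ha =>
      obtain ⟨α, rfl⟩ := ha
      rw [← he W α]
      congr 1
      exact loc_ext hWU fun x hx => by rw [loc_unloc _ _ _ hx, loc_eStar _ _ hx]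
    | algebraMap r =>
      rw [← hf W (fun _ => r) contMDiffOn_const]
      congr 1
      exact loc_ext hWU fun x hx => by rw [loc_unloc _ _ _ hx, loc_ofFun _ _ hx]
    | add a b _ _ ha hb =>
      rw [← add_zero (0 : O n m V W.1)]
      nth_rw 1 [← ha]
      rw [← hb, ← map_add]
      congr 1
      exact loc_ext hWU fun x hx => by
        rw [loc_add, loc_unloc _ _ _ hx, loc_unloc _ _ _ hx, loc_unloc _ _ _ hx]
    | mul a b _ _ ha hb =>
      have : c.unloc hWU (fun _ => a * b) contMDiffOn_const =
          c.unloc hWU (fun _ => a) contMDiffOn_const *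
            c.unloc hWU (fun _ => b) contMDiffOn_const :=
        loc_ext hWU fun x hx => by
          rw [loc_mul, loc_unloc _ _ _ hx, loc_unloc _ _ _ hx, loc_unloc _ _ _ hx]
      rw [this, hX.2.2, ha, hb, zero_mul, mul_zero, add_zero]
  refine LinearMap.ext fun s => ?_
  let b := Module.finBasis ℝ (Lam m)
  have hb : ∀ j, ContMDiffOn (𝓡 n) 𝓘(ℝ) ∞ (fun x => b.coord j (c.loc s x)) (W.1 : Set M) :=
    fun j => (LinearMap.toContinuousLinearMap (b.coord j)).contMDiff.comp_contMDiffOn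
      (loc_smooth hWU s)
  have hs : s = ∑ j, O.ofFun (fun x => b.coord j (c.loc s x)) (hb j) *
      c.unloc hWU (fun _ => b j) contMDiffOn_const := by
    refine loc_ext hWU fun x hx => ?_
    rw [loc_sum]
    conv_lhs => rw [← b.sum_repr (c.loc s x)]
    refine Finset.sum_congr rfl fun j _ => ?_
    rw [loc_mul, loc_ofFun _ _ hx, loc_unloc _ _ _ hx, ← Algebra.smul_def]
    rfl
  rw [hs, map_sum]
  refine Finset.sum_eq_zero fun j _ => ?_
  rw [hX.2.2, hf, hconst, zero_mul, mul_zero, add_zero]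

end BundleCoords

end Derivations

/-! ### Components of superderivations, Christoffel symbols of ∇, and `psi`. -/

section Superderivations

variable {U : Opens M}

theorem T.app_add (X Y : T n m V U) {W : Opens M} (h : W ≤ U) (f : O n m V W) :
    (X + Y).app h f = X.app h f + Y.app h f := rfl

theorem T.app_sub (X Y : T n m V U) {W : Opens M} (h : W ≤ U) (f : O n m V W) :
    (X - Y).app h f = X.app h f - Y.app h f := rfl

theorem T.app_sum {ι : Type*} (S : Finset ι) (X : ι → T n m V U) {W : Opens M} (h : W ≤ U)
    (f : O n m V W) : (∑ i ∈ S, X i).app h f = ∑ i ∈ S, (X i).app h f := by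
  classical
  induction S using Finset.induction_on with
  | empty => rfl
  | insert i S hi ih => rw [Finset.sum_insert hi, Finset.sum_insert hi, T.app_add, ih]

theorem T.app_smul (g : O n m V U) (X : T n m V U) {W : Opens M} (h : W ≤ U) (f : O n m V W) :
    (T.smul g X).app h f = O.res h g * X.app h f := rfl

theorem T.app_res {W : Opens M} (h : W ≤ U) (X : T n m V U) {W' : Opens M} (h' : W' ≤ W)
    (f : O n m V W') : (T.res h X).app h' f = X.app (h'.trans h) f := rfl

theorem T.res_app (X : T n m V U) {W W' : Opens M} (h : W ≤ U) (h' : W' ≤ W) (f : O n m V W) :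
    O.res h' (X.app h f) = X.app (h'.trans h) (O.res h' f) := by
  obtain ⟨Y, hY, Z, hZ, e⟩ := Submodule.mem_sup.1 (Subtype.property X)
  have : X.val = Y + Z := e.symm
  change O.res h' (X.val ⟨W, h⟩ f) = X.val ⟨W', h'.trans h⟩ (O.res h' f)
  rw [this]
  change O.res h' (Y ⟨W, h⟩ f + Z ⟨W, h⟩ f) =
    Y ⟨W', h'.trans h⟩ (O.res h' f) + Z ⟨W', h'.trans h⟩ (O.res h' f)
  rw [map_add, hY.1 ⟨W, h⟩ ⟨W', h'.trans h⟩ h' f, hZ.1 ⟨W, h⟩ ⟨W', h'.trans h⟩ h' f]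

theorem T.app_isHom {p q : ZMod 2} {X : T n m V U} (hX : X.IsHom p) {W : Opens M} (h : W ≤ U)
    {f : O n m V W} (hf : O.IsHom q f) : O.IsHom (p + q) (X.app h f) :=
  derHom_app_isHom hX ⟨W, h⟩ hf

theorem T.smul_isHom {p q : ZMod 2} {f : O n m V U} (hf : O.IsHom p f) {X : T n m V U}
    (hX : X.IsHom q) : (T.smul f X).IsHom (p + q) :=
  Op.mulLeft_mem hf hX

theorem T.res_isHom {p : ZMod 2} {X : T n m V U} (hX : X.IsHom p) {W : Opens M} (h : W ≤ U) :
    (T.res h X).IsHom p :=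
  Op.res_mem h hX

theorem O.res_isHom {p : ZMod 2} {f : O n m V U} (hf : O.IsHom p f) {W : Opens M} (h : W ≤ U) :
    O.IsHom p (O.res h f) := by
  have := congrArg (O.res h) hf
  rw [map_smul] at this
  exact this

namespace BundleCoords

variable {c : BundleCoords n m V}

theorem derHom_eq_zero_of_coord (hU : U ≤ c.U) {p : ZMod 2} {X : Op n m V U}
    (hX : X ∈ derHom n m V U p)
    (h0 : ∀ r, X ⟨U, Set.mem_Iic.2 le_rfl⟩ (c.coord hU r) = 0) : X = 0 := by
  refine derHom_eq_zero_of_ofFun hU hX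
    (derHom_ofFun_eq_zero hU hX fun k => h0 (.inl k)) fun W α => ?_
  have h1 : c.eStar α (le_trans W.2 hU) = O.res W.2 (c.coord hU (.inr α)) := rfl
  rw [h1, ← hX.1 ⟨U, Set.mem_Iic.2 le_rfl⟩ W W.2, h0, map_zero]

/-- The even and odd parts of `X` send a coordinate to superfunctions of opposite parity. If their
sum vanishes, each has both parities and so is zero, which leaves the homogeneous case. -/
theorem eq_zero_of_coord (hU : U ≤ c.U) {X : T n m V U}
    (h0 : ∀ r, X.app le_rfl (c.coord hU r) = 0) : X = 0 := by
  obtain ⟨Y, hY, Z, hZ, e⟩ := Submodule.mem_sup.1 (Subtype.property X)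
  have h1 : ∀ r, Y ⟨U, Set.mem_Iic.2 le_rfl⟩ (c.coord hU r) +
      Z ⟨U, Set.mem_Iic.2 le_rfl⟩ (c.coord hU r) = 0 := fun r => by
    rw [← h0 r]
    exact congrArg (fun A : Op n m V U => A ⟨U, Set.mem_Iic.2 le_rfl⟩ (c.coord hU r)) e
  have hpq : ∀ r : Idx n m, 0 + par r ≠ 1 + par r := fun r h =>
    zero_ne_one (α := ZMod 2) (add_right_cancel h)
  have hY0 : ∀ r, Y ⟨U, Set.mem_Iic.2 le_rfl⟩ (c.coord hU r) = 0 := fun r => by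
    refine O.eq_zero_of_isHom (hpq r) (derHom_app_isHom hY _ (coord_isHom hU r)) ?_
    have h2 := derHom_app_isHom hZ ⟨U, Set.mem_Iic.2 le_rfl⟩ (coord_isHom hU r)
    rw [eq_neg_of_add_eq_zero_left (h1 r), O.IsHom, map_neg, h2, smul_neg]
  have hZ0 : ∀ r, Z ⟨U, Set.mem_Iic.2 le_rfl⟩ (c.coord hU r) = 0 := fun r => by
    have := h1 r
    rwa [hY0, zero_add] at this
  refine Subtype.ext (e.symm.trans ?_)
  rw [derHom_eq_zero_of_coord hU hY hY0, derHom_eq_zero_of_coord hU hZ hZ0, add_zero]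
  rfl

theorem coord_inl {W : Opens M} (h : W ≤ c.U) (k : Fin n) : c.coord h (.inl k) =
    O.ofFun (fun x => c.chart x k) (c.chart_coord_smooth k fun _ hx => (h hx).1) := rfl

theorem coord_inr {W : Opens M} (h : W ≤ c.U) (α : Fin m) : c.coord h (.inr α) = c.eStar α h := rfl

theorem IsCoordDer.app_coord {d : Idx n m → T n m V c.U} (hd : c.IsCoordDer d) {W : Opens M}
    (h : W ≤ c.U) (s r : Idx n m) : (d s).app h (c.coord h r) = if s = r then 1 else 0 := by
  rcases s with i | α <;> rcases r with k | β
  · rw [coord_inl]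
    refine O.ext fun x => ?_
    rw [hd.even_fun i W h]
    have hx := c.chart_mem_target_inter (W := W) (fun _ hx => (h hx).1) x.2
    have h1 : (fun x => c.chart x k) ∘ c.chart.symm =ᶠ[𝓝 (c.chart x)]
        (EuclideanSpace.proj k : Eu n →L[ℝ] ℝ) := by
      filter_upwards [c.chart.open_target.mem_nhds hx.1] with y hy
      rw [Function.comp_apply, c.chart.right_inv hy]
      rfl
    rw [h1.fderiv_eq, ContinuousLinearMap.fderiv]
    change algebraMap ℝ _ ((EuclideanSpace.single i (1 : ℝ) : Eu n) k) = _
    rw [PiLp.single_apply]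
    by_cases hik : i = k
    · rw [if_pos hik.symm, if_pos (by rw [hik]), map_one]
      rfl
    · rw [if_neg (Ne.symm hik), if_neg (by simpa using hik), map_zero]
      rfl
  · rw [if_neg (by simp), coord_inr]
    exact hd.even_eStar i β W h
  · rw [if_neg (by simp), coord_inl]
    exact hd.odd_fun α W h _ _
  · rw [coord_inr, hd.odd_eStar α β W h]
    simp only [Sum.inr.injEq]

theorem IsCoordDer.unique {d : Idx n m → T n m V c.U} (hd : c.IsCoordDer d) : d = c.coordDer := by
  funext s
  refine sub_eq_zero.1 (eq_zero_of_coord le_rfl fun r => ?_)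
  rw [T.app_sub, hd.app_coord, c.isCoordDer_coordDer.app_coord, sub_self]

theorem coordDer_coord {W : Opens M} (h : W ≤ c.U) (s r : Idx n m) :
    (c.coordDer s).app h (c.coord h r) = if s = r then 1 else 0 :=
  c.isCoordDer_coordDer.app_coord h s r

theorem coordDer_isHom (s : Idx n m) : (c.coordDer s).IsHom (par s) := by
  rcases s with i | α
  · exact c.evenOp_mem i
  · exact c.oddOp_mem α

/-- The component `X^r = X(x^r)` of a superderivation. -/
noncomputable def cmp (hU : U ≤ c.U) (X : T n m V U) (r : Idx n m) : O n m V U :=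
  X.app le_rfl (c.coord hU r)

theorem cmp_isHom (hU : U ≤ c.U) {p : ZMod 2} {X : T n m V U} (hX : X.IsHom p) (r : Idx n m) :
    O.IsHom (p + par r) (cmp hU X r) :=
  T.app_isHom hX le_rfl (coord_isHom hU r)

theorem cmp_res (hU : U ≤ c.U) {W : Opens M} (h : W ≤ U) (X : T n m V U) (r : Idx n m) :
    cmp (h.trans hU) (T.res h X) r = O.res h (cmp hU X r) := by
  rw [cmp, cmp, T.res_app, res_coord hU h]
  rfl

/-- Both sides take the same values on the coordinates, so their difference vanishes by
`eq_zero_of_coord`. -/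
theorem eq_sum_cmp (hU : U ≤ c.U) (X : T n m V U) :
    X = ∑ r, T.smul (cmp hU X r) (T.res hU (c.coordDer r)) := by
  refine sub_eq_zero.1 (eq_zero_of_coord hU fun s => ?_)
  rw [T.app_sub, T.app_sum, sub_eq_zero]
  have : ∀ r, (T.smul (cmp hU X r) (T.res hU (c.coordDer r))).app le_rfl (c.coord hU s) =
      if r = s then cmp hU X r else 0 := fun r => by
    rw [T.app_smul, T.app_res, coordDer_coord, mul_ite, mul_one, mul_zero]
    rfl
  simp only [this, Finset.sum_ite_eq', Finset.mem_univ, if_true]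
  rfl

theorem app_eq_sum_cmp (hU : U ≤ c.U) (X : T n m V U) {W : Opens M} (h : W ≤ U) (f : O n m V W) :
    X.app h f = ∑ r, O.res h (cmp hU X r) * (c.coordDer r).app (h.trans hU) f := by
  conv_lhs => rw [eq_sum_cmp hU X]
  rw [T.app_sum]
  rfl

/-- The Christoffel symbols of a superconnection. -/
noncomputable def superChristoffel (c : BundleCoords n m V) (nab : SuperConnection n m V)
    (s u r : Idx n m) : O n m V c.U :=
  cmp le_rfl (nab.cov c.U (c.coordDer s) (c.coordDer u)) r

theorem isSuperChristoffel_superChristoffel (nab : SuperConnection n m V) :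
    c.IsSuperChristoffel nab c.coordDer (c.superChristoffel nab) := fun _ _ =>
  eq_sum_cmp le_rfl _

theorem IsSuperChristoffel.unique {nab : SuperConnection n m V}
    {Γ : Idx n m → Idx n m → Idx n m → O n m V c.U}
    (hΓ : c.IsSuperChristoffel nab c.coordDer Γ) : Γ = c.superChristoffel nab := by
  funext s u r
  rw [superChristoffel, cmp, hΓ s u, T.app_sum]
  have : ∀ r', (T.smul (Γ s u r') (c.coordDer r')).app le_rfl (c.coord le_rfl r) =
      if r' = r then Γ s u r' else 0 := fun r' => by
    rw [T.app_smul, coordDer_coord, mul_ite, mul_one, mul_zero]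
    rfl
  simp only [this, Finset.sum_ite_eq', Finset.mem_univ, if_true]

theorem superChristoffel_isHom (nab : SuperConnection n m V) (s u r : Idx n m) :
    O.IsHom (par s + par u + par r) (c.superChristoffel nab s u r) :=
  cmp_isHom le_rfl (nab.even c.U _ _ _ _ (coordDer_isHom s) (coordDer_isHom u)) r

theorem cmp_add (hU : U ≤ c.U) (X Y : T n m V U) (r : Idx n m) :
    cmp hU (X + Y) r = cmp hU X r + cmp hU Y r := rfl

theorem cmp_sum (hU : U ≤ c.U) {ι : Type*} (S : Finset ι) (X : ι → T n m V U) (r : Idx n m) :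
    cmp hU (∑ i ∈ S, X i) r = ∑ i ∈ S, cmp hU (X i) r := T.app_sum S X le_rfl _

theorem cmp_smul (hU : U ≤ c.U) (f : O n m V U) (X : T n m V U) (r : Idx n m) :
    cmp hU (T.smul f X) r = f * cmp hU X r := rfl

theorem cmp_coordDer {W : Opens M} (h : W ≤ c.U) (s r : Idx n m) :
    cmp h (T.res h (c.coordDer s)) r = if s = r then 1 else 0 :=
  coordDer_coord h s r

/-- Expand both arguments in the coordinate frame. Linearity disposes of X, the Leibniz rule of Y,
and its sign is trivial because `X` is even. The order Y^u X^s Γ matters: it lets the truncated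
product rules of `psi` be applied from the left. -/
theorem cmp_cov (hU : U ≤ c.U) (nab : SuperConnection n m V) {X : T n m V U} (hX : X.IsHom 0)
    (Y : T n m V U) (r : Idx n m) :
    cmp hU (nab.cov U X Y) r = X.app le_rfl (cmp hU Y r) +
      ∑ u, ∑ s, cmp hU Y u * (cmp hU X s * O.res hU (c.superChristoffel nab s u r)) := by
  have h1 : ∀ u, cmp hU (nab.cov U X (T.res hU (c.coordDer u))) r =
      ∑ s, cmp hU X s * O.res hU (c.superChristoffel nab s u r) := fun u => by
    conv_lhs => rw [eq_sum_cmp hU X]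
    rw [map_sum, LinearMap.sum_apply, cmp_sum]
    refine Finset.sum_congr rfl fun s _ => ?_
    rw [nab.smul_left, cmp_smul, ← nab.res_cov, superChristoffel, ← cmp_res le_rfl hU]
  conv_lhs => rw [eq_sum_cmp hU Y]
  rw [map_sum, cmp_sum]
  have h2 : ∀ u, cmp hU (nab.cov U X (T.smul (cmp hU Y u) (T.res hU (c.coordDer u)))) r =
      (if u = r then X.app le_rfl (cmp hU Y u) else 0) +
        ∑ s, cmp hU Y u * (cmp hU X s * O.res hU (c.superChristoffel nab s u r)) := fun u => by
    rw [nab.leibniz U 0 _ _ _ hX, cmp_add, cmp_smul, cmp_smul, cmp_coordDer, h1, Finset.mul_sum,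
      mul_ite, mul_one, mul_zero, O.sigPow, if_pos rfl]
    rfl
  simp only [h2, Finset.sum_add_distrib, Finset.sum_ite_eq', Finset.mem_univ, if_true]

/-! ### Parts of degree at most one -/

theorem loc_even {W : Opens M} {f : O n m V W} (hf : O.IsHom 0 f) (x : M) :
    invol (c.loc f x) = c.loc f x := by
  rw [← loc_sig, hf, sgn, if_pos rfl, one_smul]

theorem loc_odd {W : Opens M} {f : O n m V W} (hf : O.IsHom 1 f) (x : M) :
    invol (c.loc f x) = -c.loc f x := by
  rw [← loc_sig, hf, sgn, if_neg one_ne_zero, loc_smul, neg_one_smul]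

theorem psi_mul_even (hU : U ≤ c.U) {f : O n m V U} (hf : O.IsHom 0 f) (g : O n m V U)
    {e : TotalSpace (Eu m) V} (he : e.1 ∈ U) :
    psi (f * g).val e = psi f.val e * psi g.val e := by
  rw [psi_eq hU _ he, psi_eq hU _ he, psi_eq hU _ he, loc_mul, affEval_mul,
    affEval_of_even _ (loc_even hf _), ιInv_of_even (loc_even hf _), LinearMap.zero_apply, zero_mul,
    add_zero]

theorem psi_mul_odd (hU : U ≤ c.U) {f : O n m V U} (hf : O.IsHom 1 f) (g : O n m V U)
    {e : TotalSpace (Eu m) V} (he : e.1 ∈ U) :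
    psi (f * g).val e = psi f.val e * g.red e.1 := by
  rw [psi_eq hU _ he, psi_eq hU _ he, red_eq hU _ he, loc_mul, affEval_mul,
    affEval_of_odd _ (loc_odd hf _), algebraMapInv_of_odd (loc_odd hf _), zero_mul, zero_add]

theorem red_mul (hU : U ≤ c.U) (f g : O n m V U) {x : M} (hx : x ∈ U) :
    (f * g).red x = f.red x * g.red x := by
  rw [red_eq hU _ hx, red_eq hU _ hx, red_eq hU _ hx, loc_mul, map_mul]

theorem red_odd (hU : U ≤ c.U) {f : O n m V U} (hf : O.IsHom 1 f) {x : M} (hx : x ∈ U) :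
    f.red x = 0 := by
  rw [red_eq hU _ hx, algebraMapInv_of_odd (loc_odd hf _)]

theorem psi_even (hU : U ≤ c.U) {f : O n m V U} (hf : O.IsHom 0 f) {e : TotalSpace (Eu m) V}
    (he : e.1 ∈ U) : psi f.val e = f.red e.1 := by
  rw [psi_eq hU _ he, red_eq hU _ he, affEval_of_even _ (loc_even hf _)]

theorem psi_res {W : Opens M} (h : W ≤ U) (f : O n m V U) {e : TotalSpace (Eu m) V}
    (he : e.1 ∈ W) : psi (O.res h f).val e = psi f.val e := by
  rw [psi, psi, dif_pos he, dif_pos (h he)]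
  rfl

theorem red_res {W : Opens M} (h : W ≤ U) (f : O n m V U) {x : M} (hx : x ∈ W) :
    (O.res h f).red x = f.red x := by
  rw [O.red, O.red, dif_pos hx, dif_pos (h hx)]
  rfl

theorem psi_add (f g : O n m V U) {e : TotalSpace (Eu m) V} (he : e.1 ∈ U) :
    psi (f + g).val e = psi f.val e + psi g.val e := by
  have : ∀ x, (f + g).val x = f.val x + g.val x := fun _ => rfl
  rw [psi, psi, psi, dif_pos he, dif_pos he, dif_pos he, this, map_add, map_add,
    LinearMap.add_apply]
  ring

theorem psi_zero {e : TotalSpace (Eu m) V} : psi (0 : O n m V U).val e = 0 := by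
  have : ∀ x, (0 : O n m V U).val x = 0 := fun _ => rfl
  rw [psi]
  split_ifs
  · rw [this, map_zero, map_zero, LinearMap.zero_apply, add_zero]
  · rfl

theorem psi_sum {ι : Type*} (S : Finset ι) (f : ι → O n m V U) {e : TotalSpace (Eu m) V}
    (he : e.1 ∈ U) : psi (∑ i ∈ S, f i).val e = ∑ i ∈ S, psi (f i).val e := by
  classical
  induction S using Finset.induction_on with
  | empty => exact psi_zero
  | insert i S hi ih => rw [Finset.sum_insert hi, Finset.sum_insert hi, psi_add _ _ he, ih]

theorem psi_one {e : TotalSpace (Eu m) V} (he : e.1 ∈ U) : psi (1 : O n m V U).val e = 1 := by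
  have : ∀ x, (1 : O n m V U).val x = algebraMap ℝ _ 1 := fun _ => (map_one _).symm
  rw [psi, dif_pos he, this, algebraMapInv_algebraMap, ιInv_algebraMap, LinearMap.zero_apply,
    add_zero]

/-- The truncation in the definition of the reduction is invisible to `psi`, which only sees degrees
at most one. Hence no projection appears in the computations below. -/
theorem psi_pr (f : O n m V U) (e : TotalSpace (Eu m) V) :
    psi (fun x : U => pr (x : M) (f.val x)) e = psi f.val e := by
  rw [psi, psi]
  split_ifs with he
  · have h1 : ∀ a : LamFib V e.1, algebraMapInv (pr e.1 a) = algebraMapInv a := fun a => by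
      change algebraMapInv (algebraMap ℝ _ (algebraMapInv a) + ExteriorAlgebra.ι ℝ (ιInv a)) = _
      rw [map_add, algebraMapInv_algebraMap, algebraMapInv_ι, add_zero]
    have h2 : ∀ a : LamFib V e.1, ιInv (pr e.1 a) = ιInv a := fun a => by
      change ιInv (algebraMap ℝ _ (algebraMapInv a) + ExteriorAlgebra.ι ℝ (ιInv a)) = _
      rw [map_add, ιInv_algebraMap, ιInv_ι, zero_add]
    rw [h1, h2]
  · rfl

/-- The Christoffel symbols of the reduction. -/
noncomputable def redChristoffel (c : BundleCoords n m V) (nab : SuperConnection n m V) :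
    Idx n m → Idx n m → Idx n m → TotalSpace (Eu m) V → ℝ
  | .inl i, .inl j, r, e => psi (c.superChristoffel nab (.inl i) (.inl j) r).val e
  | .inl i, .inr β, r, e => (c.superChristoffel nab (.inl i) (.inr β) r).red e.1
  | .inr α, .inl j, r, e => (c.superChristoffel nab (.inr α) (.inl j) r).red e.1
  | .inr _, .inr _, _, _ => 0

/-- This computation explains the shape of `redChristoffel`. Even factors leave `psi`
multiplicative, so Γ enters as ψ(Γ). One odd factor forces what follows it to be replaced by its
reduction, so Γ enters as Γ̃. Two odd factors already have degree at least two, so nothing survives.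
-/
theorem psi_mul_superChristoffel (hU : U ≤ c.U) (nab : SuperConnection n m V)
    {s u : Idx n m} (r : Idx n m) {f g : O n m V U} (hf : O.IsHom (par u) f)
    (hg : O.IsHom (par s) g) {e : TotalSpace (Eu m) V} (he : e.1 ∈ U) :
    psi (f * (g * O.res hU (c.superChristoffel nab s u r))).val e =
      psi f.val e * psi g.val e * c.redChristoffel nab s u r e := by
  rcases s with i | α <;> rcases u with j | β
  · rw [psi_mul_even hU hf _ he, psi_mul_even hU hg _ he, psi_res hU _ he, mul_assoc]
    rfl
  · rw [psi_mul_odd hU hf _ he, red_mul hU _ _ he, psi_even hU hg he, red_res hU _ he, mul_assoc]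
    rfl
  · rw [psi_mul_even hU hf _ he, psi_mul_odd hU hg _ he, red_res hU _ he, mul_assoc]
    rfl
  · rw [psi_mul_odd hU hf _ he, red_mul hU _ _ he, red_odd hU hg he, zero_mul, mul_zero]
    exact (mul_zero _).symm

theorem psi_cmp_cov (hU : U ≤ c.U) (nab : SuperConnection n m V) {X Y : T n m V U}
    (hX : X.IsHom 0) (hY : Y.IsHom 0) (r : Idx n m) {e : TotalSpace (Eu m) V} (he : e.1 ∈ U) :
    psi (cmp hU (nab.cov U X Y) r).val e = psi (X.app le_rfl (cmp hU Y r)).val e +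
      ∑ u, ∑ s, psi (cmp hU Y u).val e * psi (cmp hU X s).val e *
        c.redChristoffel nab s u r e := by
  rw [cmp_cov hU nab hX, psi_add _ _ he, psi_sum _ _ he]
  congr 1
  refine Finset.sum_congr rfl fun u _ => ?_
  rw [psi_sum _ _ he]
  refine Finset.sum_congr rfl fun s _ => ?_
  refine psi_mul_superChristoffel hU nab r ?_ ?_ he
  · simpa using cmp_isHom hU hY u
  · simpa using cmp_isHom hU hX s

/-- The derivative of `ψ(f)` along the `r`-th coordinate of `E`. -/
noncomputable def psiDer {W : Opens M} (h : W ≤ c.U) (f : O n m V W) :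
    Idx n m → TotalSpace (Eu m) V → ℝ
  | .inl k, e => psi ((c.coordDer (.inl k)).app h f).val e
  | .inr α, e => ((c.coordDer (.inr α)).app h f).red e.1

/-- The fibre components of an even `X` are odd, so only the reduction of ∂̂_α f contributes next to
them. The formula holds for every superfunction `f`, not only for those in F. -/
theorem psi_app (hU : U ≤ c.U) {X : T n m V U} (hX : X.IsHom 0) {W : Opens M} (h : W ≤ U)
    (f : O n m V W) {e : TotalSpace (Eu m) V} (he : e.1 ∈ W) :
    psi (X.app h f).val e = ∑ r, psi (cmp hU X r).val e * psiDer (h.trans hU) f r e := by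
  rw [app_eq_sum_cmp hU X h, psi_sum _ _ he]
  refine Finset.sum_congr rfl fun r _ => ?_
  have hr : O.IsHom (par r) (O.res h (cmp hU X r)) :=
    O.res_isHom (by simpa using cmp_isHom hU hX r) h
  rcases r with k | α
  · rw [psi_mul_even (h.trans hU) hr _ he, psi_res h _ he]
    rfl
  · rw [psi_mul_odd (h.trans hU) hr _ he, psi_res h _ he]
    rfl

/-! ### Superderivations preserving the superfunctions of degree at most one -/

/-- The projection of the exterior algebra of the model onto the parts of degree at most one. -/
noncomputable def prL (m : ℕ) : Lam m →ₗ[ℝ] Lam m :=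
  Algebra.linearMap ℝ _ ∘ₗ ExteriorAlgebra.algebraMapInv.toLinearMap +
    ExteriorAlgebra.ι ℝ ∘ₗ ExteriorAlgebra.ιInv

theorem prL_apply (a : Lam m) :
    prL m a = algebraMap ℝ _ (algebraMapInv a) + ExteriorAlgebra.ι ℝ (ιInv a) := rfl

theorem pr_up (x : M) (a : Lam m) : pr x (c.up x a) = c.up x (prL m a) := by
  change algebraMap ℝ _ (algebraMapInv (c.up x a)) + ExteriorAlgebra.ι ℝ (ιInv (c.up x a)) = _
  rw [prL_apply, map_add, AlgHom.commutes, up, algebraMapInv_map, ιInv_map,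
    ExteriorAlgebra.map_apply_ι]

theorem memF_iff (hU : U ≤ c.U) (f : O n m V U) :
    f.MemF ↔ ∀ x ∈ U, prL m (c.loc f x) = c.loc f x := by
  refine ⟨fun h x hx => ?_, fun h x => ?_⟩
  · have := h ⟨x, hx⟩
    rw [← up_loc hU f hx, pr_up] at this
    have := congrArg (c.dn x) this
    rwa [c.dn_up (hU hx).2, c.dn_up (hU hx).2] at this
  · rw [← up_loc hU f x.2, pr_up, h x x.2]

/-- The superfunctions `1` and `e_α^*`. -/
noncomputable def frameCoeff (c : BundleCoords n m V) : Idx n m → O n m V c.U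
  | .inl _ => 1
  | .inr α => c.coord le_rfl (.inr α)

theorem frameCoeff_isHom (s : Idx n m) : O.IsHom (par s) (c.frameCoeff s) := by
  rcases s with i | α
  · refine (map_one (O.sig c.U)).trans ?_
    rw [par, sgn, if_pos rfl, one_smul]
    rfl
  · exact coord_isHom le_rfl _

/-- The even superderivations `∂̂_i` and `e_α^* ∂̂_α`. -/
noncomputable def evenFrame (c : BundleCoords n m V) (s : Idx n m) : T n m V c.U :=
  T.smul (c.frameCoeff s) (c.coordDer s)

theorem par_add_par (s : Idx n m) : par s + par s = 0 := by
  rcases s with i | α <;> rfl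

/-- An odd ∂̂_α is not a member of L₀; the factor e_α^* makes it even. On degree at most one, e_α^*
∂̂_α extracts the e_α^*-term, so F is preserved. The base fields differentiate coefficients and
hence commute with the projection to F. -/
theorem evenFrame_memL0 (s : Idx n m) : (c.evenFrame s).MemL0 := by
  refine ⟨par_add_par s ▸ T.smul_isHom (frameCoeff_isHom s) (coordDer_isHom s), fun W h f hf => ?_⟩
  rw [memF_iff h] at hf ⊢
  intro x hx
  rw [evenFrame, T.app_smul, loc_mul, loc_res h _ hx]
  rcases s with i | α
  · rw [loc_coordDer_inl _ _ _ _ hx, frameCoeff, loc_one (h hx), one_mul]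
    have h1 := c.pd_clm W.2 (fun _ hx => (h hx).1) i (loc_smooth h f)
      (LinearMap.toContinuousLinearMap (prL m)) hx
    refine h1.symm.trans ?_
    exact c.pd_congr W.2 (fun _ hx => (h hx).1) i hf hx
  · rw [loc_coordDer_inr _ _ _ _ hx, frameCoeff, coord, loc_eStar _ _ (h hx), ← hf x hx]
    -- Contracting an element of degree at most one leaves a scalar, so multiplying by `eps α`
    -- returns to degree one.
    have h1 : ∀ a : Lam m, eps α * contr m α (prL m a) =
        ιInv a (EuclideanSpace.single α 1) • eps α := fun a => by
      rw [prL_apply, map_add, contr, contract_algebraMap, contract_ι, zero_add,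
        ← Algebra.commutes, ← Algebra.smul_def]
      rfl
    rw [h1, map_smul, prL_apply, eps, algebraMapInv_ι, ιInv_ι, map_zero, zero_add]

theorem _root_.SuperRed.T.MemL0.res {X : T n m V U} (hX : X.MemL0) {W : Opens M} (h : W ≤ U) :
    (T.res h X).MemL0 :=
  ⟨T.res_isHom hX.1 h, fun W' h' f hf => hX.2 W' (h'.trans h) f hf⟩

theorem cmp_evenFrame {W : Opens M} (h : W ≤ c.U) (s r : Idx n m) :
    cmp h (T.res h (c.evenFrame s)) r = if s = r then O.res h (c.frameCoeff s) else 0 := by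
  have : cmp h (T.res h (c.evenFrame s)) r =
      O.res h (c.frameCoeff s) * cmp h (T.res h (c.coordDer s)) r := rfl
  rw [this, cmp_coordDer, mul_ite, mul_one, mul_zero]

end BundleCoords

end Superderivations

/-! ### Regularity of differentials applied to vector fields. -/

section DirectionalDerivatives

variable {E : Type*} [NormedAddCommGroup E] [NormedSpace ℝ E] {H : Type*} [TopologicalSpace H]
  {I : ModelWithCorners ℝ E H} {N : Type*} [TopologicalSpace N] [ChartedSpace H N]
  [IsManifold I ∞ N]

/-- Reading df and the tangent vector in one fixed trivialization near e₀ turns the pairing into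
application of a linear map between fixed spaces. The regularity of e ↦ df_e(Y_e) then follows from
that of the two factors. -/
theorem mfderiv_eq_inTangentCoordinates (g : N → ℝ) (e₀ : N) {e : N}
    (he : e ∈ (trivializationAt E (TangentSpace I : N → Type _) e₀).baseSet)
    (ξ : TangentSpace I e) :
    mfderiv I 𝓘(ℝ) g e ξ = inTangentCoordinates I 𝓘(ℝ) id g (mfderiv I 𝓘(ℝ) g) e₀ e
      (trivializationAt E (TangentSpace I : N → Type _) e₀ ⟨e, ξ⟩).2 := by
  have h1 := (trivializationAt E (TangentSpace I : N → Type _) e₀).symmL_continuousLinearMapAt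
    (R := ℝ) he ξ
  rw [Trivialization.continuousLinearMapAt_apply,
    Trivialization.coe_linearMapAt_of_mem _ he] at h1
  simp only [inTangentCoordinates, ContinuousLinearMap.inCoordinates,
    ContinuousLinearMap.comp_apply, id_eq]
  rw [h1, TangentBundle.continuousLinearMapAt_model_space]
  rfl

theorem mdifferentiableAt_mfderiv_apply {g : N → ℝ} {Y : Π e : N, TangentSpace I e} {e₀ : N}
    (hg : ContMDiffAt I 𝓘(ℝ) ∞ g e₀)
    (hY : MDifferentiableAt I (I.prod 𝓘(ℝ, E))
      (fun e => (⟨e, Y e⟩ : TotalSpace E (TangentSpace I : N → Type _))) e₀) :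
    MDifferentiableAt I 𝓘(ℝ) (fun e => (mfderiv I 𝓘(ℝ) g e (Y e) : ℝ)) e₀ := by
  have h1 : MDifferentiableAt I 𝓘(ℝ, E →L[ℝ] ℝ)
      (inTangentCoordinates I 𝓘(ℝ) id g (mfderiv I 𝓘(ℝ) g) e₀) e₀ :=
    (ContMDiffAt.mfderiv_const hg (m := ∞) le_rfl).mdifferentiableAt (by simp)
  have h2 := (mdifferentiableAt_section I Y).1 hY
  refine (h1.clm_apply h2).congr_of_eventuallyEq ?_
  filter_upwards [(trivializationAt E (TangentSpace I : N → Type _) e₀).open_baseSet.mem_nhds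
    (FiberBundle.mem_baseSet_trivializationAt' e₀)] with e he
  exact mfderiv_eq_inTangentCoordinates g e₀ he (Y e)

theorem contMDiffAt_mfderiv_apply {g : N → ℝ} {Y : Π e : N, TangentSpace I e} {e₀ : N}
    (hg : ContMDiffAt I 𝓘(ℝ) ∞ g e₀)
    (hY : ContMDiffAt I (I.prod 𝓘(ℝ, E)) ∞
      (fun e => (⟨e, Y e⟩ : TotalSpace E (TangentSpace I : N → Type _))) e₀) :
    ContMDiffAt I 𝓘(ℝ) ∞ (fun e => (mfderiv I 𝓘(ℝ) g e (Y e) : ℝ)) e₀ := by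
  have h1 : ContMDiffAt I 𝓘(ℝ, E →L[ℝ] ℝ) ∞
      (inTangentCoordinates I 𝓘(ℝ) id g (mfderiv I 𝓘(ℝ) g) e₀) e₀ :=
    ContMDiffAt.mfderiv_const hg (m := ∞) le_rfl
  have h2 := (contMDiffAt_section e₀).1 hY
  refine (h1.clm_apply h2).congr_of_eventuallyEq ?_
  filter_upwards [(trivializationAt E (TangentSpace I : N → Type _) e₀).open_baseSet.mem_nhds
    (FiberBundle.mem_baseSet_trivializationAt' e₀)] with e he
  exact mfderiv_eq_inTangentCoordinates g e₀ he (Y e)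

variable (I) in
/-- The differential of a real valued function. -/
noncomputable def dL (g : N → ℝ) (e : N) : TangentSpace I e →L[ℝ] ℝ := mfderiv I 𝓘(ℝ) g e

/-- The differential of a smooth function tensored with a smooth vector field is a smooth section
of the endomorphism bundle. -/
theorem contMDiffAt_mfderiv_smulRight {g : N → ℝ} {Z : Π e : N, TangentSpace I e} {e₀ : N}
    (hg : ContMDiffAt I 𝓘(ℝ) ∞ g e₀)
    (hZ : ContMDiffAt I (I.prod 𝓘(ℝ, E)) ∞
      (fun e => (⟨e, Z e⟩ : TotalSpace E (TangentSpace I : N → Type _))) e₀) :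
    ContMDiffAt I (I.prod 𝓘(ℝ, E →L[ℝ] E)) ∞
      (fun e => (⟨e, (dL I g e).smulRight (Z e)⟩ : TotalSpace (E →L[ℝ] E)
          fun e : N => TangentSpace I e →L[ℝ] TangentSpace I e)) e₀ := by
  have h1 : ContMDiffAt I 𝓘(ℝ, E →L[ℝ] ℝ) ∞
      (inTangentCoordinates I 𝓘(ℝ) id g (mfderiv I 𝓘(ℝ) g) e₀) e₀ :=
    ContMDiffAt.mfderiv_const hg (m := ∞) le_rfl
  have h2 := (contMDiffAt_section e₀).1 hZ
  rw [contMDiffAt_hom_bundle]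
  refine ⟨contMDiffAt_id, ?_⟩
  have h3 := ((ContinuousLinearMap.smulRightL ℝ E E).contMDiff.contMDiffAt.comp e₀ h1).clm_apply h2
  refine h3.congr_of_eventuallyEq ?_
  filter_upwards [(trivializationAt E (TangentSpace I : N → Type _) e₀).open_baseSet.mem_nhds
    (FiberBundle.mem_baseSet_trivializationAt' e₀)] with e he
  refine ContinuousLinearMap.ext fun v => ?_
  have h4 : dL I g e ((trivializationAt E (TangentSpace I : N → Type _) e₀).symmL ℝ e v) =
      inTangentCoordinates I 𝓘(ℝ) id g (mfderiv I 𝓘(ℝ) g) e₀ e v := by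
    simp only [inTangentCoordinates, ContinuousLinearMap.inCoordinates,
      ContinuousLinearMap.comp_apply, id_eq]
    rw [TangentBundle.continuousLinearMapAt_model_space]
    rfl
  change (trivializationAt E (TangentSpace I : N → Type _) e₀).continuousLinearMapAt ℝ e
    (dL I g e ((trivializationAt E (TangentSpace I : N → Type _) e₀).symmL ℝ e v) • Z e) =
      inTangentCoordinates I 𝓘(ℝ) id g (mfderiv I 𝓘(ℝ) g) e₀ e v •
        (trivializationAt E (TangentSpace I : N → Type _) e₀ ⟨e, Z e⟩).2
  rw [map_smul, h4, Trivialization.continuousLinearMapAt_apply,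
    Trivialization.coe_linearMapAt_of_mem _ he]

end DirectionalDerivatives

/-! ### Coordinates and coordinate vector fields on the total space E. -/

namespace BundleCoords

variable (c : BundleCoords n m V)

theorem coordE_smooth : ContMDiffOn ((𝓡 n).prod 𝓘(ℝ, Eu m)) 𝓘(ℝ, Eu n × Eu m) ∞ c.coordE
    (TotalSpace.proj ⁻¹' (c.U : Set M)) := by
  refine ContMDiffOn.prodMk_space ?_ ?_
  · exact c.chart_smooth.comp (contMDiff_proj V).contMDiffOn fun e he => he.1
  · exact contMDiff_snd.comp_contMDiffOn (c.smooth.mono fun e he => c.triv.mem_source.2 he.2)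

/-- The inverse of the coordinate map `coordE`. -/
noncomputable def coordInv (p : Eu n × Eu m) : TotalSpace (Eu m) V :=
  c.triv.toOpenPartialHomeomorph.symm (c.chart.symm p.1, p.2)

/-- The coordinate domain in `ℝⁿ × ℝᵐ`. -/
def coordRange : Set (Eu n × Eu m) :=
  Prod.fst ⁻¹' (c.chart.target ∩ c.chart.symm ⁻¹' (c.U : Set M))

theorem isOpen_coordRange : IsOpen c.coordRange :=
  (c.isOpen_target_inter c.U.2).preimage continuous_fst

theorem coordE_mem {e : TotalSpace (Eu m) V} (he : e.1 ∈ c.U) : c.coordE e ∈ c.coordRange :=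
  c.chart_mem_target_inter c.U_subset_source he

theorem coordInv_coordE {e : TotalSpace (Eu m) V} (he : e.1 ∈ c.U) :
    c.coordInv (c.coordE e) = e := by
  rw [coordInv, coordE, c.chart.left_inv he.1, ← c.triv.coe_fst' he.2]
  exact c.triv.toOpenPartialHomeomorph.left_inv (c.triv.mem_source.2 he.2)

theorem coordInv_proj {p : Eu n × Eu m} (hp : p ∈ c.coordRange) :
    (c.coordInv p).1 = c.chart.symm p.1 := by
  rw [coordInv, c.triv_symm_apply hp.2.2]

theorem coordE_coordInv {p : Eu n × Eu m} (hp : p ∈ c.coordRange) :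
    c.coordE (c.coordInv p) = p := by
  have h1 : c.triv (c.coordInv p) = (c.chart.symm p.1, p.2) :=
    c.triv.toOpenPartialHomeomorph.right_inv (c.triv.mem_target.2 hp.2.2)
  rw [coordE, h1, c.coordInv_proj hp, c.chart.right_inv hp.1]

theorem coordInv_smooth : ContMDiffOn 𝓘(ℝ, Eu n × Eu m) ((𝓡 n).prod 𝓘(ℝ, Eu m)) ∞ c.coordInv
    c.coordRange := by
  refine c.smooth_symm.comp (t := c.triv.target) ?_ fun p hp => c.triv.mem_target.2 hp.2.2
  exact (c.chart_symm_smooth.comp contDiff_fst.contMDiff.contMDiffOn fun p hp => hp.1).prodMk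
    contDiff_snd.contMDiff.contMDiffOn

theorem isOpen_over {W : Set M} (hW : IsOpen W) :
    IsOpen (TotalSpace.proj ⁻¹' W : Set (TotalSpace (Eu m) V)) :=
  isOpen_preimage_proj hW

variable {c} in
theorem coordE_mdifferentiableAt {e : TotalSpace (Eu m) V} (he : e.1 ∈ c.U) :
    MDifferentiableAt ((𝓡 n).prod 𝓘(ℝ, Eu m)) 𝓘(ℝ, Eu n × Eu m) c.coordE e :=
  (c.coordE_smooth.contMDiffAt ((isOpen_over c.U.2).mem_nhds he)).mdifferentiableAt (by simp)

/-- The chain rule for the two composites with `coordInv` gives a two-sided inverse. This is needed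
because `vf` uses `ContinuousLinearMap.inverse`, which has the default value zero on maps that are
not invertible. -/
theorem isInvertible_mfderiv_coordE {e : TotalSpace (Eu m) V} (he : e.1 ∈ c.U) :
    (mfderiv ((𝓡 n).prod 𝓘(ℝ, Eu m)) 𝓘(ℝ, Eu n × Eu m) c.coordE e).IsInvertible := by
  have h1 := (coordE_mdifferentiableAt he).hasMFDerivAt
  have h2 : HasMFDerivAt 𝓘(ℝ, Eu n × Eu m) ((𝓡 n).prod 𝓘(ℝ, Eu m)) c.coordInv (c.coordE e) _ :=
    ((c.coordInv_smooth.contMDiffAt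
      (c.isOpen_coordRange.mem_nhds (c.coordE_mem he))).mdifferentiableAt (by simp)).hasMFDerivAt
  have h3 := h2.comp e h1
  have h4 : HasMFDerivAt ((𝓡 n).prod 𝓘(ℝ, Eu m)) ((𝓡 n).prod 𝓘(ℝ, Eu m))
      (c.coordInv ∘ c.coordE) e (ContinuousLinearMap.id ℝ _) :=
    (hasMFDerivAt_id e).congr_of_eventuallyEq (by
      filter_upwards [(isOpen_over c.U.2).mem_nhds he] with e' he'
      exact c.coordInv_coordE he')
  have h1' : HasMFDerivAt ((𝓡 n).prod 𝓘(ℝ, Eu m)) 𝓘(ℝ, Eu n × Eu m) c.coordE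
      (c.coordInv (c.coordE e)) (mfderiv ((𝓡 n).prod 𝓘(ℝ, Eu m)) 𝓘(ℝ, Eu n × Eu m) c.coordE e) := by
    rw [c.coordInv_coordE he]; exact h1
  have h5 := h1'.comp (c.coordE e) h2
  have h6 : HasMFDerivAt 𝓘(ℝ, Eu n × Eu m) 𝓘(ℝ, Eu n × Eu m)
      (c.coordE ∘ c.coordInv) (c.coordE e) (ContinuousLinearMap.id ℝ _) :=
    (hasMFDerivAt_id (c.coordE e)).congr_of_eventuallyEq (by
      filter_upwards [c.isOpen_coordRange.mem_nhds (c.coordE_mem he)] with p hp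
      exact c.coordE_coordInv hp)
  exact ContinuousLinearMap.IsInvertible.of_inverse (hasMFDerivAt_unique h5 h6)
    (hasMFDerivAt_unique h3 h4)

theorem vf_smooth (s : Idx n m) : SmoothVF (c.vf s) (TotalSpace.proj ⁻¹' (c.U : Set M)) := by
  intro e he
  refine ContMDiffAt.contMDiffWithinAt ?_
  -- The coordinate field is the pullback of a constant vector field under the local diffeomorphism
  -- `coordE`.
  refine ContMDiffAt.mpullback_vectorField_preimage (f := c.coordE)
    (V := fun _ : Eu n × Eu m => (stdVec s : Eu n × Eu m)) ?_
    (c.coordE_smooth.contMDiffAt ((isOpen_over c.U.2).mem_nhds he))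
    (c.isInvertible_mfderiv_coordE he) (m := ∞) le_rfl
  exact (contMDiffAt_vectorSpace_iff_contDiffAt
    (V := fun x : Eu n × Eu m => (stdVec s : TangentSpace 𝓘(ℝ, Eu n × Eu m) x))).2
    contDiffAt_const

theorem mfderiv_coordE_vf (s : Idx n m) {e : TotalSpace (Eu m) V} (he : e.1 ∈ c.U) :
    mfderiv ((𝓡 n).prod 𝓘(ℝ, Eu m)) 𝓘(ℝ, Eu n × Eu m) c.coordE e (c.vf s e) = stdVec s :=
  (c.isInvertible_mfderiv_coordE he).self_apply_inverse _

/-- The coordinates of `ℝⁿ × ℝᵐ`. -/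
noncomputable def stdCo : Idx n m → (Eu n × Eu m) →L[ℝ] ℝ
  | .inl k => (EuclideanSpace.proj k : Eu n →L[ℝ] ℝ) ∘L ContinuousLinearMap.fst ℝ _ _
  | .inr α => (EuclideanSpace.proj α : Eu m →L[ℝ] ℝ) ∘L ContinuousLinearMap.snd ℝ _ _

theorem stdCo_stdVec (r s : Idx n m) :
    stdCo r (stdVec s : Eu n × Eu m) = if s = r then (1 : ℝ) else 0 := by
  rcases r with k | α <;> rcases s with i | β <;>
    simp [stdCo, stdVec, PiLp.single_apply, eq_comm]

theorem eq_sum_stdCo (v : Eu n × Eu m) : v = ∑ r, stdCo r v • stdVec r := by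
  rw [Fintype.sum_sum_type]
  refine Prod.ext ?_ ?_
  · conv_lhs => rw [← (EuclideanSpace.basisFun (Fin n) ℝ).sum_repr v.1]
    simp [stdCo, stdVec, Prod.fst_sum]
  · conv_lhs => rw [← (EuclideanSpace.basisFun (Fin m) ℝ).sum_repr v.2]
    simp [stdCo, stdVec, Prod.snd_sum]

/-- The coordinate functions on the total space. -/
noncomputable def coE (r : Idx n m) (e : TotalSpace (Eu m) V) : ℝ := stdCo r (c.coordE e)

theorem coE_smooth (r : Idx n m) : ContMDiffOn ((𝓡 n).prod 𝓘(ℝ, Eu m)) 𝓘(ℝ) ∞ (c.coE r)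
    (TotalSpace.proj ⁻¹' (c.U : Set M)) :=
  (stdCo r).contMDiff.comp_contMDiffOn c.coordE_smooth

/-- The components of tangent vectors of the total space. -/
noncomputable def comp (r : Idx n m) (e : TotalSpace (Eu m) V) :
    TangentSpace ((𝓡 n).prod 𝓘(ℝ, Eu m)) e →L[ℝ] ℝ :=
  dL ((𝓡 n).prod 𝓘(ℝ, Eu m)) (c.coE r) e

theorem dirDeriv_comp_coordE (X' : VF n m V) {h : Eu n × Eu m → ℝ} {e : TotalSpace (Eu m) V}
    (he : e.1 ∈ c.U) {h' : Eu n × Eu m →L[ℝ] ℝ} (hh : HasFDerivAt h h' (c.coordE e))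
    {g : TotalSpace (Eu m) V → ℝ} (hg : ∀ᶠ e' in 𝓝 e, g e' = h (c.coordE e')) :
    dirDeriv X' g e =
      h' (mfderiv ((𝓡 n).prod 𝓘(ℝ, Eu m)) 𝓘(ℝ, Eu n × Eu m) c.coordE e (X' e)) := by
  have h1 := hh.hasMFDerivAt.comp e (coordE_mdifferentiableAt he).hasMFDerivAt
  have h2 := h1.congr_of_eventuallyEq hg
  rw [dirDeriv, h2.mfderiv]
  rfl

theorem comp_apply (r : Idx n m) {e : TotalSpace (Eu m) V} (he : e.1 ∈ c.U)
    (ξ : TangentSpace ((𝓡 n).prod 𝓘(ℝ, Eu m)) e) : c.comp r e ξ =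
      stdCo r (mfderiv ((𝓡 n).prod 𝓘(ℝ, Eu m)) 𝓘(ℝ, Eu n × Eu m) c.coordE e ξ) := by
  have h1 := ((stdCo r).hasMFDerivAt (x := c.coordE e)).comp e
    (coordE_mdifferentiableAt he).hasMFDerivAt
  exact DFunLike.congr_fun h1.mfderiv ξ

theorem comp_vf (r s : Idx n m) {e : TotalSpace (Eu m) V} (he : e.1 ∈ c.U) :
    c.comp r e (c.vf s e) = if s = r then 1 else 0 := by
  rw [c.comp_apply r he, c.mfderiv_coordE_vf s he, stdCo_stdVec]

theorem eq_sum_comp {e : TotalSpace (Eu m) V} (he : e.1 ∈ c.U)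
    (ξ : TangentSpace ((𝓡 n).prod 𝓘(ℝ, Eu m)) e) : ξ = ∑ r, c.comp r e ξ • c.vf r e := by
  refine (c.isInvertible_mfderiv_coordE he).injective ?_
  rw [map_sum]
  simp only [map_smul, c.mfderiv_coordE_vf _ he, c.comp_apply _ he]
  exact eq_sum_stdCo _

theorem comp_sum_smul_vf (r : Idx n m) {e : TotalSpace (Eu m) V} (he : e.1 ∈ c.U)
    (a : Idx n m → ℝ) : c.comp r e (∑ s, a s • c.vf s e) = a r := by
  rw [map_sum]
  simp only [map_smul, c.comp_vf _ _ he, smul_eq_mul, mul_ite, mul_one, mul_zero,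
    Finset.sum_ite_eq', Finset.mem_univ, if_true]

end BundleCoords

theorem dirDeriv_eq (X' : VF n m V) (g : TotalSpace (Eu m) V → ℝ) (e : TotalSpace (Eu m) V) :
    dirDeriv X' g e = dL ((𝓡 n).prod 𝓘(ℝ, Eu m)) g e (X' e) := rfl

theorem dirDeriv_congr (X' : VF n m V) {g g' : TotalSpace (Eu m) V → ℝ} {e : TotalSpace (Eu m) V}
    (h : g =ᶠ[𝓝 e] g') : dirDeriv X' g e = dirDeriv X' g' e := by
  rw [dirDeriv, dirDeriv, h.mfderiv_eq]
  rfl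

/-! ### The vector fields Ψ(X) in coordinates. -/

namespace BundleCoords

variable {c : BundleCoords n m V} {U : Opens M}

/-- The degree zero part of an element of the exterior algebra. -/
noncomputable def redL (m : ℕ) : Lam m →L[ℝ] ℝ :=
  LinearMap.toContinuousLinearMap algebraMapInv.toLinearMap

/-- The degree one part of an element of the exterior algebra. -/
noncomputable def linL (m : ℕ) : Lam m →L[ℝ] Eu m →L[ℝ] ℝ :=
  LinearMap.toContinuousLinearMap
    ((LinearMap.toContinuousLinearMap (𝕜 := ℝ) (E := Eu m) (F' := ℝ)).toLinearMap ∘ₗ ιInv)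

theorem affEval_eq (v : Eu m) (a : Lam m) : affEval v a = redL m a + linL m a v :=
  affEval_apply v a

theorem psi_smooth {W : Opens M} (h : W ≤ c.U) (f : O n m V W) :
    ContMDiffOn ((𝓡 n).prod 𝓘(ℝ, Eu m)) 𝓘(ℝ) ∞ (psi f.val : TotalSpace (Eu m) V → ℝ)
      (TotalSpace.proj ⁻¹' (W : Set M)) := by
  have h1 : ContMDiffOn ((𝓡 n).prod 𝓘(ℝ, Eu m)) 𝓘(ℝ, Lam m) ∞
      (fun e : TotalSpace (Eu m) V => c.loc f e.1) (TotalSpace.proj ⁻¹' (W : Set M)) :=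
    (loc_smooth h f).comp (contMDiff_proj V).contMDiffOn fun e he => he
  have h2 : ContMDiffOn ((𝓡 n).prod 𝓘(ℝ, Eu m)) 𝓘(ℝ, Eu m) ∞
      (fun e : TotalSpace (Eu m) V => (c.triv e).2) (TotalSpace.proj ⁻¹' (W : Set M)) :=
    contMDiff_snd.comp_contMDiffOn (c.smooth.mono fun e he => c.triv.mem_source.2 (h he).2)
  refine (((redL m).contMDiff.comp_contMDiffOn h1).add
    (((linL m).contMDiff.comp_contMDiffOn h1).clm_apply h2)).congr fun e he => ?_
  rw [psi_eq h f he, affEval_eq]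
  rfl

theorem red_smooth {W : Opens M} (h : W ≤ c.U) (f : O n m V W) :
    ContMDiffOn ((𝓡 n).prod 𝓘(ℝ, Eu m)) 𝓘(ℝ) ∞ (fun e : TotalSpace (Eu m) V => f.red e.1)
      (TotalSpace.proj ⁻¹' (W : Set M)) := by
  have h1 : ContMDiffOn ((𝓡 n).prod 𝓘(ℝ, Eu m)) 𝓘(ℝ, Lam m) ∞
      (fun e : TotalSpace (Eu m) V => c.loc f e.1) (TotalSpace.proj ⁻¹' (W : Set M)) :=
    (loc_smooth h f).comp (contMDiff_proj V).contMDiffOn fun e he => he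
  refine ((redL m).contMDiff.comp_contMDiffOn h1).congr fun e he => ?_
  rw [red_eq h f he]
  rfl

/-- In coordinates ψ(f) is f₀(x) + f₁(x)(v). Along ∂_i both coefficients are differentiated, which
is what ∂̂_i does. Along ∂_α only the slope f₁(x)(e_α) remains, the degree-zero part of the
contraction ∂̂_α f. -/
theorem dirDeriv_vf_psi {W : Opens M} (h : W ≤ c.U) (f : O n m V W) (s : Idx n m)
    {e : TotalSpace (Eu m) V} (he : e.1 ∈ W) :
    dirDeriv (c.vf s) (psi f.val) e = psiDer h f s e := by
  have h0 := (c.differentiableAt_comp_chart_symm W.2 (fun _ hx => (h hx).1) (loc_smooth h f)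
    he).hasFDerivAt
  have h1 : HasFDerivAt (fun p : Eu n × Eu m => (c.loc f ∘ c.chart.symm) p.1) _ (c.coordE e) :=
    HasFDerivAt.comp (c.coordE e) (f := Prod.fst) h0 hasFDerivAt_fst
  have h2 := ((redL m).hasFDerivAt.comp (c.coordE e) h1).add
    (((linL m).hasFDerivAt.comp (c.coordE e) h1).clm_apply hasFDerivAt_snd)
  rw [c.dirDeriv_comp_coordE (c.vf s) (h he) h2, c.mfderiv_coordE_vf s (h he)]
  · rcases s with i | α
    · rw [psiDer, psi_eq h _ he, loc_coordDer_inl _ _ _ _ he, affEval_eq]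
      simp only [stdVec, pd, add_apply, ContinuousLinearMap.comp_apply,
        ContinuousLinearMap.flip_apply, ContinuousLinearMap.coe_fst', ContinuousLinearMap.coe_snd',
        map_zero, zero_add, coordE]
    · rw [psiDer, red_eq h _ he, loc_coordDer_inr _ _ _ _ he, contr, algebraMapInv_contract]
      simp only [stdVec, add_apply, ContinuousLinearMap.comp_apply,
        ContinuousLinearMap.flip_apply, ContinuousLinearMap.coe_fst', ContinuousLinearMap.coe_snd',
        map_zero, zero_add, coordE, Function.comp_apply, c.chart.left_inv (h he).1,
        zero_apply, add_zero]
      rfl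
  · filter_upwards [(isOpen_over W.2).mem_nhds he] with e' he'
    rw [psi_eq h f he', affEval_eq]
    simp only [coordE, Function.comp_apply, Pi.add_apply, c.chart.left_inv (h he').1]

theorem psi_coord {W : Opens M} (h : W ≤ c.U) (r : Idx n m) {e : TotalSpace (Eu m) V}
    (he : e.1 ∈ W) : psi (c.coord h r).val e = c.coE r e := by
  rw [psi_eq h _ he]
  rcases r with k | α
  · rw [coord_inl, loc_ofFun _ _ he, affEval_apply, algebraMapInv_algebraMap, ιInv_algebraMap,
      LinearMap.zero_apply, add_zero]
    rfl
  · rw [coord_inr, loc_eStar _ _ he, affEval_apply, eps, algebraMapInv_ι, ιInv_ι, zero_add]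
    rfl

theorem coord_memF {W : Opens M} (h : W ≤ c.U) (r : Idx n m) : (c.coord h r).MemF := by
  rw [memF_iff h]
  intro x hx
  rcases r with k | α
  · rw [coord_inl, loc_ofFun _ _ hx, prL_apply, algebraMapInv_algebraMap, ιInv_algebraMap, map_zero,
      add_zero]
  · rw [coord_inr, loc_eStar _ _ hx, prL_apply, eps, algebraMapInv_ι, ιInv_ι, map_zero, zero_add]

/-- The vector field `Ψ(X)` on the total space. -/
noncomputable def psiVF (hU : U ≤ c.U) (X : T n m V U) : VF n m V := fun e =>
  ∑ r, psi (cmp hU X r).val e • c.vf r e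

theorem smoothVF_sum_smul {Ω : Set (TotalSpace (Eu m) V)} {a : Idx n m → TotalSpace (Eu m) V → ℝ}
    (hΩ : Ω ⊆ TotalSpace.proj ⁻¹' (c.U : Set M))
    (ha : ∀ r, ContMDiffOn ((𝓡 n).prod 𝓘(ℝ, Eu m)) 𝓘(ℝ) ∞ (a r) Ω) :
    SmoothVF (fun e => ∑ r, a r e • c.vf r e) Ω :=
  ContMDiffOn.sum_section fun r _ => (ha r).smul_section ((c.vf_smooth r).mono hΩ)

theorem psiVF_smooth (hU : U ≤ c.U) (X : T n m V U) :
    SmoothVF (psiVF hU X) (TotalSpace.proj ⁻¹' (U : Set M)) :=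
  smoothVF_sum_smul (Set.preimage_mono hU) fun r => psi_smooth hU (cmp hU X r)

theorem dirDeriv_psiVF (hU : U ≤ c.U) (X : T n m V U) (g : TotalSpace (Eu m) V → ℝ)
    (e : TotalSpace (Eu m) V) : dirDeriv (psiVF hU X) g e =
      ∑ r, psi (cmp hU X r).val e * dirDeriv (c.vf r) g e := by
  rw [dirDeriv_eq, psiVF, map_sum]
  exact Finset.sum_congr rfl fun r _ => map_smul _ _ _

theorem dirDeriv_psiVF_psi (hU : U ≤ c.U) {X : T n m V U} (hX : X.IsHom 0) {W : Opens M}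
    (h : W ≤ U) (f : O n m V W) {e : TotalSpace (Eu m) V} (he : e.1 ∈ W) :
    dirDeriv (psiVF hU X) (psi f.val) e = psi (X.app h f).val e := by
  rw [dirDeriv_psiVF, psi_app hU hX h f he]
  exact Finset.sum_congr rfl fun r _ => by rw [dirDeriv_vf_psi (h.trans hU) f r he]

/-- Evenness alone suffices: the field with components ψ(X^r) intertwines with X on all
superfunctions. So Ψ also makes sense for ∇_X Y, which need not preserve F. -/
theorem isPsi_psiVF (hU : U ≤ c.U) {X : T n m V U} (hX : X.IsHom 0) : IsPsi X (psiVF hU X) :=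
  ⟨psiVF_smooth hU X, fun _ h f _ _ he => dirDeriv_psiVF_psi hU hX h f he⟩

theorem dirDeriv_psi_coord (hU : U ≤ c.U) (X' : VF n m V) (r : Idx n m) {e : TotalSpace (Eu m) V}
    (he : e.1 ∈ U) : dirDeriv X' (psi (c.coord hU r).val) e = c.comp r e (X' e) := by
  refine dirDeriv_congr X' ?_
  filter_upwards [(isOpen_over U.2).mem_nhds he] with e' he'
  exact psi_coord hU r he'

theorem _root_.SuperRed.IsPsi.res {X : T n m V U} {X' : VF n m V} (hX : IsPsi X X') {W : Opens M}
    (h : W ≤ U) : IsPsi (T.res h X) X' :=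
  ⟨hX.1.mono (Set.preimage_mono h), fun W' h' f hf e he => hX.2 W' (h'.trans h) f hf e he⟩

/-- The coordinates of E are the images under `psi` of the supercoordinates, which lie in F. The
defining property therefore fixes every component of the field. -/
theorem _root_.SuperRed.IsPsi.eq_psiVF (hU : U ≤ c.U) {X : T n m V U} {X' : VF n m V}
    (hX : IsPsi X X') {e : TotalSpace (Eu m) V} (he : e.1 ∈ U) : X' e = psiVF hU X e := by
  rw [c.eq_sum_comp (hU he) (X' e), psiVF]
  refine Finset.sum_congr rfl fun r _ => ?_
  rw [← dirDeriv_psi_coord hU X' r he, hX.2 U le_rfl _ (coord_memF hU r) e he]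
  rfl

theorem comp_psiVF (hU : U ≤ c.U) (X : T n m V U) (r : Idx n m) {e : TotalSpace (Eu m) V}
    (he : e.1 ∈ U) : c.comp r e (psiVF hU X e) = psi (cmp hU X r).val e :=
  c.comp_sum_smul_vf r (hU he) _

end BundleCoords

/-! ### The connection on E over a coordinate domain. -/

section DifferentialRules

variable {E : Type*} [NormedAddCommGroup E] [NormedSpace ℝ E] {H : Type*} [TopologicalSpace H]
  {I : ModelWithCorners ℝ E H} {N : Type*} [TopologicalSpace N] [ChartedSpace H N]

theorem dL_congr {g g' : N → ℝ} {e : N} (h : g =ᶠ[𝓝 e] g') : dL I g e = dL I g' e := by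
  refine ContinuousLinearMap.ext fun ξ => ?_
  rw [dL, h.mfderiv_eq]
  rfl

theorem dL_add {g g' : N → ℝ} {e : N} (hg : MDifferentiableAt I 𝓘(ℝ) g e)
    (hg' : MDifferentiableAt I 𝓘(ℝ) g' e) :
    dL I (fun e => g e + g' e) e = dL I g e + dL I g' e :=
  (hg.hasMFDerivAt.add hg'.hasMFDerivAt).mfderiv

theorem dL_mul {g g' : N → ℝ} {e : N} (hg : MDifferentiableAt I 𝓘(ℝ) g e)
    (hg' : MDifferentiableAt I 𝓘(ℝ) g' e) :
    dL I (fun e => g e * g' e) e = g e • dL I g' e + g' e • dL I g e :=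
  (hg.hasMFDerivAt.mul hg'.hasMFDerivAt).mfderiv

theorem dL_const (a : ℝ) (e : N) : dL I (fun _ => a) e = 0 := mfderiv_const

end DifferentialRules

variable (n m V) in
/-- Operators from vector fields on the total space to endomorphism fields. -/
abbrev ConnOp := VF n m V → Π e : TotalSpace (Eu m) V,
  TangentSpace ((𝓡 n).prod 𝓘(ℝ, Eu m)) e →L[ℝ] TangentSpace ((𝓡 n).prod 𝓘(ℝ, Eu m)) e

/-- The operator `cov` is a reduction of `∇` over the open subset `W` of the base. -/
structure IsLocalReduction (nab : SuperConnection n m V) (cov : ConnOp n m V) (W : Opens M) :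
    Prop where
  conn : IsCovariantDerivativeOn (Eu n × Eu m) cov (TotalSpace.proj ⁻¹' (W : Set M))
  smooth : ∀ Ω : Set (TotalSpace (Eu m) V), IsOpen Ω → Ω ⊆ TotalSpace.proj ⁻¹' (W : Set M) →
    ContMDiffCovariantDerivativeOn (Eu n × Eu m) ∞ cov Ω
  compat : ∀ (U : Opens M), U ≤ W → ∀ (X Y : T n m V U) (X' Y' : VF n m V), X.MemL0 → Y.MemL0 →
    IsPsi X X' → IsPsi Y Y' →
    ∀ (W' : Opens M) (h : W' ≤ U) (f : O n m V W'), f.MemF → ∀ e : TotalSpace (Eu m) V,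
      e.1 ∈ W' → dirDeriv (fun e' => cov Y' e' (X' e')) (psi f.val) e =
        psi (fun x => pr (x : M) (((nab.cov U X Y).app h f).val x)) e

theorem IsReduction.isLocalReduction {nab : SuperConnection n m V} {D : ConnE n m V}
    (hD : IsReduction nab D) (W : Opens M) : IsLocalReduction nab D.toFun W where
  conn := D.isCovariantDerivativeOn
  smooth Ω hΩ _ := hD.smooth Ω hΩ
  compat U _ := hD.compat U

namespace BundleCoords

variable {c : BundleCoords n m V} {U : Opens M}

theorem ext_comp {e : TotalSpace (Eu m) V} (he : e.1 ∈ c.U)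
    {ξ η : TangentSpace ((𝓡 n).prod 𝓘(ℝ, Eu m)) e} (h : ∀ r, c.comp r e ξ = c.comp r e η) :
    ξ = η := by
  rw [c.eq_sum_comp he ξ, c.eq_sum_comp he η]
  exact Finset.sum_congr rfl fun r _ => by rw [h r]

theorem redChristoffel_smooth (nab : SuperConnection n m V) (s u r : Idx n m) :
    ContMDiffOn ((𝓡 n).prod 𝓘(ℝ, Eu m)) 𝓘(ℝ) ∞ (c.redChristoffel nab s u r)
      (TotalSpace.proj ⁻¹' (c.U : Set M)) := by
  rcases s with i | α <;> rcases u with j | β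
  · exact psi_smooth le_rfl _
  · exact red_smooth le_rfl _
  · exact red_smooth le_rfl _
  · exact contMDiffOn_const

/-- The connection over the coordinate domain with Christoffel symbols `redChristoffel`. -/
noncomputable def localConn (c : BundleCoords n m V) (nab : SuperConnection n m V) :
    ConnOp n m V := fun Y e =>
  ∑ r, (dL ((𝓡 n).prod 𝓘(ℝ, Eu m)) (fun e' => c.comp r e' (Y e')) e +
    ∑ u, ∑ s, (c.comp u e (Y e) * c.redChristoffel nab s u r e) • c.comp s e).smulRight (c.vf r e)

theorem comp_localConn (nab : SuperConnection n m V) (Y : VF n m V) (r : Idx n m)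
    {e : TotalSpace (Eu m) V} (he : e.1 ∈ c.U) (ξ : TangentSpace ((𝓡 n).prod 𝓘(ℝ, Eu m)) e) :
    c.comp r e (c.localConn nab Y e ξ) =
      dL ((𝓡 n).prod 𝓘(ℝ, Eu m)) (fun e' => c.comp r e' (Y e')) e ξ +
        ∑ u, ∑ s, c.comp u e (Y e) * c.redChristoffel nab s u r e * c.comp s e ξ := by
  have h1 : c.localConn nab Y e ξ = ∑ r,
      (dL ((𝓡 n).prod 𝓘(ℝ, Eu m)) (fun e' => c.comp r e' (Y e')) e ξ +
        ∑ u, ∑ s, c.comp u e (Y e) * c.redChristoffel nab s u r e * c.comp s e ξ) • c.vf r e := by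
    simp only [localConn, sum_apply, ContinuousLinearMap.smulRight_apply,
      add_apply, smul_apply, smul_eq_mul]
  rw [h1, c.comp_sum_smul_vf r he]

theorem comp_mdifferentiableAt {Y : VF n m V} {e : TotalSpace (Eu m) V} (he : e.1 ∈ c.U)
    (hY : MDifferentiableAt ((𝓡 n).prod 𝓘(ℝ, Eu m))
      (((𝓡 n).prod 𝓘(ℝ, Eu m)).prod 𝓘(ℝ, Eu n × Eu m))
      (fun e => (⟨e, Y e⟩ : TotalSpace (Eu n × Eu m)
        (TangentSpace ((𝓡 n).prod 𝓘(ℝ, Eu m)) : TotalSpace (Eu m) V → Type _))) e) (r : Idx n m) :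
    MDifferentiableAt ((𝓡 n).prod 𝓘(ℝ, Eu m)) 𝓘(ℝ) (fun e' => c.comp r e' (Y e')) e :=
  mdifferentiableAt_mfderiv_apply ((c.coE_smooth r).contMDiffAt ((isOpen_over c.U.2).mem_nhds he))
    hY

theorem comp_smooth {Y : VF n m V} {Ω : Set (TotalSpace (Eu m) V)} (hΩ : IsOpen Ω)
    (hΩU : Ω ⊆ TotalSpace.proj ⁻¹' (c.U : Set M)) (hY : SmoothVF Y Ω) (r : Idx n m) :
    ContMDiffOn ((𝓡 n).prod 𝓘(ℝ, Eu m)) 𝓘(ℝ) ∞ (fun e' => c.comp r e' (Y e')) Ω := fun _ he =>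
  (contMDiffAt_mfderiv_apply ((c.coE_smooth r).contMDiffAt
    ((isOpen_over c.U.2).mem_nhds (hΩU he))) (hY.contMDiffAt (hΩ.mem_nhds he))).contMDiffWithinAt

/-- Compared component by component: the Christoffel term is linear over functions, and the
differential of the component supplies the Leibniz term. -/
theorem localConn_isCovariantDerivativeOn (c : BundleCoords n m V) (nab : SuperConnection n m V) :
    IsCovariantDerivativeOn (Eu n × Eu m) (c.localConn nab)
      (TotalSpace.proj ⁻¹' (c.U : Set M)) where
  add {Y Z e} hY hZ he := by
    refine ContinuousLinearMap.ext fun ξ => ext_comp (c := c) he fun r => ?_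
    have h1 : dL ((𝓡 n).prod 𝓘(ℝ, Eu m)) (fun e' => c.comp r e' ((Y + Z) e')) e = _ :=
      (congrArg (fun g => dL ((𝓡 n).prod 𝓘(ℝ, Eu m)) g e)
        (funext fun e' => map_add (c.comp r e') (Y e') (Z e'))).trans
        (dL_add (comp_mdifferentiableAt he hY r) (comp_mdifferentiableAt he hZ r))
    rw [add_apply, map_add, comp_localConn _ _ _ he, comp_localConn _ _ _ he,
      comp_localConn _ _ _ he, h1, add_apply, Pi.add_apply]
    simp only [map_add, add_mul, Finset.sum_add_distrib]
    ring
  leibniz {Y g e} hY hg he := by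
    refine ContinuousLinearMap.ext fun ξ => ext_comp (c := c) he fun r => ?_
    have h1 : dL ((𝓡 n).prod 𝓘(ℝ, Eu m)) (fun e' => c.comp r e' ((g • Y) e')) e = _ :=
      (congrArg (fun g => dL ((𝓡 n).prod 𝓘(ℝ, Eu m)) g e)
        (funext fun e' => map_smul (c.comp r e') (g e') (Y e'))).trans
        (dL_mul hg (comp_mdifferentiableAt he hY r))
    have h2 : c.comp r e ((g e • c.localConn nab Y e +
        (mvfderiv ((𝓡 n).prod 𝓘(ℝ, Eu m)) g e).smulRight (Y e)) ξ) =
        g e * c.comp r e (c.localConn nab Y e ξ) +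
          dL ((𝓡 n).prod 𝓘(ℝ, Eu m)) g e ξ * c.comp r e (Y e) := by
      rw [add_apply, map_add, smul_apply, map_smul, ContinuousLinearMap.smulRight_apply, map_smul]
      rfl
    rw [h2, comp_localConn _ _ _ he, comp_localConn _ _ _ he, h1]
    simp only [add_apply, smul_apply, smul_eq_mul, Pi.smul_apply', map_smul, mul_add,
      Finset.mul_sum, mul_assoc]
    ring

theorem localConn_smooth (c : BundleCoords n m V) (nab : SuperConnection n m V)
    {Ω : Set (TotalSpace (Eu m) V)} (hΩ : IsOpen Ω)
    (hΩU : Ω ⊆ TotalSpace.proj ⁻¹' (c.U : Set M)) :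
    ContMDiffCovariantDerivativeOn (Eu n × Eu m) ∞ (c.localConn nab) Ω where
  contMDiff {Y} hY := by
    have hY' : SmoothVF Y Ω := hY
    have h1 : ∀ r (g : TotalSpace (Eu m) V → ℝ),
        ContMDiffOn ((𝓡 n).prod 𝓘(ℝ, Eu m)) 𝓘(ℝ) ∞ g Ω →
        ContMDiffOn ((𝓡 n).prod 𝓘(ℝ, Eu m))
          (((𝓡 n).prod 𝓘(ℝ, Eu m)).prod 𝓘(ℝ, (Eu n × Eu m) →L[ℝ] (Eu n × Eu m))) ∞
          (fun e => (⟨e, (dL ((𝓡 n).prod 𝓘(ℝ, Eu m)) g e).smulRight (c.vf r e)⟩ :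
            TotalSpace ((Eu n × Eu m) →L[ℝ] (Eu n × Eu m)) fun e : TotalSpace (Eu m) V =>
              TangentSpace ((𝓡 n).prod 𝓘(ℝ, Eu m)) e →L[ℝ]
                TangentSpace ((𝓡 n).prod 𝓘(ℝ, Eu m)) e)) Ω := fun r g hg e he =>
      (contMDiffAt_mfderiv_smulRight (hg.contMDiffAt (hΩ.mem_nhds he))
        ((c.vf_smooth r).contMDiffAt ((isOpen_over c.U.2).mem_nhds (hΩU he)))).contMDiffWithinAt
    -- Regrouped as a sum of smooth functions times dg ⊗ ∂_r, for which smoothness as a section of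
    -- the endomorphism bundle is known.
    have h2 : ∀ e, c.localConn nab Y e = ∑ r,
        ((dL ((𝓡 n).prod 𝓘(ℝ, Eu m)) (fun e' => c.comp r e' (Y e')) e).smulRight (c.vf r e) +
          ∑ u, ∑ s, (c.comp u e (Y e) * c.redChristoffel nab s u r e) •
            (dL ((𝓡 n).prod 𝓘(ℝ, Eu m)) (c.coE s) e).smulRight (c.vf r e)) := fun e => by
      refine ContinuousLinearMap.ext fun ξ => ?_
      simp only [localConn, sum_apply, ContinuousLinearMap.smulRight_apply,
        add_apply, smul_apply, add_smul, Finset.sum_smul, smul_assoc]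
      rfl
    have h3 := fun r => h1 r _ (comp_smooth hΩ hΩU hY' r)
    simp only [h2]
    refine ContMDiffOn.sum_section fun r _ => (h3 r).add_section
      (ContMDiffOn.sum_section fun u _ => ContMDiffOn.sum_section fun s _ =>
        ContMDiffOn.smul_section ?_ (h1 r _ ((c.coE_smooth s).mono hΩU)))
    exact (comp_smooth hΩ hΩU hY' u).mul ((redChristoffel_smooth nab s u r).mono hΩU)

/-- The existence half in coordinates: D_{Ψ(X)} Ψ(Y) is the field with components ψ((∇_X Y)^r). The
term d(Y^r) matches ψ(X(Y^r)) and the Christoffel terms match by `psi_cmp_cov`. -/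
theorem localConn_psiVF (hU : U ≤ c.U) (nab : SuperConnection n m V) {X Y : T n m V U}
    (hX : X.IsHom 0) (hY : Y.IsHom 0) {X' Y' : VF n m V} (hX' : IsPsi X X') (hY' : IsPsi Y Y')
    {e : TotalSpace (Eu m) V} (he : e.1 ∈ U) :
    c.localConn nab Y' e (X' e) = psiVF hU (nab.cov U X Y) e := by
  refine ext_comp (hU he) fun r => ?_
  have h1 : (fun e' => c.comp r e' (Y' e')) =ᶠ[𝓝 e] psi (cmp hU Y r).val := by
    filter_upwards [(isOpen_over U.2).mem_nhds he] with e' he'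
    rw [hY'.eq_psiVF hU he', comp_psiVF hU Y r he']
  rw [comp_localConn _ _ _ (hU he), dL_congr h1, comp_psiVF hU _ r he, psi_cmp_cov hU nab hX hY r he,
    hX'.eq_psiVF hU he, hY'.eq_psiVF hU he, ← dirDeriv_eq, dirDeriv_psiVF_psi hU hX le_rfl _ he]
  congr 1
  refine Finset.sum_congr rfl fun u _ => Finset.sum_congr rfl fun s _ => ?_
  rw [comp_psiVF hU Y u he, comp_psiVF hU X s he]
  ring

theorem isLocalReduction_localConn (c : BundleCoords n m V) (nab : SuperConnection n m V) :
    IsLocalReduction nab (c.localConn nab) c.U where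
  conn := c.localConn_isCovariantDerivativeOn nab
  smooth Ω hΩ hΩU := c.localConn_smooth nab hΩ hΩU
  compat U hU X Y X' Y' hX hY hX' hY' W h f _ e he := by
    rw [psi_pr, ← dirDeriv_psiVF_psi hU (nab.even U 0 0 X Y hX.1 hY.1) h f he, dirDeriv_eq,
      dirDeriv_eq, localConn_psiVF hU nab hX.1 hY.1 hX' hY' (h he)]

theorem localConn_vf (c : BundleCoords n m V) (nab : SuperConnection n m V) (s u : Idx n m)
    {e : TotalSpace (Eu m) V} (he : e.1 ∈ c.U) :
    c.localConn nab (c.vf u) e (c.vf s e) = ∑ r, c.redChristoffel nab s u r e • c.vf r e := by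
  refine ext_comp he fun r => ?_
  have h1 : (fun e' => c.comp r e' (c.vf u e')) =ᶠ[𝓝 e] fun _ => if u = r then 1 else 0 := by
    filter_upwards [(isOpen_over c.U.2).mem_nhds he] with e' he'
    exact c.comp_vf r u he'
  rw [comp_localConn _ _ _ he, dL_congr h1, dL_const, c.comp_sum_smul_vf r he]
  simp [c.comp_vf _ _ he]

end BundleCoords

/-! ### Uniqueness of local reductions. -/

namespace BundleCoords

variable {c : BundleCoords n m V} {U : Opens M}

theorem psiVF_evenFrame {W : Opens M} (h : W ≤ c.U) (s : Idx n m) :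
    psiVF h (T.res h (c.evenFrame s)) =
      (psi (O.res h (c.frameCoeff s)).val : TotalSpace (Eu m) V → ℝ) • c.vf s := by
  funext e
  rw [psiVF, Finset.sum_eq_single s]
  · rw [cmp_evenFrame, if_pos rfl]
    rfl
  · intro r _ hr
    rw [cmp_evenFrame, if_neg hr.symm, psi_zero, zero_smul]
  · exact fun hs => absurd (Finset.mem_univ s) hs

/-- The Christoffel symbols of a local reduction are determined up to the coefficients of the even
frame. -/
theorem _root_.SuperRed.IsLocalReduction.frameCoeff_mul {nab : SuperConnection n m V}
    {cov : ConnOp n m V} {W : Opens M} (hc : IsLocalReduction nab cov W) (s u r : Idx n m)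
    {e : TotalSpace (Eu m) V} (heW : e.1 ∈ W) (he : e.1 ∈ c.U) :
    psi (c.frameCoeff u).val e * psi (c.frameCoeff s).val e *
      (c.comp r e (cov (c.vf u) e (c.vf s e)) - c.redChristoffel nab s u r e) = 0 := by
  have hU : W ⊓ c.U ≤ c.U := inf_le_right
  have heU : e.1 ∈ W ⊓ c.U := ⟨heW, he⟩
  have hX := (c.evenFrame_memL0 s).res hU
  have hY := (c.evenFrame_memL0 u).res hU
  -- Testing the compatibility condition on two members of the even frame, with `f` the r-th
  -- coordinate, isolates the r-th component.
  have h1 := hc.compat (W ⊓ c.U) inf_le_left _ _ _ _ hX hY (isPsi_psiVF hU hX.1)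
    (isPsi_psiVF hU hY.1) _ le_rfl _ (coord_memF hU r) e heU
  rw [psi_pr, dirDeriv_psi_coord hU _ r heU] at h1
  have h2 := psi_cmp_cov hU nab hX.1 hY.1 r heU
  have h3 := h1.trans h2
  rw [← dirDeriv_psiVF_psi hU hX.1 le_rfl _ heU] at h3
  have hcmp : ∀ (t r : Idx n m) (e' : TotalSpace (Eu m) V),
      psi (cmp hU (T.res hU (c.evenFrame t)) r).val e' =
        if t = r then psi (O.res hU (c.frameCoeff t)).val e' else 0 := fun t r e' => by
    rw [cmp_evenFrame]
    split_ifs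
    · rfl
    · exact psi_zero
  -- Ψ of an even frame field is a function times a coordinate field. The derivative of that
  -- function produced by the Leibniz rule cancels against the term ψ(X(Y^r)) on the super side.
  have h4 := hc.conn.leibniz (σ := c.vf u) (g := psi (O.res hU (c.frameCoeff u)).val) (x := e)
    (((c.vf_smooth u).contMDiffAt ((isOpen_over c.U.2).mem_nhds he)).mdifferentiableAt (by simp))
    (((psi_smooth hU (O.res hU (c.frameCoeff u))).contMDiffAt
      ((isOpen_over (W ⊓ c.U).2).mem_nhds heU)).mdifferentiableAt (by simp)) heW
  rw [← psiVF_evenFrame hU u] at h4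
  have h5 : dirDeriv (psiVF hU (T.res hU (c.evenFrame s)))
      (psi (cmp hU (T.res hU (c.evenFrame u)) r).val) e = if u = r then
        dirDeriv (psiVF hU (T.res hU (c.evenFrame s))) (psi (O.res hU (c.frameCoeff u)).val) e
      else 0 := by
    rw [cmp_evenFrame]
    split_ifs
    · rfl
    · rw [dirDeriv_congr _ (g' := fun _ => 0) (Filter.Eventually.of_forall fun _ => psi_zero),
        dirDeriv_eq, dL_const, zero_apply]
  have h6 : c.comp r e ((psi (O.res hU (c.frameCoeff u)).val e • cov (c.vf u) e +
      (mvfderiv ((𝓡 n).prod 𝓘(ℝ, Eu m)) (psi (O.res hU (c.frameCoeff u)).val) e).smulRight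
        (c.vf u e)) (psiVF hU (T.res hU (c.evenFrame s)) e)) =
      psi (O.res hU (c.frameCoeff u)).val e *
        c.comp r e (cov (c.vf u) e (psiVF hU (T.res hU (c.evenFrame s)) e)) +
      dirDeriv (psiVF hU (T.res hU (c.evenFrame s))) (psi (O.res hU (c.frameCoeff u)).val) e *
        c.comp r e (c.vf u e) := by
    rw [add_apply, map_add, smul_apply, map_smul, ContinuousLinearMap.smulRight_apply, map_smul]
    rfl
  rw [h5, h4, h6, c.comp_vf r u he, psiVF_evenFrame hU s, Pi.smul_apply', map_smul, map_smul] at h3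
  simp only [hcmp, ite_mul, mul_ite, zero_mul, mul_zero, Finset.sum_ite_eq, Finset.mem_univ,
    if_true, mul_one, psi_res hU _ heU, smul_eq_mul] at h3
  linear_combination h3

/-- Here smoothness of the reduction enters: where a coefficient of the even frame vanishes,
`frameCoeff_mul` gives no information, and the value must come from a limit. -/
theorem continuousAt_comp_cov {nab : SuperConnection n m V} {cov : ConnOp n m V} {W : Opens M}
    (hc : IsLocalReduction nab cov W) (s u r : Idx n m) {e : TotalSpace (Eu m) V} (heW : e.1 ∈ W)
    (he : e.1 ∈ c.U) : ContinuousAt (fun e => c.comp r e (cov (c.vf u) e (c.vf s e))) e := by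
  have hΩ := isOpen_over (m := m) (V := V) (W ⊓ c.U).2
  have h1 := (hc.smooth _ hΩ (Set.preimage_mono inf_le_left)).contMDiff
    (σ := c.vf u) ((c.vf_smooth u).mono (Set.preimage_mono inf_le_right))
  have h2 := (h1.contMDiffAt (hΩ.mem_nhds ⟨heW, he⟩)).clm_bundle_apply
    ((c.vf_smooth s).contMDiffAt ((isOpen_over c.U.2).mem_nhds he))
  exact (contMDiffAt_mfderiv_apply ((c.coE_smooth r).contMDiffAt
    ((isOpen_over c.U.2).mem_nhds he)) h2).continuousAt

/-- The curve in the fibre through `e` in the direction `(1, …, 1)`. -/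
noncomputable def fibCurve (c : BundleCoords n m V) (e : TotalSpace (Eu m) V) (t : ℝ) :
    TotalSpace (Eu m) V :=
  c.coordInv (c.coordE e + t • (0, WithLp.toLp 2 fun _ => 1))

theorem coordE_fibCurve_mem {e : TotalSpace (Eu m) V} (he : e.1 ∈ c.U) (t : ℝ) :
    c.coordE e + t • (0, WithLp.toLp 2 fun _ => 1) ∈ c.coordRange := by
  have := c.coordE_mem he
  rw [coordRange, Set.mem_preimage] at this ⊢
  simpa using this

theorem fibCurve_proj {e : TotalSpace (Eu m) V} (he : e.1 ∈ c.U) (t : ℝ) :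
    (c.fibCurve e t).1 = e.1 := by
  rw [fibCurve, c.coordInv_proj (coordE_fibCurve_mem he t)]
  simpa [coordE] using c.chart.left_inv he.1

theorem fibCurve_zero {e : TotalSpace (Eu m) V} (he : e.1 ∈ c.U) : c.fibCurve e 0 = e := by
  rw [fibCurve, zero_smul, add_zero, c.coordInv_coordE he]

theorem coE_fibCurve {e : TotalSpace (Eu m) V} (he : e.1 ∈ c.U) (α : Fin m) (t : ℝ) :
    c.coE (.inr α) (c.fibCurve e t) = c.coE (.inr α) e + t := by
  rw [coE, fibCurve, c.coordE_coordInv (coordE_fibCurve_mem he t), map_add]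
  simp [coE, stdCo]

theorem continuousAt_fibCurve {e : TotalSpace (Eu m) V} (he : e.1 ∈ c.U) :
    ContinuousAt (c.fibCurve e) 0 := by
  have h1 : ContinuousAt (fun t : ℝ => c.coordE e +
    t • ((0, WithLp.toLp 2 fun _ => 1) : Eu n × Eu m)) 0 := by fun_prop
  refine ContinuousAt.comp (g := c.coordInv) (c.coordInv_smooth.continuousOn.continuousAt
    (c.isOpen_coordRange.mem_nhds (coordE_fibCurve_mem he 0))) h1

/-- Moving in direction (1, …, 1) adds t to all fibre coordinates at once. Each of them vanishes for
a single value of t only, so it is nonzero for all small t ≠ 0. -/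
theorem eventually_frameCoeff_ne_zero {e : TotalSpace (Eu m) V} (he : e.1 ∈ c.U) (s : Idx n m) :
    ∀ᶠ t in 𝓝[≠] (0 : ℝ), psi (c.frameCoeff s).val (c.fibCurve e t) ≠ 0 := by
  have hU : ∀ t, (c.fibCurve e t).1 ∈ c.U := fun t => by rwa [fibCurve_proj he t]
  rcases s with i | α
  · refine Filter.Eventually.of_forall fun t => ?_
    rw [frameCoeff, psi_one (hU t)]
    exact one_ne_zero
  · have h1 : ∀ᶠ t in 𝓝[≠] (0 : ℝ), t ≠ -c.coE (.inr α) e := by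
      by_cases h0 : -c.coE (.inr α) e = 0
      · rw [h0]
        exact self_mem_nhdsWithin
      · exact (eventually_ne_nhds (Ne.symm h0)).filter_mono nhdsWithin_le_nhds
    filter_upwards [h1] with t ht
    rw [frameCoeff, psi_coord le_rfl _ (hU t), coE_fibCurve he]
    exact fun h => ht (eq_neg_of_add_eq_zero_right h)

/-- The Christoffel symbols of a local reduction. -/
theorem _root_.SuperRed.IsLocalReduction.comp_cov {nab : SuperConnection n m V}
    {cov : ConnOp n m V} {W : Opens M} (hc : IsLocalReduction nab cov W) (s u r : Idx n m)
    {e : TotalSpace (Eu m) V} (heW : e.1 ∈ W) (he : e.1 ∈ c.U) :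
    c.comp r e (cov (c.vf u) e (c.vf s e)) = c.redChristoffel nab s u r e := by
  have h0 : ContinuousAt (fun e => c.comp r e (cov (c.vf u) e (c.vf s e)) -
      c.redChristoffel nab s u r e) (c.fibCurve e 0) := by
    rw [fibCurve_zero he]
    exact (continuousAt_comp_cov hc s u r heW he).sub
      ((redChristoffel_smooth nab s u r).continuousOn.continuousAt
        ((isOpen_over c.U.2).mem_nhds he))
  -- The difference of the symbols is continuous along the curve and vanishes for small t ≠ 0, where
  -- both coefficients can be cancelled. Hence it also vanishes at t = 0.
  have h1 := (h0.comp (continuousAt_fibCurve he)).tendsto.mono_left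
    (nhdsWithin_le_nhds (s := {0}ᶜ))
  have h2 : Filter.Tendsto ((fun e => c.comp r e (cov (c.vf u) e (c.vf s e)) -
      c.redChristoffel nab s u r e) ∘ c.fibCurve e) (𝓝[≠] 0) (𝓝 0) := by
    refine tendsto_const_nhds.congr' ?_
    filter_upwards [eventually_frameCoeff_ne_zero he s, eventually_frameCoeff_ne_zero he u]
      with t hs hu
    have := hc.frameCoeff_mul (c := c) s u r (e := c.fibCurve e t)
      (by rwa [fibCurve_proj he t]) (by rwa [fibCurve_proj he t])
    exact ((mul_eq_zero.1 this).resolve_left (mul_ne_zero hu hs)).symm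
  have h3 := tendsto_nhds_unique h1 h2
  rw [Function.comp_apply, fibCurve_zero he] at h3
  exact sub_eq_zero.1 h3

theorem _root_.SuperRed.IsLocalReduction.cov_vf {nab : SuperConnection n m V}
    {cov : ConnOp n m V} {W : Opens M} (hc : IsLocalReduction nab cov W) (s u : Idx n m)
    {e : TotalSpace (Eu m) V} (heW : e.1 ∈ W) (he : e.1 ∈ c.U) :
    cov (c.vf u) e (c.vf s e) = ∑ r, c.redChristoffel nab s u r e • c.vf r e := by
  refine ext_comp he fun r => ?_
  rw [hc.comp_cov s u r heW he, c.comp_sum_smul_vf r he]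

/-- A local reduction is given by the coordinate formula. -/
theorem _root_.SuperRed.IsLocalReduction.eq_localConn {nab : SuperConnection n m V}
    {cov : ConnOp n m V} {W : Opens M} (hc : IsLocalReduction nab cov W) {Y : VF n m V}
    {e : TotalSpace (Eu m) V} (heW : e.1 ∈ W) (he : e.1 ∈ c.U)
    (hY : MDifferentiableAt ((𝓡 n).prod 𝓘(ℝ, Eu m))
      (((𝓡 n).prod 𝓘(ℝ, Eu m)).prod 𝓘(ℝ, Eu n × Eu m))
      (fun e => (⟨e, Y e⟩ : TotalSpace (Eu n × Eu m)
        (TangentSpace ((𝓡 n).prod 𝓘(ℝ, Eu m)) : TotalSpace (Eu m) V → Type _))) e) :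
    cov Y e = c.localConn nab Y e := by
  have h1 := hc.conn.mono (s := TotalSpace.proj ⁻¹' ((W ⊓ c.U : Opens M) : Set M))
    (Set.preimage_mono inf_le_left)
  have h2 := (c.localConn_isCovariantDerivativeOn nab).mono
    (s := TotalSpace.proj ⁻¹' ((W ⊓ c.U : Opens M) : Set M)) (Set.preimage_mono inf_le_right)
  have hx : e ∈ TotalSpace.proj ⁻¹' ((W ⊓ c.U : Opens M) : Set M) := ⟨heW, he⟩
  -- The difference of two connections is a tensor, so it is enough that it vanishes on the
  -- coordinate frame, where both connections have the same symbols.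
  have h3 : ∀ u, h1.difference h2 e (c.vf u e) = 0 := fun u => by
    rw [h1.difference_apply h2 hx (((c.vf_smooth u).contMDiffAt
      ((isOpen_over c.U.2).mem_nhds he)).mdifferentiableAt (by simp))]
    refine ContinuousLinearMap.ext fun ξ => ?_
    rw [c.eq_sum_comp he ξ, map_sum, zero_apply]
    refine Finset.sum_eq_zero fun s _ => ?_
    rw [map_smul, sub_apply, hc.cov_vf s u heW he, c.localConn_vf nab s u he, sub_self, smul_zero]
  have h4 := h1.difference_apply h2 hx hY
  rw [c.eq_sum_comp he (Y e), map_sum] at h4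
  simp only [map_smul, h3, smul_zero, Finset.sum_const_zero] at h4
  exact sub_eq_zero.1 h4.symm

end BundleCoords

/-! ### Gluing to a global reduction, and comparison of Christoffel symbols. -/

namespace BundleCoords

variable {c : BundleCoords n m V} {U : Opens M}

variable (n m V) in
/-- The preferred bundle coordinates near a point. -/
noncomputable def std (x : M) : BundleCoords n m V where
  chart := chartAt (Eu n) x
  chart_mem := IsManifold.chart_mem_maximalAtlas x
  triv := trivializationAt (Eu m) V x
  linear := inferInstance
  smooth := Trivialization.contMDiffOn _
  smooth_symm := Trivialization.contMDiffOn_symm _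

theorem mem_std_U (x : M) : x ∈ (std n m V x).U :=
  ⟨mem_chart_source (Eu n) x, FiberBundle.mem_baseSet_trivializationAt' x⟩

/-- The reduction of a superconnection. -/
noncomputable def redConn (nab : SuperConnection n m V) : ConnE n m V where
  -- The coordinates vary with the point. The axioms of a covariant derivative are conditions at a
  -- single point, so they hold without comparing different coordinates.
  toFun Y e := (std n m V e.1).localConn nab Y e
  isCovariantDerivativeOnUniv :=
    { add := fun {_ _ e} hY hZ _ =>
        ((std n m V e.1).localConn_isCovariantDerivativeOn nab).add hY hZ (mem_std_U e.1)
      leibniz := fun {_ _ e} hY hg _ =>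
        ((std n m V e.1).localConn_isCovariantDerivativeOn nab).leibniz hY hg (mem_std_U e.1) }

theorem redConn_apply (nab : SuperConnection n m V) (Y : VF n m V) (e : TotalSpace (Eu m) V) :
    redConn nab Y e = (std n m V e.1).localConn nab Y e := rfl

/-- Here independence of coordinates is essential: by uniqueness, near `e` the connection coincides
on smooth fields with the local connection of the fixed coordinates chosen at `e`. -/
theorem redConn_smooth (nab : SuperConnection n m V) {Ω : Set (TotalSpace (Eu m) V)}
    (hΩ : IsOpen Ω) :
    ContMDiffCovariantDerivativeOn (Eu n × Eu m) ∞ (redConn nab).toFun Ω where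
  contMDiff {Y} hY e he := by
    have hY' : SmoothVF Y Ω := hY
    have hU : IsOpen (TotalSpace.proj ⁻¹' ((std n m V e.1).U : Set M) :
        Set (TotalSpace (Eu m) V)) := isOpen_over (std n m V e.1).U.2
    have h1 := ((std n m V e.1).localConn_smooth nab (hΩ.inter hU)
      Set.inter_subset_right).contMDiff (σ := Y) (hY.mono Set.inter_subset_left)
    have hmem := (hΩ.inter hU).mem_nhds ⟨he, mem_std_U e.1⟩
    refine ((h1.contMDiffAt hmem).congr_of_eventuallyEq ?_).contMDiffWithinAt
    filter_upwards [hmem] with e' he'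
    congr 1
    exact ((std n m V e'.1).isLocalReduction_localConn nab).eq_localConn (mem_std_U e'.1) he'.2
      ((hY'.contMDiffAt (hΩ.mem_nhds he'.1)).mdifferentiableAt (by simp))

/-- Compatibility at `e` involves the covariant derivative only at `e`, where it is the local
connection of the coordinates chosen there. Restricting all data to that coordinate domain is
enough. -/
theorem isReduction_redConn (nab : SuperConnection n m V) : IsReduction nab (redConn nab) where
  smooth _ hΩ := redConn_smooth nab hΩ
  compat U X Y X' Y' hX hY hX' hY' W h f hf e he := by
    have hU : U ⊓ (std n m V e.1).U ≤ U := inf_le_left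
    have hW : W ⊓ (std n m V e.1).U ≤ W := inf_le_left
    have heW : e.1 ∈ W ⊓ (std n m V e.1).U := ⟨he, mem_std_U e.1⟩
    have h1 := ((std n m V e.1).isLocalReduction_localConn nab).compat
      (U ⊓ (std n m V e.1).U) inf_le_right _ _ _ _ (hX.res hU) (hY.res hU) (hX'.res hU) (hY'.res hU)
      (W ⊓ (std n m V e.1).U) (inf_le_inf_right _ h) (O.res hW f) (fun x => hf ⟨x, hW x.2⟩) e heW
    rw [dirDeriv_eq, psi_pr, ← nab.res_cov, T.app_res, ← T.res_app _ h hW, psi_res hW _ heW] at h1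
    rw [dirDeriv_eq, psi_pr, redConn_apply, ← h1]
    refine DFunLike.congr_fun (dL_congr ?_) _
    filter_upwards [(isOpen_over (W ⊓ (std n m V e.1).U).2).mem_nhds heW] with e' he'
    exact (psi_res hW f he').symm

theorem IsChristoffelE.eq_redChristoffel {nab : SuperConnection n m V} {D : ConnE n m V}
    (hD : IsReduction nab D) {G : Idx n m → Idx n m → Idx n m → TotalSpace (Eu m) V → ℝ}
    (hG : c.IsChristoffelE D G) (s u r : Idx n m) {e : TotalSpace (Eu m) V} (he : e.1 ∈ c.U) :
    G s u r e = c.redChristoffel nab s u r e := by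
  have h1 := (hG s u e he).symm.trans ((hD.isLocalReduction c.U).cov_vf s u he he)
  have h2 := congrArg (c.comp r e) h1
  rwa [c.comp_sum_smul_vf r he, c.comp_sum_smul_vf r he] at h2

theorem isChristoffelE_redChristoffel {nab : SuperConnection n m V} {D : ConnE n m V}
    (hD : IsReduction nab D) : c.IsChristoffelE D (c.redChristoffel nab) := fun s u _ he =>
  (hD.isLocalReduction c.U).cov_vf s u he he

/-- An odd superfunction has no degree-zero part, and the coefficients of its degree-one part are
the reductions of its odd derivatives. -/
theorem psi_of_odd {W : Opens M} (h : W ≤ c.U) {f : O n m V W} (hf : O.IsHom 1 f)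
    {e : TotalSpace (Eu m) V} (he : e.1 ∈ W) :
    psi f.val e = ∑ δ, (c.triv e).2 δ * ((c.coordDer (.inr δ)).app h f).red e.1 := by
  rw [psi_eq h f he, affEval_of_odd _ (loc_odd hf _), dual_eq_sum (ιInv (c.loc f e.1)),
    LinearMap.sum_apply]
  refine Finset.sum_congr rfl fun δ _ => ?_
  rw [red_eq h _ he, loc_coordDer_inr _ _ _ _ he, contr, algebraMapInv_contract, mul_comm]
  rfl

end BundleCoords

end SuperRed

/-! ### The theorem. -/

theorem lemma3p5 (n m : ℕ) (M : Type*) [TopologicalSpace M] [T2Space M]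
    [SecondCountableTopology M] [ChartedSpace (SuperRed.Eu n) M] [IsManifold (𝓡 n) ∞ M]
    (V : M → Type*) [∀ x, AddCommGroup (V x)] [∀ x, Module ℝ (V x)]
    [TopologicalSpace (TotalSpace (SuperRed.Eu m) V)] [∀ x, TopologicalSpace (V x)]
    [FiberBundle (SuperRed.Eu m) V] [VectorBundle ℝ (SuperRed.Eu m) V]
    [ContMDiffVectorBundle ∞ (SuperRed.Eu m) V (𝓡 n)]
    (nab : SuperRed.SuperConnection n m V) :
    (∃ D : SuperRed.ConnE n m V, SuperRed.IsReduction nab D) ∧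
    ∀ D : SuperRed.ConnE n m V, SuperRed.IsReduction nab D →
    ∀ c : SuperRed.BundleCoords n m V,
      (∃! d : SuperRed.BundleCoords.Idx n m → SuperRed.T n m V c.U, c.IsCoordDer d) ∧
      ∀ d : SuperRed.BundleCoords.Idx n m → SuperRed.T n m V c.U, c.IsCoordDer d →
        (∃! Γ, c.IsSuperChristoffel nab d Γ) ∧
        (∃ G, c.IsChristoffelE D G) ∧
        ∀ Γ G, c.IsSuperChristoffel nab d Γ → c.IsChristoffelE D G →
        ∀ e : TotalSpace (SuperRed.Eu m) V, e.1 ∈ c.U →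
        ∀ (i j k : Fin n) (α β γ : Fin m),
          G (.inl i) (.inl j) (.inl k) e = (Γ (.inl i) (.inl j) (.inl k)).red e.1 ∧
          G (.inl i) (.inl j) (.inr α) e =
            ∑ δ : Fin m, (c.triv e).2 δ *
              ((d (.inr δ)).app le_rfl (Γ (.inl i) (.inl j) (.inr α))).red e.1 ∧
          G (.inl i) (.inr α) (.inr γ) e = (Γ (.inl i) (.inr α) (.inr γ)).red e.1 ∧
          G (.inr α) (.inl i) (.inr γ) e = (Γ (.inr α) (.inl i) (.inr γ)).red e.1 ∧
          G (.inl i) (.inr α) (.inl k) e = 0 ∧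
          G (.inr α) (.inl i) (.inl k) e = 0 ∧
          G (.inr α) (.inr β) (.inl k) e = 0 ∧
          G (.inr α) (.inr β) (.inr γ) e = 0 := by
  refine ⟨⟨_, SuperRed.BundleCoords.isReduction_redConn nab⟩, fun D hD c =>
    ⟨⟨c.coordDer, c.isCoordDer_coordDer, fun d hd => hd.unique⟩, fun d hd => ?_⟩⟩
  obtain rfl := hd.unique
  refine ⟨⟨c.superChristoffel nab, SuperRed.BundleCoords.isSuperChristoffel_superChristoffel nab,
    fun Γ hΓ => hΓ.unique⟩,
    ⟨c.redChristoffel nab, SuperRed.BundleCoords.isChristoffelE_redChristoffel hD⟩,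
    fun Γ G hΓ hG e he i j k α β γ => ?_⟩
  obtain rfl := hΓ.unique
  have hpar := SuperRed.BundleCoords.superChristoffel_isHom (c := c) nab
  -- Every reduction has the symbols `redChristoffel`. The entries with mixed lower indices and
  -- fibre upper index, and those with two lower fibre indices, then hold by definition; the others
  -- follow from the parity of Γ.
  simp only [hG.eq_redChristoffel hD _ _ _ he]
  exact ⟨SuperRed.BundleCoords.psi_even le_rfl (hpar (.inl i) (.inl j) (.inl k)) he,
    SuperRed.BundleCoords.psi_of_odd le_rfl (hpar (.inl i) (.inl j) (.inr α)) he, rfl, rfl,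
    SuperRed.BundleCoords.red_odd le_rfl (hpar (.inl i) (.inr α) (.inl k)) he,
    SuperRed.BundleCoords.red_odd le_rfl (hpar (.inr α) (.inl i) (.inl k)) he, rfl, rfl⟩
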